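/- Let $k$ be an algebraically closed field of characteristic two. A form $h\in k[x_1,x_2,x_3,x_4]$ is called non-degenerate if no invertible linear change of coordinates brings it to a polynomial in fewer than four variables. A scheme $X$ of characteristic $2$ with Frobenius morphism $F$ is called Frobenius split if the map of sheaves of $\mathcal O_X$-modules $\mathcal O_X\to F_*\mathcal O_X$, $a\mapsto a^2$, splits. For a cubic form $h$, let $X_h=\operatorname{Proj} k[x_1,x_2,x_3,x_4]/\langle h\rangle$ be the closed subscheme of $\mathbb P^3_k$ it defines. Let $h$ be a non-degenerate cubic form in four variables over $k$. Then $X_h$ fails to be Frobenius split if and only if, up to invertible linear change of coordinates, $h$ is exactly one of the following: 1. $x_1^3+x_2^3+x_3^3+x_4^3$, 2. $x_1^2x_4+x_2^3+x_1x_3^2$, 3. $x_1^2x_4+x_2^2x_3+x_1x_3^2$, 4. $x_1^2x_4+x_2^3+x_3^3$, 5. $x_1^2x_3+x_2^2x_4$. These five forms are non-degenerate, and no two of them are equivalent under an invertible linear change of coordinates. The first defines a surface that is smooth over $k$ and not Frobenius split, and it is the unique one: every non-zero cubic form $h$ such that $X_h$ is smooth over $k$ and not Frobenius split is equivalent to it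 under an invertible linear change of coordinates. Each of the surfaces defined by the second, third and fourth forms is normal, and its singular locus (the set of points whose local ring is not regular) is the single point $[0:0:0:1]$. The surface defined by the last form is not normal, and its singular locus is the line $x_1=x_2=0$. -/

import Mathlib

open MvPolynomial AlgebraicGeometry CategoryTheory

universe u

namespace CubicSurface

/-! ### Properties of schemes -/

/-- For a scheme `X` of prime characteristic `p`, the data of an `O_X`-linear left inverse
`φ : F_* O_X → O_X` of the map of sheaves of `O_X`-modules `O_X → F_* O_X`, `a ↦ a ^ p`.
As a sheaf of abelian groups `F_* O_X` is `O_X`, and a section `a` of `O_X` acts on it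
as multiplication by `a ^ p`. So `φ` is a family of additive endomorphisms of the groups
`Γ(X, U)` which commutes with restriction (`map_res`), satisfies `φ (a ^ p * s) = a * φ s`
(`map_pow_mul`), and sends `a ^ p` to `a` (`map_pow`). -/
structure FrobeniusSplitting (p : ℕ) (X : Scheme.{u}) where
  toFun : ∀ U : X.Opens, Γ(X, U) →+ Γ(X, U)
  map_res : ∀ {U V : X.Opens} (i : U ⟶ V) (s : Γ(X, V)),
    toFun U (X.presheaf.map i.op s) = X.presheaf.map i.op (toFun V s)
  map_pow_mul : ∀ (U : X.Opens) (a s : Γ(X, U)), toFun U (a ^ p * s) = a * toFun U s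
  map_pow : ∀ (U : X.Opens) (a : Γ(X, U)), toFun U (a ^ p) = a

/-- A scheme is *Frobenius split* if `O_X → F_* O_X` splits as a map of sheaves of `O_X`-modules. -/
def IsFrobeniusSplit (p : ℕ) (X : Scheme.{u}) : Prop :=
  Nonempty (FrobeniusSplitting p X)

/-- A scheme is normal if all its local rings are integrally closed domains. -/
def IsNormalScheme (X : Scheme.{u}) : Prop :=
  ∀ x : X, IsDomain (X.presheaf.stalk x) ∧ IsIntegrallyClosed (X.presheaf.stalk x)

/-- The singular locus: the set of points whose local ring is not regular. -/
def singularLocus (X : Scheme.{u}) : Set X :=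
  {x | ¬ IsRegularLocalRing (X.presheaf.stalk x)}

/-! ### Linear changes of coordinates -/

section Coordinates

variable {k : Type u} [Field k] {n : ℕ}

/-- The substitution `x_i ↦ ∑ j, g i j * x_j`. -/
noncomputable def linearSubst (g : Matrix (Fin n) (Fin n) k) :
    MvPolynomial (Fin n) k →ₐ[k] MvPolynomial (Fin n) k :=
  aeval fun i => ∑ j, C (g i j) * X j

/-- `f` becomes `h` after an invertible linear change of coordinates. -/
def LinearlyEquivalent (f h : MvPolynomial (Fin n) k) : Prop :=
  ∃ g : GL (Fin n) k, linearSubst (g : Matrix (Fin n) (Fin n) k) f = h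

/-- A form is non-degenerate if no invertible linear change of coordinates brings it to a
polynomial in fewer variables. -/
def IsNondegenerate (f : MvPolynomial (Fin n) k) : Prop :=
  ∀ g : GL (Fin n) k, ∀ i : Fin n, i ∈ (linearSubst (g : Matrix (Fin n) (Fin n) k) f).vars

end Coordinates

/-! ### The grading of the quotient of a graded algebra by a homogeneous ideal -/

section Quotient

variable {k A : Type u} [CommRing k] [CommRing A] [Algebra k A]
  (𝒜 : ℕ → Submodule k A) (I : Ideal A)

/-- The degree `n` part of `A ⧸ I` is the image of the degree `n` part of `A`. -/
def quotientGrading (n : ℕ) : Submodule k (A ⧸ I) :=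
  (𝒜 n).map (Ideal.Quotient.mkₐ k I).toLinearMap

theorem mk_mem_quotientGrading {n : ℕ} {a : A} (ha : a ∈ 𝒜 n) :
    Ideal.Quotient.mk I a ∈ quotientGrading 𝒜 I n :=
  ⟨a, ha, rfl⟩

variable [GradedAlgebra 𝒜]

theorem quotientGrading_gradedMonoid : SetLike.GradedMonoid (quotientGrading 𝒜 I) where
  one_mem := mk_mem_quotientGrading 𝒜 I SetLike.GradedOne.one_mem
  mul_mem := by
    rintro i j _ _ ⟨a, ha, rfl⟩ ⟨b, hb, rfl⟩
    exact ⟨a * b, SetLike.GradedMul.mul_mem ha hb, map_mul (Ideal.Quotient.mk I) _ _⟩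

/-- The map sending `a` to the family of the classes of its homogeneous components. -/
noncomputable def quotientComponents :
    A →ₗ[k] DirectSum ℕ fun n => quotientGrading 𝒜 I n :=
  (DirectSum.lmap fun n => (Ideal.Quotient.mkₐ k I).toLinearMap.submoduleMap (𝒜 n)) ∘ₗ
    (DirectSum.decomposeLinearEquiv 𝒜).toLinearMap

theorem quotientComponents_coe {n : ℕ} (a : 𝒜 n) :
    quotientComponents 𝒜 I a =
      DirectSum.of (fun n => quotientGrading 𝒜 I n) n ⟨_, mk_mem_quotientGrading 𝒜 I a.2⟩ := by
  simp only [quotientComponents, LinearMap.comp_apply, LinearEquiv.coe_coe,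
    DirectSum.decomposeLinearEquiv_apply, DirectSum.decompose_coe]
  exact DirectSum.lmap_lof _ _ _

theorem quotientComponents_eq_zero (hI : I.IsHomogeneous 𝒜) {a : A} (ha : a ∈ I) :
    quotientComponents 𝒜 I a = 0 := by
  refine DFinsupp.ext fun n => Subtype.ext ?_
  exact Ideal.Quotient.eq_zero_iff_mem.mpr (hI n ha)

/-- For a homogeneous ideal `I`, the map `quotientComponents` factors through `A ⧸ I`. -/
noncomputable def quotientDecompose (hI : I.IsHomogeneous 𝒜) :
    A ⧸ I →+ DirectSum ℕ fun n => quotientGrading 𝒜 I n :=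
  QuotientAddGroup.lift I.toAddSubgroup (quotientComponents 𝒜 I).toAddMonoidHom
    fun _ ha => quotientComponents_eq_zero 𝒜 I hI ha

/-- For a homogeneous ideal `I`, `quotientGrading` is a grading of `A ⧸ I`. -/
noncomputable abbrev quotientGradedAlgebra (hI : I.IsHomogeneous 𝒜) :
    GradedAlgebra (quotientGrading 𝒜 I) where
  toGradedMonoid := quotientGrading_gradedMonoid 𝒜 I
  toDecomposition := DirectSum.Decomposition.ofAddHom _
    (quotientDecompose 𝒜 I hI)
    (by
      refine AddMonoidHom.ext fun x => ?_
      obtain ⟨a, rfl⟩ := Ideal.Quotient.mk_surjective x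
      induction a using DirectSum.Decomposition.inductionOn 𝒜 with
      | zero => simp
      | add a b ha hb => rw [map_add, map_add, ha, hb, map_add]
      | homogeneous a =>
        change DirectSum.coeAddMonoidHom (quotientGrading 𝒜 I) (quotientComponents 𝒜 I a) = _
        rw [quotientComponents_coe]
        exact DirectSum.coeAddMonoidHom_of _ _ _)
    (by
      refine DirectSum.addHom_ext' fun n => AddMonoidHom.ext ?_
      rintro ⟨_, a, ha, rfl⟩
      change quotientDecompose 𝒜 I hI
        (DirectSum.coeAddMonoidHom (quotientGrading 𝒜 I)
          (DirectSum.of (fun n => quotientGrading 𝒜 I n) n _)) = _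
      rw [DirectSum.coeAddMonoidHom_of]
      exact quotientComponents_coe 𝒜 I (⟨a, ha⟩ : 𝒜 n))

end Quotient

/-! ### Cubic surfaces -/

section Surface

attribute [local instance] MvPolynomial.gradedAlgebra

variable (k : Type u) [Field k]

/-- Cubic forms in the variables `x₁ = X 0`, `x₂ = X 1`, `x₃ = X 2`, `x₄ = X 3`. -/
abbrev CubicForm : Type u := homogeneousSubmodule (Fin 4) k 3

variable {k}
variable (f : CubicForm k)

/-- The homogeneous coordinate ring `k[x₁, x₂, x₃, x₄] / (f)`. -/
noncomputable abbrev CoordRing : Type u :=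
  MvPolynomial (Fin 4) k ⧸ Ideal.span {(f : MvPolynomial (Fin 4) k)}

/-- The grading of the homogeneous coordinate ring by degree. -/
noncomputable abbrev coordGrading (n : ℕ) : Submodule k (CoordRing f) :=
  quotientGrading (homogeneousSubmodule (Fin 4) k) (Ideal.span {(f : MvPolynomial (Fin 4) k)}) n

theorem span_isHomogeneous :
    (Ideal.span {(f : MvPolynomial (Fin 4) k)}).IsHomogeneous (homogeneousSubmodule (Fin 4) k) :=
  Ideal.homogeneous_span _ _ (by rintro _ rfl; exact ⟨3, f.2⟩)

noncomputable instance : GradedAlgebra (coordGrading f) :=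
  quotientGradedAlgebra _ _ (span_isHomogeneous f)

/-- The subscheme of `ℙ³` defined by `f`, as the `Proj` of its homogeneous coordinate ring. -/
noncomputable def surface : Scheme.{u} := Proj (coordGrading f)

/-- The structure morphism of the surface over the ground field. -/
noncomputable def surfaceToSpec : surface f ⟶ Spec (CommRingCat.of k) :=
  Proj.toSpecZero (coordGrading f) ≫
    Spec.map (CommRingCat.ofHom (algebraMap k (coordGrading f 0)))

/-- The closed subset of the surface where the coordinates `x_i`, `i ∈ s`, vanish. -/
def coordLocus (s : Set (Fin 4)) : Set (surface f) :=
  ProjectiveSpectrum.zeroLocus (coordGrading f)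
    ((fun i => (Ideal.Quotient.mk _ (X i) : CoordRing f)) '' s)

variable (k)

/-- The five polynomials of the classification. -/
noncomputable def normalPoly : Fin 5 → MvPolynomial (Fin 4) k :=
  ![X 0 ^ 3 + X 1 ^ 3 + X 2 ^ 3 + X 3 ^ 3,
    X 0 ^ 2 * X 3 + X 1 ^ 3 + X 0 * X 2 ^ 2,
    X 0 ^ 2 * X 3 + X 1 ^ 2 * X 2 + X 0 * X 2 ^ 2,
    X 0 ^ 2 * X 3 + X 1 ^ 3 + X 2 ^ 3,
    X 0 ^ 2 * X 2 + X 1 ^ 2 * X 3]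

theorem normalPoly_isHomogeneous (i : Fin 5) : (normalPoly k i).IsHomogeneous 3 := by
  have h3 (i : Fin 4) : (X i ^ 3 : MvPolynomial (Fin 4) k).IsHomogeneous 3 := isHomogeneous_X_pow i 3
  have h21 (i j : Fin 4) : (X i ^ 2 * X j : MvPolynomial (Fin 4) k).IsHomogeneous 3 :=
    (isHomogeneous_X_pow i 2).mul (isHomogeneous_X k j)
  have h12 (i j : Fin 4) : (X i * X j ^ 2 : MvPolynomial (Fin 4) k).IsHomogeneous 3 :=
    (isHomogeneous_X k i).mul (isHomogeneous_X_pow j 2)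
  fin_cases i
  · exact (((h3 0).add (h3 1)).add (h3 2)).add (h3 3)
  · exact ((h21 0 3).add (h3 1)).add (h12 0 2)
  · exact ((h21 0 3).add (h21 1 2)).add (h12 0 2)
  · exact ((h21 0 3).add (h3 1)).add (h3 2)
  · exact (h21 0 2).add (h21 1 3)

/-- The five cubic forms of the classification. -/
noncomputable def normalForm (i : Fin 5) : CubicForm k :=
  ⟨normalPoly k i, (mem_homogeneousSubmodule 3 _).mpr (normalPoly_isHomogeneous k i)⟩

end Surface

end CubicSurface

open CubicSurface

/-!
A cubic form with a squarefree monomial `x_a x_b x_c` defines a Frobenius split surface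
(`isFrobeniusSplit_of_coeff_ne_zero`): if `x_l` is the remaining variable, the trace of the
polynomial ring over its subring of squares, twisted by `h * x_l`, descends to a multiple of a
splitting of the homogeneous coordinate ring, graded so that it induces a splitting of `Proj`.
Conversely, a non-zero form `∑ M i j * x_i ^ 2 * x_j` does not define a Frobenius split surface
(`not_isFrobeniusSplit`). With `L_i = ∑ j, M i j * x_j`, the fractions `x_i * L_i / w_i`, where
`w_i` is the product of the variables other than `x_i`, have as squares sums of fractions
`L_i * L_l / (x_j * x_m) ^ 2`, with `{i, l, j, m}` the four indices. As the latter are symmetric in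
`i` and `l`, applying a splitting and adding up over `i` yields a relation in the coordinate ring
in which everything cancels in characteristic two, and which lifts to an expression of a power of
the product of the variables by higher powers of the single variables. This is Fedder's criterion
for cubic surfaces.

So the surfaces in question are those of the forms `frobForm M`. Such a form corresponds to a
pairing `∑ M i j * u_i ^ 2 * v_j`, linear in `v` and Frobenius-linear in `u`, and linear changes of
coordinates correspond to changes of basis (`linearlyEquivalent_frobForm_iff`). The form is
non-degenerate if and only if the left and the right kernel of the pairing intersect trivially
(`isNondegenerate_frobForm_iff`). If the right kernel is zero, there is an orthonormal basis
(`IsFrobeniusPairing.exists_orthonormal`): the map `T` with `β w (T v) = (β v w) ^ 2` is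
semilinear, its fixed vectors span by Lang's theorem (`span_fixed_eq_top`), and the pairing
restricts to them as a hermitian form over the field with four elements. Otherwise both kernels are
non-zero, and a case analysis in dimension four leaves four more pairings
(`IsFrobeniusPairing.exists_normalMatrix`). The five pairings are told apart by invariants of their
kernels (`not_linearlyEquivalent_normalPoly`).

The geometry of the surfaces is studied on the four affine charts, which are hypersurfaces in
affine space (`chartEquiv`). A vector of the left kernel is a point where all partial derivatives
of the form vanish, so a smooth surface has a trivial left kernel, hence a trivial right kernel,
and is equivalent to the Fermat surface (`linearlyEquivalent_fermat_of_smooth`). A hypersurface is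
regular at a point if and only if its equation is not in the square of the maximal ideal
(`isRegularLocalRing_quotient_iff`), and applying derivations determines the singular loci
(`singularLocus_eq_coordLocus`). For normality, a domain is integrally closed if its localization
away from a radical element is (`isIntegrallyClosed_of_away`), so that normality spreads from the
chart of `x_0`, which is an affine plane, to the other charts. On the last surface, `x_1 / x_0` is
integral but not regular at `[0 : 0 : 0 : 1]` (`not_isNormalScheme_normalForm_four`).
-/


namespace CubicSurface

/-! ### Fixed vectors of semilinear maps -/

section Lang

variable {k V : Type*} [Field k] [AddCommGroup V] [Module k V]

theorem exists_minimal_iterate_mem_span [FiniteDimensional k V] (T : V → V) (v : V) :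
    ∃ m, LinearIndependent k (fun i : Fin m => T^[i] v) ∧
      T^[m] v ∈ Submodule.span k (Set.range fun i : Fin m => T^[i] v) := by
  classical
  have hex : ∃ m, ¬ LinearIndependent k (fun i : Fin (m + 1) => T^[i] v) := by
    refine ⟨Module.finrank k V, fun h => ?_⟩
    have := h.fintype_card_le_finrank
    simp at this
  have hlin : LinearIndependent k (fun i : Fin (Nat.find hex) => T^[i] v) := by
    rcases hm : Nat.find hex with _ | m
    · exact linearIndependent_empty_type
    · exact not_not.mp (Nat.find_min hex (m := m) (by omega))
  refine ⟨Nat.find hex, hlin, ?_⟩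
  by_contra hnot
  apply Nat.find_spec hex
  have := linearIndependent_finSnoc.mpr ⟨hlin, hnot⟩
  convert this using 1
  funext i
  refine Fin.lastCases ?_ (fun j => ?_) i
  · simp
  · simp

/-- The coefficient of `T ^ i v` in a fixed vector of a semilinear map `T` with
`T ^ m v = ∑ i < m, a i • T ^ i v`, as a polynomial in the coefficient of `T ^ (m - 1) v`. -/
noncomputable def fixedCoeff (q : ℕ) (a : ℕ → k) : ℕ → Polynomial k
  | 0 => Polynomial.C (a 0) * Polynomial.X ^ q
  | i + 1 => fixedCoeff q a i ^ q + Polynomial.C (a (i + 1)) * Polynomial.X ^ q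

theorem X_pow_dvd_fixedCoeff {q : ℕ} (hq : 2 ≤ q) (a : ℕ → k) (i : ℕ) :
    (Polynomial.X : Polynomial k) ^ q ∣ fixedCoeff q a i := by
  induction i with
  | zero => exact Dvd.intro_left _ rfl
  | succ i ih =>
    exact dvd_add (dvd_pow ih (by omega)) (Dvd.intro_left _ rfl)

/-- The `q`-th power in the recursion is divisible by a higher power of the variable than `q`,
so the coefficient of degree `q` determines the last `a j`. -/
theorem eq_zero_of_fixedCoeff_eq_zero {q : ℕ} (hq : 2 ≤ q) (a : ℕ → k) (i : ℕ)
    (h : fixedCoeff q a i = 0) : ∀ j ≤ i, a j = 0 := by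
  induction i with
  | zero =>
    intro j hj
    obtain rfl : j = 0 := by omega
    simpa [fixedCoeff] using h
  | succ i ih =>
    have hdvd : (Polynomial.X : Polynomial k) ^ (q + 1) ∣ fixedCoeff q a i ^ q := by
      refine dvd_trans (pow_dvd_pow Polynomial.X ?_)
        (pow_mul (Polynomial.X : Polynomial k) q q ▸ pow_dvd_pow_of_dvd
          (X_pow_dvd_fixedCoeff hq a i) q)
      nlinarith
    have ha : a (i + 1) = 0 := by
      obtain ⟨c, hc⟩ := hdvd
      have hcoeff := congrArg (fun p => p.coeff q) h
      simp only [fixedCoeff, hc, Polynomial.coeff_add, Polynomial.coeff_C_mul,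
        Polynomial.coeff_X_pow, if_true, mul_one, Polynomial.coeff_zero,
        Polynomial.coeff_X_pow_mul', if_neg (show ¬ q + 1 ≤ q by omega), zero_add] at hcoeff
      exact hcoeff
    have h0 : fixedCoeff q a i = 0 := by
      simp only [fixedCoeff, ha, Polynomial.C_0, zero_mul, add_zero] at h
      exact pow_eq_zero_iff (by omega) |>.mp h
    intro j hj
    rcases Nat.lt_or_ge i j with hlt | hge
    · obtain rfl : j = i + 1 := by omega
      exact ha
    · exact ih h0 j hge

theorem exists_ne_zero_eval_fixedCoeff [IsAlgClosed k] {q : ℕ} (hq : 2 ≤ q) (a : ℕ → k) (i : ℕ)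
    (h : ∃ j ≤ i, a j ≠ 0) : ∃ y : k, y ≠ 0 ∧ (fixedCoeff q a i).eval y = y := by
  have h0 : fixedCoeff q a i ≠ 0 := fun h0 => by
    obtain ⟨j, hj, hne⟩ := h
    exact hne (eq_zero_of_fixedCoeff_eq_zero hq a i h0 j hj)
  obtain ⟨R, hR⟩ := X_pow_dvd_fixedCoeff hq a i
  have hR0 : R ≠ 0 := by rintro rfl; exact h0 (by rw [hR, mul_zero])
  -- Writing `fixedCoeff q a i = X ^ q * R`, the difference `fixedCoeff q a i - X` is `X` times
  -- `X ^ (q - 1) * R - 1`, and the latter has only non-zero roots.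
  have hnat : (Polynomial.X ^ (q - 1) * R).natDegree = q - 1 + R.natDegree := by
    rw [Polynomial.natDegree_mul (pow_ne_zero _ Polynomial.X_ne_zero) hR0,
      Polynomial.natDegree_X_pow]
  have hdeg : (Polynomial.X ^ (q - 1) * R - Polynomial.C 1).natDegree = q - 1 + R.natDegree := by
    rw [Polynomial.natDegree_sub_C, hnat]
  obtain ⟨y, hy⟩ := IsAlgClosed.exists_root (Polynomial.X ^ (q - 1) * R - Polynomial.C 1)
    (by intro hd; have := Polynomial.natDegree_eq_zero_iff_degree_le_zero.mpr hd.le; omega)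
  have hy' : y ^ (q - 1) * R.eval y = 1 := by
    simpa [sub_eq_zero, Polynomial.IsRoot] using hy
  refine ⟨y, ?_, ?_⟩
  · rintro rfl
    rw [zero_pow (by omega), zero_mul] at hy'
    exact zero_ne_one hy'
  · rw [hR, Polynomial.eval_mul, Polynomial.eval_pow, Polynomial.eval_X]
    calc y ^ q * R.eval y = y * (y ^ (q - 1) * R.eval y) := by
          rw [← mul_assoc, ← pow_succ', Nat.sub_add_cancel (by omega)]
      _ = y := by rw [hy', mul_one]

variable [IsAlgClosed k] {σ : k →+* k} {q : ℕ}

/-- Over an algebraically closed field, an injective semilinear map over a power map of the field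
fixes a non-zero vector: inside the span of the iterates of one vector, being fixed amounts to
one polynomial equation in one unknown. -/
theorem exists_fixed_ne_zero [FiniteDimensional k V] [Nontrivial V] (hq : 2 ≤ q)
    (hσ : ∀ x, σ x = x ^ q) (T : V →ₛₗ[σ] V) (hT : Function.Injective T) :
    ∃ x, x ≠ 0 ∧ T x = x := by
  obtain ⟨v, hv⟩ := exists_ne (0 : V)
  obtain ⟨m, hlin, hmem⟩ := exists_minimal_iterate_mem_span (k := k) T v
  have hit : ∀ n, T^[n] v ≠ 0 := by
    intro n
    induction n with
    | zero => exact hv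
    | succ n ih =>
      rw [Function.iterate_succ_apply']
      exact fun h => ih (hT (h.trans (map_zero T).symm))
  obtain ⟨c, hc⟩ := (Submodule.mem_span_range_iff_exists_fun k).mp hmem
  rcases m with _ | m
  · exact absurd (by simpa using hc.symm) (hit 0)
  set a : ℕ → k := fun i => if h : i < m + 1 then c ⟨i, h⟩ else 0 with ha
  have hac : ∀ i : Fin (m + 1), c i = a i := by intro i; simp only [ha, i.2, dif_pos, Fin.eta]
  have hsum : T^[m + 1] v = ∑ i ∈ Finset.range (m + 1), a i • T^[i] v := by
    rw [← hc, Finset.sum_range]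
    exact Finset.sum_congr rfl fun i _ => by rw [hac]
  have hane : ∃ j ≤ m, a j ≠ 0 := by
    by_contra! hall
    refine hit (m + 1) ?_
    rw [hsum]
    exact Finset.sum_eq_zero fun i hi => by
      rw [hall i (by simpa [Nat.lt_succ_iff] using hi), zero_smul]
  obtain ⟨y, hy0, hy⟩ := exists_ne_zero_eval_fixedCoeff hq a m hane
  set b : ℕ → k := fun i => (fixedCoeff q a i).eval y with hb
  have hb0 : b 0 = a 0 * y ^ q := by simp [hb, fixedCoeff]
  have hbs : ∀ i, b (i + 1) = b i ^ q + a (i + 1) * y ^ q := by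
    intro i; simp [hb, fixedCoeff]
  have hbm : b m = y := hy
  refine ⟨∑ i ∈ Finset.range (m + 1), b i • T^[i] v, ?_, ?_⟩
  · intro h0
    rw [Finset.sum_range] at h0
    have := (Fintype.linearIndependent_iff.mp hlin) (fun i => b i) h0 (Fin.last m)
    rw [Fin.val_last, hbm] at this
    exact hy0 this
  · rw [map_sum]
    simp only [map_smulₛₗ, hσ, ← Function.iterate_succ_apply']
    rw [Finset.sum_range_succ, hbm, hsum, Finset.smul_sum, Finset.sum_range_succ',
      Finset.sum_range_succ' (fun i => b i • T^[i] v), hb0, ← add_assoc,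
      ← Finset.sum_add_distrib]
    congr 1
    · refine Finset.sum_congr rfl fun i _ => ?_
      rw [hbs, add_smul, smul_smul, mul_comm (y ^ q)]
    · rw [smul_smul, mul_comm]

/-- Lang's theorem for semilinear maps: the fixed vectors of an injective semilinear map over a
power map of an algebraically closed field span the space. Otherwise the quotient by their span has
a non-zero fixed vector, and solving `d ^ q - d + c = 0` for the coefficients of its defect lifts
it to a fixed vector of the whole space. -/
theorem span_fixed_eq_top [FiniteDimensional k V] (hq : 2 ≤ q)
    (hσ : ∀ x, σ x = x ^ q) (T : V →ₛₗ[σ] V) (hT : Function.Injective T) :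
    Submodule.span k {x | T x = x} = ⊤ := by
  set U := Submodule.span k {x | T x = x} with hU
  have hroot : ∀ c : k, ∃ d, d ^ q = c := fun c => IsAlgClosed.exists_pow_nat_eq c (by omega)
  have hmem : ∀ u ∈ U, ∃ (n : ℕ) (f : Fin n → k) (g : Fin n → {x | T x = x}),
      ∑ i, f i • (g i : V) = u := fun u hu => (Submodule.mem_span_set').mp hu
  have hTU : ∀ u ∈ U, T u ∈ U := by
    intro u hu
    obtain ⟨n, f, g, rfl⟩ := hmem u hu
    rw [map_sum]
    refine Submodule.sum_mem _ fun i _ => ?_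
    rw [map_smulₛₗ]
    exact U.smul_mem _ (by rw [(g i).2]; exact Submodule.subset_span (g i).2)
  -- `T` maps the span onto itself, hence is injective on the quotient.
  have hsurj : ∀ u ∈ U, ∃ u' ∈ U, T u' = u := by
    intro u hu
    obtain ⟨n, f, g, rfl⟩ := hmem u hu
    choose d hd using fun i => hroot (f i)
    refine ⟨∑ i, d i • (g i : V), Submodule.sum_mem _ fun i _ => U.smul_mem _
      (Submodule.subset_span (g i).2), ?_⟩
    rw [map_sum]
    exact Finset.sum_congr rfl fun i _ => by rw [map_smulₛₗ, hσ, hd, (g i).2]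
  -- The map `u' ↦ u' - T u'` is onto on the span.
  have hAS : ∀ u ∈ U, ∃ u' ∈ U, T u' + u = u' := by
    intro u hu
    obtain ⟨n, f, g, rfl⟩ := hmem u hu
    have : ∀ c : k, ∃ d : k, d ^ q + c = d := by
      intro c
      have hX : (Polynomial.X : Polynomial k).degree <
          (Polynomial.X ^ q : Polynomial k).degree := by
        rw [Polynomial.degree_X_pow, Polynomial.degree_X]; exact_mod_cast hq
      have hd : (Polynomial.X ^ q - Polynomial.X + Polynomial.C c : Polynomial k).degree = q := by
        have h1 : (Polynomial.X ^ q - Polynomial.X : Polynomial k).degree = q := by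
          rw [Polynomial.degree_sub_eq_left_of_degree_lt hX, Polynomial.degree_X_pow]
        rw [Polynomial.degree_add_C (by rw [h1]; exact_mod_cast (by omega : 0 < q)), h1]
      obtain ⟨d, hd⟩ := IsAlgClosed.exists_root
        (Polynomial.X ^ q - Polynomial.X + Polynomial.C c : Polynomial k)
        (by rw [hd]; exact_mod_cast (by omega : q ≠ 0))
      refine ⟨d, ?_⟩
      have hd' : d ^ q - d + c = 0 := by simpa [Polynomial.IsRoot] using hd
      linear_combination hd'
    choose d hd using fun i => this (f i)
    refine ⟨∑ i, d i • (g i : V), Submodule.sum_mem _ fun i _ => U.smul_mem _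
      (Submodule.subset_span (g i).2), ?_⟩
    rw [map_sum, ← Finset.sum_add_distrib]
    refine Finset.sum_congr rfl fun i _ => ?_
    rw [map_smulₛₗ, hσ, (g i).2, ← add_smul, hd]
  by_contra hne
  have : Nontrivial (V ⧸ U) := Submodule.Quotient.nontrivial_iff.mpr hne
  obtain ⟨x, hx0, hx⟩ := exists_fixed_ne_zero hq hσ (U.mapQ U T hTU) (by
    rw [injective_iff_map_eq_zero]
    intro x hx
    obtain ⟨w, rfl⟩ := U.mkQ_surjective x
    rw [Submodule.mkQ_apply, Submodule.mapQ_apply, Submodule.Quotient.mk_eq_zero] at hx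
    obtain ⟨u', hu', h⟩ := hsurj _ hx
    rw [hT h] at hu'
    simpa using hu')
  obtain ⟨w, rfl⟩ := U.mkQ_surjective x
  rw [Submodule.mkQ_apply, Submodule.mapQ_apply, Submodule.Quotient.eq] at hx
  obtain ⟨u', hu', h⟩ := hAS _ hx
  apply hx0
  rw [Submodule.mkQ_apply, Submodule.Quotient.mk_eq_zero]
  have hfix : T (w + u') = w + u' := by
    rw [map_add]; nth_rewrite 2 [← h]; abel
  have : w + u' ∈ U := Submodule.subset_span hfix
  simpa using U.sub_mem this hu'

end Lang

/-! ### Pairings that are quadratic in one argument and linear in the other -/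

/-- A function `β` of two vectors that is linear in the second one, and additive and homogeneous
of degree two in the first one. In characteristic two it is bilinear up to a Frobenius twist of the
first argument. -/
structure IsFrobeniusPairing {k V : Type*} [Field k] [AddCommGroup V] [Module k V]
    (β : V → V → k) : Prop where
  add_left : ∀ u u' v, β (u + u') v = β u v + β u' v
  smul_left : ∀ (c : k) u v, β (c • u) v = c ^ 2 * β u v
  add_right : ∀ u v v', β u (v + v') = β u v + β u v'
  smul_right : ∀ (c : k) u v, β u (c • v) = c * β u v

namespace IsFrobeniusPairing

variable {k V : Type*} [Field k] [AddCommGroup V] [Module k V] {β : V → V → k}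

/-- The linear functional `β u`. -/
def right (hβ : IsFrobeniusPairing β) (u : V) : V →ₗ[k] k where
  toFun := β u
  map_add' := hβ.add_right u
  map_smul' c v := hβ.smul_right c u v

theorem zero_right (hβ : IsFrobeniusPairing β) (u : V) : β u 0 = 0 := map_zero (hβ.right u)

theorem zero_left (hβ : IsFrobeniusPairing β) (v : V) : β 0 v = 0 := by
  have := hβ.smul_left 0 0 v
  simpa using this

theorem sum_right (hβ : IsFrobeniusPairing β) {ι : Type*} (s : Finset ι) (u : V) (f : ι → V) :
    β u (∑ i ∈ s, f i) = ∑ i ∈ s, β u (f i) := map_sum (hβ.right u) f s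

theorem sum_left (hβ : IsFrobeniusPairing β) {ι : Type*} (s : Finset ι) (f : ι → V) (v : V) :
    β (∑ i ∈ s, f i) v = ∑ i ∈ s, β (f i) v :=
  map_sum (AddMonoidHom.mk' (fun u => β u v) fun u u' => hβ.add_left u u' v) f s

theorem restrict (hβ : IsFrobeniusPairing β) (U : Submodule k V) :
    IsFrobeniusPairing fun u v : U => β u v where
  add_left u u' v := hβ.add_left u u' v
  smul_left c u v := hβ.smul_left c u v
  add_right u v v' := hβ.add_right u v v'
  smul_right c u v := hβ.smul_right c u v

/-- The values of a pairing on a basis, as a linear map in the second argument. -/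
noncomputable def evalBasis (hβ : IsFrobeniusPairing β) {n : ℕ} (e : Module.Basis (Fin n) k V) :
    V →ₗ[k] Fin n → k :=
  LinearMap.pi fun i => hβ.right (e i)

theorem evalBasis_apply (hβ : IsFrobeniusPairing β) {n : ℕ} (e : Module.Basis (Fin n) k V)
    (v : V) (i : Fin n) : hβ.evalBasis e v i = β (e i) v := rfl

theorem eq_sum_left (hβ : IsFrobeniusPairing β) {n : ℕ} (e : Module.Basis (Fin n) k V) (u v : V) :
    β u v = ∑ i, e.repr u i ^ 2 * β (e i) v := by
  conv_lhs => rw [← e.sum_repr u, hβ.sum_left]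
  exact Finset.sum_congr rfl fun i _ => hβ.smul_left _ _ _

theorem eq_sum_right (hβ : IsFrobeniusPairing β) {n : ℕ} (e : Module.Basis (Fin n) k V) (u v : V) :
    β u v = ∑ i, e.repr v i * β u (e i) := by
  conv_lhs => rw [← e.sum_repr v, hβ.sum_right]
  exact Finset.sum_congr rfl fun i _ => hβ.smul_right _ _ _

variable [FiniteDimensional k V]

theorem evalBasis_surjective (hβ : IsFrobeniusPairing β)
    (hr : ∀ v, (∀ u, β u v = 0) → v = 0) (e : Module.Basis (Fin (Module.finrank k V)) k V) :
    Function.Surjective (hβ.evalBasis e) := by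
  rw [← LinearMap.injective_iff_surjective_of_finrank_eq_finrank (by simp),
    injective_iff_map_eq_zero]
  intro v hv
  refine hr v fun u => ?_
  rw [hβ.eq_sum_left e]
  exact Finset.sum_eq_zero fun i _ => by
    rw [← hβ.evalBasis_apply e v i, hv, Pi.zero_apply, mul_zero]

theorem eq_zero_of_left (hβ : IsFrobeniusPairing β)
    (hr : ∀ v, (∀ u, β u v = 0) → v = 0) (u : V) (hu : ∀ v, β u v = 0) : u = 0 := by
  classical
  set e := Module.finBasis k V
  refine e.repr.injective (Finsupp.ext fun j => ?_)
  obtain ⟨z, hz⟩ := hβ.evalBasis_surjective hr e (Pi.single j 1)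
  have := hu z
  rw [hβ.eq_sum_left e] at this
  simp only [← hβ.evalBasis_apply e, hz] at this
  simpa [Pi.single_apply] using this

/-- A pairing with a non-zero right kernel has a non-zero left kernel: its matrix is square, and
square roots of the coefficients of a relation between the rows give a vector in the left kernel. -/
theorem exists_left_kernel [IsAlgClosed k] (hβ : IsFrobeniusPairing β) {r : V} (hr0 : r ≠ 0)
    (hr : ∀ u, β u r = 0) : ∃ l, l ≠ 0 ∧ ∀ v, β l v = 0 := by
  classical
  set e := Module.finBasis k V
  have hns : LinearMap.range (hβ.evalBasis e) < ⊤ := by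
    rw [lt_top_iff_ne_top, Ne, LinearMap.range_eq_top,
      ← LinearMap.injective_iff_surjective_of_finrank_eq_finrank (by simp)]
    intro hinj
    exact hr0 (hinj (by rw [map_zero]; ext i; exact hr _))
  obtain ⟨f, hf0, hf⟩ := Submodule.exists_le_ker_of_lt_top _ hns
  choose d hd using fun i => IsAlgClosed.exists_pow_nat_eq (f (Pi.single i 1)) (n := 2) (by omega)
  refine ⟨∑ i, d i • e i, fun h0 => hf0 ?_, fun v => ?_⟩
  · have hd0 := Fintype.linearIndependent_iff.mp e.linearIndependent d h0
    refine (Pi.basisFun k _).ext fun i => ?_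
    rw [Pi.basisFun_apply, ← hd, hd0]
    simp
  · have h0 : f (hβ.evalBasis e v) = 0 := hf ⟨v, rfl⟩
    rw [hβ.sum_left, ← h0]
    conv_rhs => rw [← Finset.univ_sum_single (hβ.evalBasis e v), map_sum]
    refine Finset.sum_congr rfl fun i _ => ?_
    rw [hβ.smul_left, hd, ← hβ.evalBasis_apply e, mul_comm, ← smul_eq_mul, ← map_smul,
      ← Pi.single_smul, smul_eq_mul, mul_one]

variable [IsAlgClosed k] [CharP k 2]

/-- A non-degenerate pairing `β` takes the value `1` at some `(v, v)` with
`β w v = (β v w) ^ 2` for all `w`. Such `v` are sought among the fixed vectors of the semilinear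
map `T` with `β w (T v) = (β v w) ^ 2`: these span the space, and `β` restricts to them as a
hermitian form over the field with four elements. -/
theorem exists_hermitian_unit_vector [Nontrivial V] (hβ : IsFrobeniusPairing β)
    (hr : ∀ v, (∀ u, β u v = 0) → v = 0) :
    ∃ v, β v v = 1 ∧ ∀ w, β w v = β v w ^ 2 := by
  set e := Module.finBasis k V
  have hex : ∀ v, ∃ z, ∀ w, β w z = β v w ^ 2 := by
    intro v
    obtain ⟨z, hz⟩ := hβ.evalBasis_surjective hr e fun i => β v (e i) ^ 2
    refine ⟨z, fun w => ?_⟩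
    rw [hβ.eq_sum_left e, hβ.eq_sum_right e v w, sum_pow_char]
    refine Finset.sum_congr rfl fun i _ => ?_
    rw [mul_pow, ← hβ.evalBasis_apply e z i, hz]
  choose T hT using hex
  have huniq : ∀ z z', (∀ w, β w z = β w z') → z = z' := by
    intro z z' h
    rw [← sub_eq_zero]
    refine hr _ fun u => ?_
    have : hβ.right u (z - z') = 0 := by rw [map_sub]; exact sub_eq_zero.mpr (h u)
    exact this
  let T' : V →ₛₗ[iterateFrobenius k 2 2] V :=
    { toFun := T
      map_add' := fun u v => huniq _ _ fun w => by
        rw [hT, hβ.add_right, hT, hT, hβ.add_left, add_pow_char]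
      map_smul' := fun c v => huniq _ _ fun w => by
        rw [hT, hβ.smul_right, hT, hβ.smul_left, iterateFrobenius_def]; ring }
  have hspan := span_fixed_eq_top (q := 4) (by norm_num)
    (fun x => by rw [iterateFrobenius_def]; norm_num) T' (by
      rw [injective_iff_map_eq_zero]
      intro v hv
      refine hβ.eq_zero_of_left hr v fun w => ?_
      have h1 := hT v w
      rw [show T v = 0 from hv, hβ.zero_right] at h1
      exact pow_eq_zero_iff (two_ne_zero) |>.mp h1.symm)
  have hherm : ∀ v, T v = v → ∀ w, β w v = β v w ^ 2 := by
    intro v hv w; rw [← hT, hv]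
  by_cases hv : ∃ v, T v = v ∧ β v v ≠ 0
  · obtain ⟨v, hTv, hv⟩ := hv
    refine ⟨v, ?_, hherm v hTv⟩
    have h1 := hherm v hTv v
    have : β v v * (β v v - 1) = 0 := by linear_combination -h1
    exact sub_eq_zero.mp ((mul_eq_zero.mp this).resolve_left hv)
  · exfalso
    push Not at hv
    have hzero : ∀ v w, T v = v → T w = w → β v w = 0 := by
      intro v w hTv hTw
      by_contra hx
      -- `β v w` times a primitive cube root of unity would have trace zero.
      obtain ⟨c, hc⟩ : ∃ c : k, c ^ 2 + c + 1 = 0 := by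
        obtain ⟨c, hc⟩ := IsAlgClosed.exists_root
          (Polynomial.X ^ 2 + Polynomial.X + 1 : Polynomial k) (by
            have : (Polynomial.X ^ 2 + Polynomial.X + 1 : Polynomial k).natDegree = 2 := by
              compute_degree!
            intro h
            have h0 := Polynomial.natDegree_eq_zero_iff_degree_le_zero.mpr h.le
            omega)
        exact ⟨c, by simpa [Polynomial.IsRoot] using hc⟩
      have hTc : T (c • w) = c • w := by
        have h4 : c ^ 4 = c := by linear_combination (c ^ 2 - c) * hc
        have := T'.map_smulₛₗ c w
        rw [iterateFrobenius_def] at this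
        calc T (c • w) = c ^ 2 ^ 2 • T w := this
          _ = c • w := by rw [hTw, show (2 : ℕ) ^ 2 = 4 by norm_num, h4]
      have hadd : ∀ u, T u = u → β v u + β v u ^ 2 = 0 := by
        intro u hTu
        have h := hv (v + u) (by
          calc T (v + u) = T v + T u := T'.map_add v u
            _ = v + u := by rw [hTv, hTu])
        rwa [hβ.add_left, hβ.add_right, hβ.add_right, hv v hTv, hv u hTu, zero_add, add_zero,
          hherm v hTv u] at h
      have h1 := hadd w hTw
      have h2 := hadd (c • w) hTc
      rw [hβ.smul_right] at h2
      have h3 : β v w = 1 := by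
        have : β v w * (β v w + 1) = 0 := by linear_combination h1
        have := (mul_eq_zero.mp this).resolve_left hx
        rwa [CharTwo.add_eq_zero] at this
      rw [h3] at h2
      have : (1 : k) = 0 := by linear_combination hc - h2
      exact one_ne_zero this
    obtain ⟨x, hx0⟩ := exists_ne (0 : V)
    refine hx0 (hr x fun u => ?_)
    clear hx0
    have hu : u ∈ Submodule.span k {x | T' x = x} := by rw [hspan]; trivial
    have hx : x ∈ Submodule.span k {x | T' x = x} := by rw [hspan]; trivial
    induction hu using Submodule.span_induction with
    | zero => exact hβ.zero_left _
    | add u u' _ _ h h' => rw [hβ.add_left, h, h', add_zero]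
    | smul c u _ h => rw [hβ.smul_left, h, mul_zero]
    | mem u hu =>
      induction hx using Submodule.span_induction with
      | zero => exact hβ.zero_right _
      | add u u' _ _ h h' => rw [hβ.add_right, h, h', add_zero]
      | smul c u _ h => rw [hβ.smul_right, h, mul_zero]
      | mem v hv => exact hzero u v hu hv

omit [FiniteDimensional k V] in
/-- Over an algebraically closed field of characteristic two, every non-degenerate pairing has an
orthonormal basis: the orthogonal complement of a unit vector from `exists_hermitian_unit_vector`
is again non-degenerate. -/
theorem exists_orthonormal (n : ℕ) (hβ : IsFrobeniusPairing β) [FiniteDimensional k V]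
    (hn : Module.finrank k V = n) (hr : ∀ v, (∀ u, β u v = 0) → v = 0) :
    ∃ b : Fin n → V, ∀ i j, β (b i) (b j) = if i = j then 1 else 0 := by
  induction n generalizing V with
  | zero => exact ⟨Fin.elim0, fun i => i.elim0⟩
  | succ n ih =>
    have : Nontrivial V := Module.nontrivial_of_finrank_pos (R := k) (by omega)
    obtain ⟨v, hv, hherm⟩ := hβ.exists_hermitian_unit_vector hr
    have hker : Module.finrank k (LinearMap.ker (hβ.right v)) = n := by
      have h1 := LinearMap.finrank_range_add_finrank_ker (hβ.right v)
      have h2 : LinearMap.range (hβ.right v) = ⊤ := by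
        rw [LinearMap.range_eq_top]
        exact fun c => ⟨c • v, by rw [map_smul]; change c * β v v = c; rw [hv, mul_one]⟩
      rw [h2, finrank_top, Module.finrank_self] at h1
      omega
    have hmem : ∀ w : LinearMap.ker (hβ.right v), β v w = 0 := fun w => w.2
    have hmem' : ∀ w : LinearMap.ker (hβ.right v), β w v = 0 := fun w => by
      rw [hherm, hmem, zero_pow two_ne_zero]
    obtain ⟨b, hb⟩ := ih (hβ.restrict _) hker (by
      intro w hw
      refine Subtype.ext (hr w fun u => ?_)
      have hu : u + β v u • v ∈ LinearMap.ker (hβ.right v) := by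
        change β v _ = 0
        rw [hβ.add_right, hβ.smul_right, hv, mul_one, CharTwo.add_self_eq_zero]
      have := hw ⟨_, hu⟩
      rwa [hβ.add_left, hβ.smul_left, hmem w, mul_zero, add_zero] at this)
    refine ⟨Fin.cons v fun i => b i, fun i j => ?_⟩
    refine Fin.cases ?_ (fun i => ?_) i <;> refine Fin.cases ?_ (fun j => ?_) j
    · simp [hv]
    · simpa [(Fin.succ_ne_zero j).symm] using hmem (b j)
    · simpa using hmem' (b i)
    · simpa using hb i j

end IsFrobeniusPairing

/-! ### Normal forms of pairings on a four-dimensional space -/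

variable {k V : Type*} [Field k] [AddCommGroup V] [Module k V] {β : V → V → k}

/-- The coefficients of `x_i ^ 2 * x_j` in the five forms of the classification. -/
def normalMatrix (k : Type*) [Field k] : Fin 5 → Matrix (Fin 4) (Fin 4) k :=
  ![!![1, 0, 0, 0; 0, 1, 0, 0; 0, 0, 1, 0; 0, 0, 0, 1],
    !![0, 0, 0, 1; 0, 1, 0, 0; 1, 0, 0, 0; 0, 0, 0, 0],
    !![0, 0, 0, 1; 0, 0, 1, 0; 1, 0, 0, 0; 0, 0, 0, 0],
    !![0, 0, 0, 1; 0, 1, 0, 0; 0, 0, 1, 0; 0, 0, 0, 0],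
    !![0, 0, 1, 0; 0, 0, 0, 1; 0, 0, 0, 0; 0, 0, 0, 0]]

namespace IsFrobeniusPairing

/-- If vectors `r` and `l` of the right and the left kernel pair to a non-zero value, they split
off as a direct summand, and the complementary plane is either non-degenerate or of the same kind.
-/
theorem exists_of_kernels_pairing [FiniteDimensional k V] [IsAlgClosed k] [CharP k 2]
    (hβ : IsFrobeniusPairing β) (hV : Module.finrank k V = 4)
    (hnd : ∀ v, (∀ u, β v u = 0) → (∀ u, β u v = 0) → v = 0)
    {r l : V} (hr : ∀ u, β u r = 0) (hl : ∀ v, β l v = 0) (hrl : β r l ≠ 0) :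
    (∃ b : Fin 4 → V, ∀ i j, β (b i) (b j) = normalMatrix k 3 i j) ∨
      ∃ b : Fin 4 → V, ∀ i j, β (b i) (b j) = normalMatrix k 4 i j := by
  wlog h1 : β r l = 1 generalizing l
  · exact this (l := (β r l)⁻¹ • l) (fun v => by rw [hβ.smul_left, hl, mul_zero])
      (by rw [hβ.smul_right, inv_mul_cancel₀ hrl]; exact one_ne_zero)
      (by rw [hβ.smul_right, inv_mul_cancel₀ hrl])
  -- The common orthogonal complement of `r` and `l`.
  let U : Submodule k V :=
    { carrier := {w | β w l = 0 ∧ β r w = 0}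
      zero_mem' := ⟨hβ.zero_left _, hβ.zero_right _⟩
      add_mem' := fun {a b} ha hb => ⟨by rw [hβ.add_left, ha.1, hb.1, add_zero],
        by rw [hβ.add_right, ha.2, hb.2, add_zero]⟩
      smul_mem' := fun c w hw => ⟨by rw [hβ.smul_left, hw.1, mul_zero],
        by rw [hβ.smul_right, hw.2, mul_zero]⟩ }
  have hUl : ∀ w : U, β w l = 0 := fun w => w.2.1
  have hUr : ∀ w : U, β r w = 0 := fun w => w.2.2
  have hVV : ∀ v : V, v + v = 0 := fun v => by
    rw [← two_smul k, CharTwo.two_eq_zero, zero_smul]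
  have hdec : ∀ v, ∃ (w : U) (a c : k), v = w + a • r + c • l := by
    intro v
    obtain ⟨a, ha⟩ := IsAlgClosed.exists_pow_nat_eq (β v l) (n := 2) (by omega)
    refine ⟨⟨v + a • r + β r v • l, ?_, ?_⟩, a, β r v, ?_⟩
    · rw [hβ.add_left, hβ.add_left, hβ.smul_left, hβ.smul_left, hl, ha, h1]
      linear_combination CharTwo.add_self_eq_zero (β v l)
    · rw [hβ.add_right, hβ.add_right, hβ.smul_right, hβ.smul_right, hr, h1]
      linear_combination CharTwo.add_self_eq_zero (β r v)
    · have h2 := hVV (a • r)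
      have h3 := hVV (β r v • l)
      rw [add_assoc (v + a • r), add_comm (β r v • l), ← add_assoc, add_assoc v, h2, add_zero,
        add_assoc, h3, add_zero]
  have hli : LinearIndependent k ![r, l] := by
    rw [LinearIndependent.pair_iff]
    intro a c hac
    constructor
    · have := hβ.zero_left l
      rw [← hac, hβ.add_left, hβ.smul_left, hβ.smul_left, hl, h1] at this
      simpa using this
    · have := hβ.zero_right r
      rw [← hac, hβ.add_right, hβ.smul_right, hβ.smul_right, hr, h1] at this
      simpa using this
  have hcompl : IsCompl U (Submodule.span k (Set.range ![r, l])) := by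
    rw [isCompl_iff, Submodule.disjoint_def, codisjoint_iff, eq_top_iff]
    have hrange : Set.range ![r, l] = {r, l} := by simp [Set.pair_comm]
    rw [hrange]
    refine ⟨fun x hx hx' => ?_, fun x _ => ?_⟩
    · obtain ⟨a, c, rfl⟩ := Submodule.mem_span_pair.mp hx'
      have h2 := hUl ⟨_, hx⟩
      have h3 := hUr ⟨_, hx⟩
      rw [hβ.add_left, hβ.smul_left, hβ.smul_left, hl, h1] at h2
      rw [hβ.add_right, hβ.smul_right, hβ.smul_right, hr, h1] at h3
      have ha : a = 0 := by simpa using h2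
      have hc : c = 0 := by simpa using h3
      simp [ha, hc]
    · obtain ⟨w, a, c, rfl⟩ := hdec x
      rw [add_assoc]
      exact Submodule.add_mem_sup w.2 (Submodule.mem_span_pair.mpr ⟨a, c, rfl⟩)
  have hUdim : Module.finrank k U = 2 := by
    have h2 := Submodule.finrank_add_eq_of_isCompl hcompl
    rw [finrank_span_eq_card hli, hV, Fintype.card_fin] at h2
    omega
  by_cases hU : ∀ v : U, (∀ u : U, β u v = 0) → v = 0
  · left
    obtain ⟨b, hb⟩ := (hβ.restrict U).exists_orthonormal 2 hUdim hU
    refine ⟨![r, b 0, b 1, l], fun i j => ?_⟩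
    fin_cases i <;> fin_cases j <;> simp [normalMatrix, hr, hl, hUr, hUl, h1, hb]
  · right
    push Not at hU
    obtain ⟨r', hr', hr'0⟩ := hU
    obtain ⟨l', hl'0, hl'⟩ := (hβ.restrict U).exists_left_kernel hr'0 hr'
    have hr'V : ∀ u, β u r' = 0 := fun u => by
      obtain ⟨w, a, c, rfl⟩ := hdec u
      rw [hβ.add_left, hβ.add_left, hβ.smul_left, hβ.smul_left, hr', hUr, hl]
      ring
    have hl'V : ∀ v, β l' v = 0 := fun v => by
      obtain ⟨w, a, c, rfl⟩ := hdec v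
      rw [hβ.add_right, hβ.add_right, hβ.smul_right, hβ.smul_right, hl', hUl, hr]
      ring
    have hne : β r' l' ≠ 0 := by
      intro h0
      have hli' : LinearIndependent k ![r', l'] := by
        rw [LinearIndependent.pair_iff' hr'0]
        rintro c rfl
        refine hl'0 (Subtype.ext (hnd _ hl'V fun u => ?_))
        rw [Submodule.coe_smul, hβ.smul_right, hr'V, mul_zero]
      refine hr'0 (Subtype.ext (hnd _ (fun u => ?_) hr'V))
      obtain ⟨w, a, c, rfl⟩ := hdec u
      have hw : w ∈ Submodule.span k (Set.range ![r', l']) := by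
        rw [hli'.span_eq_top_of_card_eq_finrank (by rw [hUdim, Fintype.card_fin])]; trivial
      rw [show Set.range ![r', l'] = {r', l'} by simp [Set.pair_comm]] at hw
      obtain ⟨x, y, rfl⟩ := Submodule.mem_span_pair.mp hw
      rw [Submodule.coe_add, Submodule.coe_smul, Submodule.coe_smul, hβ.add_right, hβ.add_right,
        hβ.add_right, hβ.smul_right, hβ.smul_right, hβ.smul_right, hβ.smul_right, hr'V, h0, hr, hUl]
      ring
    refine ⟨![r, r', l, (β r' l')⁻¹ • l'], fun i j => ?_⟩
    fin_cases i <;> fin_cases j <;>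
      simp [normalMatrix, hr, hl, hUr, hUl, h1, hr'V, hl'V, hβ.smul_left, hβ.smul_right, hne]

/-- If non-zero vectors `r` and `l` of the right and the left kernel pair to zero, the shape of the
pairing depends on whether `β r` vanishes on the vectors `u` with `β u l = 0`. -/
theorem exists_of_kernels_orthogonal [FiniteDimensional k V] [IsAlgClosed k] [CharP k 2]
    (hβ : IsFrobeniusPairing β) (hV : Module.finrank k V = 4)
    (hnd : ∀ v, (∀ u, β v u = 0) → (∀ u, β u v = 0) → v = 0)
    {r l : V} (hr0 : r ≠ 0) (hl0 : l ≠ 0)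
    (hr : ∀ u, β u r = 0) (hl : ∀ v, β l v = 0) (hrl : β r l = 0) :
    ∃ (i : Fin 5) (b : Fin 4 → V), ∀ a c, β (b a) (b c) = normalMatrix k i a c := by
  obtain ⟨z, hz⟩ : ∃ z, β r z ≠ 0 := by
    by_contra! h; exact hr0 (hnd r h hr)
  obtain ⟨y, hy⟩ : ∃ y, β y l ≠ 0 := by
    by_contra! h; exact hl0 (hnd l hl h)
  have hsq : ∀ c : k, ∃ d, d ^ 2 = c := fun c => IsAlgClosed.exists_pow_nat_eq c (by omega)
  by_cases hind : ∃ e, β e l = 0 ∧ β r e ≠ 0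
  · obtain ⟨e, hel, hre⟩ := hind
    wlog hre1 : β r e = 1 generalizing e
    · exact this ((β r e)⁻¹ • e) (by rw [hβ.smul_left, hel, mul_zero])
        (by rw [hβ.smul_right, inv_mul_cancel₀ hre]; exact one_ne_zero)
        (by rw [hβ.smul_right, inv_mul_cancel₀ hre])
    obtain ⟨f, hfl, hrf⟩ : ∃ f, β f l ≠ 0 ∧ β r f = 0 := by
      refine ⟨y + β r y • e, ?_, ?_⟩
      · rwa [hβ.add_left, hβ.smul_left, hel, mul_zero, add_zero]
      · rw [hβ.add_right, hβ.smul_right, hre1, mul_one, CharTwo.add_self_eq_zero]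
    wlog hfl1 : β f l = 1 generalizing l
    · have hi : β f ((β f l)⁻¹ • l) = 1 := by rw [hβ.smul_right, inv_mul_cancel₀ hfl]
      exact this (l := (β f l)⁻¹ • l) (smul_ne_zero (inv_ne_zero hfl) hl0)
        (fun v => by rw [hβ.smul_left, hl, mul_zero]) (by rw [hβ.smul_right, hrl, mul_zero])
        (by rw [hβ.smul_right]; exact mul_ne_zero (inv_ne_zero hfl) hy)
        (by rw [hβ.smul_right, hel, mul_zero]) (by rw [hi]; exact one_ne_zero) hi
    -- Subtracting multiples of `l` and `r` makes `f`, `e` isotropic and `β f e` zero.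
    obtain ⟨d, hd⟩ := hsq (β e e)
    set f' := f + β f f • l with hf'
    set e' := e + β f e • l + d • r with he'
    have hff : β f' f' = 0 := by
      simp only [hf', hβ.add_left, hβ.add_right, hβ.smul_left, hβ.smul_right, hl, hfl1]
      linear_combination CharTwo.add_self_eq_zero (β f f)
    have hfe : β f' e' = 0 := by
      simp only [hf', he', hβ.add_left, hβ.add_right, hβ.smul_left, hβ.smul_right, hl, hr, hfl1]
      linear_combination CharTwo.add_self_eq_zero (β f e)
    have hee : β e' e' = 0 := by
      simp only [he', hβ.add_left, hβ.add_right, hβ.smul_left, hβ.smul_right, hl, hr, hel, hre1,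
        hrl, hd]
      linear_combination CharTwo.add_self_eq_zero (β e e)
    have hel' : β e' l = 0 := by
      simp only [he', hβ.add_left, hβ.smul_left, hl, hel, hrl]; ring
    have hfl' : β f' l = 1 := by
      simp only [hf', hβ.add_left, hβ.smul_left, hl, hfl1]; ring
    have hre' : β r e' = 1 := by
      simp only [he', hβ.add_right, hβ.smul_right, hr, hre1, hrl]; ring
    have hrf' : β r f' = 0 := by
      simp only [hf', hβ.add_right, hβ.smul_right, hrf, hrl]; ring
    clear_value f' e'
    by_cases hc : β e' f' = 0
    · refine ⟨4, ![f', r, l, e'], fun i j => ?_⟩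
      fin_cases i <;> fin_cases j <;>
        simp [normalMatrix, hr, hl, hff, hfe, hee, hel', hfl', hre', hrf', hrl, hc]
    · refine ⟨2, ![(β e' f')⁻¹ • f', r, e', β e' f' ^ 2 • l], fun i j => ?_⟩
      fin_cases i <;> fin_cases j <;>
        simp [normalMatrix, hr, hl, hff, hfe, hee, hel', hfl', hre', hrf', hrl, hc,
          hβ.smul_left, hβ.smul_right]
  · -- Here `β u l = 0` implies `β r u = 0`.
    push Not at hind
    have hzl : β z l ≠ 0 := fun h => hz (hind z h)
    clear hy y
    wlog hrz1 : β r z = 1 generalizing r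
    · obtain ⟨d, hd⟩ := hsq (β r z)⁻¹
      have hd0 : d ≠ 0 := by rintro rfl; exact inv_ne_zero hz (by rw [← hd]; ring)
      have h1 : β (d • r) z = 1 := by rw [hβ.smul_left, hd, inv_mul_cancel₀ hz]
      exact this (r := d • r) (smul_ne_zero hd0 hr0)
        (fun u => by rw [hβ.smul_right, hr, mul_zero]) (by rw [hβ.smul_left, hrl, mul_zero])
        (by rw [h1]; exact one_ne_zero)
        (fun e he => by rw [hβ.smul_left, hind e he, mul_zero]) h1
    wlog hzl1 : β z l = 1 generalizing l
    · have hi : β z ((β z l)⁻¹ • l) = 1 := by rw [hβ.smul_right, inv_mul_cancel₀ hzl]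
      exact this (l := (β z l)⁻¹ • l) (smul_ne_zero (inv_ne_zero hzl) hl0)
        (fun v => by rw [hβ.smul_left, hl, mul_zero]) (by rw [hi]; exact one_ne_zero)
        (by rw [hβ.smul_right, hrl, mul_zero])
        (fun e he => hind e (by
          rw [hβ.smul_right] at he
          exact (mul_eq_zero.mp he).resolve_left (inv_ne_zero hzl))) hi
    by_cases hw : ∃ w, β w l = 0 ∧ β w w ≠ 0
    · obtain ⟨w, hwl, hww⟩ := hw
      wlog hww1 : β w w = 1 generalizing w
      · obtain ⟨t, ht⟩ := IsAlgClosed.exists_pow_nat_eq (β w w)⁻¹ (n := 3) (by omega)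
        have h1 : β (t • w) (t • w) = 1 := by
          rw [hβ.smul_left, hβ.smul_right, ← mul_assoc, ← pow_succ, ht, inv_mul_cancel₀ hww]
        exact this (t • w) (by rw [hβ.smul_left, hwl, mul_zero]) (by rw [h1]; exact one_ne_zero) h1
      have hrw : β r w = 0 := hind w hwl
      -- Adding a multiple of `w` to `z` makes `β w z` vanish; multiples of `l` do the rest.
      set x := z + β w z • w with hx
      have hwx : β w x = 0 := by
        simp only [hx, hβ.add_right, hβ.smul_right, hww1]
        linear_combination CharTwo.add_self_eq_zero (β w z)
      have hxl : β x l = 1 := by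
        simp only [hx, hβ.add_left, hβ.smul_left, hzl1, hwl]; ring
      have hrx : β r x = 1 := by
        simp only [hx, hβ.add_right, hβ.smul_right, hrz1, hrw]; ring
      clear_value x
      refine ⟨1, ![x + β x x • l, w + β x w • l, r, l], fun i j => ?_⟩
      fin_cases i <;> fin_cases j <;>
        simp [normalMatrix, hr, hl, hβ.smul_left, hβ.smul_right, hβ.add_left, hβ.add_right, hwx,
          hxl, hrx, hwl, hrw, hww1, hrl, CharTwo.add_self_eq_zero]
    · -- Then `β` vanishes on the space of all `u` with `β u l = 0`. It contains a vector `w` not in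
      -- the span of `r` and `l`, and adding multiples of `r` and `l` brings `w` into both kernels.
      exfalso
      push Not at hw
      have hpol : ∀ w w', β w l = 0 → β w' l = 0 → β w w' = 0 := by
        intro w w' hwl hwl'
        have h (c : k) : c ^ 2 * β w w' + c * β w' w = 0 := by
          have h1 := hw (c • w + w') (by
            rw [hβ.add_left, hβ.smul_left, hwl, hwl', mul_zero, add_zero])
          rw [hβ.add_left, hβ.add_right, hβ.add_right, hβ.smul_left, hβ.smul_left, hβ.smul_right,
            hβ.smul_right, hw w hwl, hw w' hwl'] at h1
          linear_combination h1
        obtain ⟨c, hc0, hc1⟩ : ∃ c : k, c ≠ 0 ∧ c ≠ 1 := by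
          classical
          obtain ⟨c, hc⟩ := Set.Infinite.exists_notMem_finset (Set.infinite_univ (α := k)) {0, 1}
          exact ⟨c, by simpa using hc.2⟩
        have h1 := h 1
        have h2 := h c
        have h3 : c * (c - 1) * β w w' = 0 := by linear_combination h2 - c * h1
        exact (mul_eq_zero.mp h3).resolve_left (mul_ne_zero hc0 (sub_ne_zero.mpr hc1))
      have hVV : ∀ v : V, v + v = 0 := fun v => by
        rw [← two_smul k, CharTwo.two_eq_zero, zero_smul]
      have hdec : ∀ u, ∃ (v : V) (a : k), β v l = 0 ∧ u = v + a • z := by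
        intro u
        obtain ⟨a, ha⟩ := hsq (β u l)
        refine ⟨u + a • z, a, ?_, ?_⟩
        · rw [hβ.add_left, hβ.smul_left, ha, hzl1]
          linear_combination CharTwo.add_self_eq_zero (β u l)
        · rw [add_assoc, hVV, add_zero]
      obtain ⟨w, hwl, hwn⟩ : ∃ w, β w l = 0 ∧ w ∉ Submodule.span k {r, l} := by
        by_contra! hall
        have htop : Submodule.span k (Set.range ![z, r, l]) = ⊤ := by
          rw [eq_top_iff]
          intro u _
          obtain ⟨v, a, hv, rfl⟩ := hdec u
          have hsub : ({r, l} : Set V) ⊆ Set.range ![z, r, l] := by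
            rintro _ (rfl | rfl)
            · exact ⟨1, rfl⟩
            · exact ⟨2, rfl⟩
          exact Submodule.add_mem _ (Submodule.span_mono hsub (hall v hv))
            (Submodule.smul_mem _ _ (Submodule.subset_span ⟨0, rfl⟩))
        have h1 := finrank_range_le_card (R := k) ![z, r, l]
        rw [Set.finrank, htop, finrank_top, hV, Fintype.card_fin] at h1
        omega
      obtain ⟨d, hd⟩ := hsq (β w z)
      have h0 : w + d • r + β z w • l = 0 := by
        refine hnd _ (fun u => ?_) (fun u => ?_) <;> obtain ⟨v, a, hv, rfl⟩ := hdec u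
        · simp only [hβ.add_left, hβ.add_right, hβ.smul_left, hβ.smul_right, hl, hpol w v hwl hv,
            hind v hv, hrz1, hd]
          linear_combination a * CharTwo.add_self_eq_zero (β w z)
        · simp only [hβ.add_left, hβ.add_right, hβ.smul_left, hβ.smul_right, hr, hpol v w hv hwl,
            hv, hzl1]
          linear_combination a ^ 2 * CharTwo.add_self_eq_zero (β z w)
      refine hwn (Submodule.mem_span_pair.mpr ⟨d, β z w, ?_⟩)
      have h1 := hVV (d • r + β z w • l)
      rw [add_assoc] at h0
      exact (add_right_cancel (h0.trans h1.symm)).symm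

/-- A pairing on a four-dimensional space whose kernels intersect trivially has one of five
matrices in a suitable basis. -/
theorem exists_normalMatrix [FiniteDimensional k V] [IsAlgClosed k] [CharP k 2]
    (hβ : IsFrobeniusPairing β) (hV : Module.finrank k V = 4)
    (hnd : ∀ v, (∀ u, β v u = 0) → (∀ u, β u v = 0) → v = 0) :
    ∃ (i : Fin 5) (b : Fin 4 → V), ∀ a c, β (b a) (b c) = normalMatrix k i a c := by
  by_cases hR : ∀ v, (∀ u, β u v = 0) → v = 0
  · obtain ⟨b, hb⟩ := hβ.exists_orthonormal 4 hV hR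
    refine ⟨0, b, fun i j => ?_⟩
    rw [hb]
    fin_cases i <;> fin_cases j <;> simp [normalMatrix]
  · push Not at hR
    obtain ⟨r, hr, hr0⟩ := hR
    obtain ⟨l, hl0, hl⟩ := hβ.exists_left_kernel hr0 hr
    by_cases hrl : β r l = 0
    · exact hβ.exists_of_kernels_orthogonal hV hnd hr0 hl0 hr hl hrl
    · rcases hβ.exists_of_kernels_pairing hV hnd hr hl hrl with ⟨b, hb⟩ | ⟨b, hb⟩
      · exact ⟨3, b, hb⟩
      · exact ⟨4, b, hb⟩

end IsFrobeniusPairing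
/-! ### Cubic forms without squarefree monomials and their pairings -/

section FrobeniusForms

variable {k : Type u} [Field k]

/-- The cubic form `∑ M i j * x_i ^ 2 * x_j`. -/
noncomputable def frobForm (M : Matrix (Fin 4) (Fin 4) k) : MvPolynomial (Fin 4) k :=
  ∑ i, ∑ j, C (M i j) * X i ^ 2 * X j

/-- The pairing `∑ M i j * u_i ^ 2 * v_j`, whose values on the diagonal are those of `frobForm M`.
-/
def pairing (M : Matrix (Fin 4) (Fin 4) k) (u v : Fin 4 → k) : k :=
  ∑ i, ∑ j, M i j * u i ^ 2 * v j

theorem isFrobeniusPairing_pairing [CharP k 2] (M : Matrix (Fin 4) (Fin 4) k) :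
    IsFrobeniusPairing (pairing M) where
  add_left u u' v := by
    simp only [pairing, ← Finset.sum_add_distrib, Pi.add_apply, CharTwo.add_sq]
    exact Finset.sum_congr rfl fun i _ => Finset.sum_congr rfl fun j _ => by ring
  smul_left c u v := by
    simp only [pairing, Finset.mul_sum, Pi.smul_apply, smul_eq_mul]
    exact Finset.sum_congr rfl fun i _ => Finset.sum_congr rfl fun j _ => by ring
  add_right u v v' := by
    simp only [pairing, ← Finset.sum_add_distrib, Pi.add_apply]
    exact Finset.sum_congr rfl fun i _ => Finset.sum_congr rfl fun j _ => by ring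
  smul_right c u v := by
    simp only [pairing, Finset.mul_sum, Pi.smul_apply, smul_eq_mul]
    exact Finset.sum_congr rfl fun i _ => Finset.sum_congr rfl fun j _ => by ring

theorem single_two_add_single_one_inj {a b i j : Fin 4}
    (h : Finsupp.single a 2 + Finsupp.single b 1 = Finsupp.single i 2 + Finsupp.single j (1 : ℕ)) :
    a = i ∧ b = j := by
  have hai : a = i := by
    by_contra hne
    have := DFunLike.congr_fun h a
    simp only [Finsupp.add_apply, Finsupp.single_eq_same, Finsupp.single_apply,
      if_neg (Ne.symm hne)] at this
    split_ifs at this <;> omega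
  subst hai
  refine ⟨rfl, ?_⟩
  exact Finsupp.single_left_injective one_ne_zero (add_left_cancel h)

theorem C_mul_X_sq_mul_X (c : k) (a b : Fin 4) :
    C c * X a ^ 2 * X b = monomial (Finsupp.single a 2 + Finsupp.single b 1) c := by
  rw [C_mul_X_pow_eq_monomial, X, monomial_mul, mul_one]

theorem coeff_frobForm (M : Matrix (Fin 4) (Fin 4) k) (i j : Fin 4) :
    coeff (Finsupp.single i 2 + Finsupp.single j 1) (frobForm M) = M i j := by
  classical
  simp only [frobForm, C_mul_X_sq_mul_X, coeff_sum, coeff_monomial]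
  rw [Finset.sum_eq_single i, Finset.sum_eq_single j]
  · simp
  · intro b _ hb
    exact if_neg fun h => hb (single_two_add_single_one_inj h).2
  · simp
  · intro a _ ha
    exact Finset.sum_eq_zero fun b _ => if_neg fun h => ha (single_two_add_single_one_inj h).1
  · simp

theorem frobForm_injective : Function.Injective (frobForm (k := k)) := fun M N h => by
  ext i j
  rw [← coeff_frobForm M, h, coeff_frobForm]

theorem pderiv_frobForm [CharP k 2] (M : Matrix (Fin 4) (Fin 4) k) (j : Fin 4) :
    pderiv j (frobForm M) = ∑ i, C (M i j) * X i ^ 2 := by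
  have h2 : (2 : MvPolynomial (Fin 4) k) = 0 := CharTwo.two_eq_zero
  simp only [frobForm, map_sum]
  refine Finset.sum_congr rfl fun i _ => ?_
  rw [Finset.sum_eq_single j]
  · simp [h2, Derivation.leibniz, Derivation.leibniz_pow]
  · intro b _ hb
    simp [h2, Derivation.leibniz, Derivation.leibniz_pow, pderiv_X_of_ne hb]
  · simp

/-- As squaring is additive, a substitution replaces the matrix of a form by the values of its
pairing on the columns of the substitution. -/
theorem linearSubst_frobForm [CharP k 2] (g M : Matrix (Fin 4) (Fin 4) k) :
    linearSubst g (frobForm M) =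
      frobForm (Matrix.of fun a b => pairing M (fun i => g i a) fun j => g j b) := by
  have h1 : linearSubst g (frobForm M) = ∑ p : Fin 4 × Fin 4, ∑ q : Fin 4 × Fin 4,
      C (M p.1 p.2 * g p.1 q.1 ^ 2 * g p.2 q.2) * X q.1 ^ 2 * X q.2 := by
    simp only [frobForm, linearSubst, map_sum, map_mul, map_pow, aeval_X, algHom_C, algebraMap_eq,
      sum_pow_char, mul_pow, Fintype.sum_prod_type]
    refine Finset.sum_congr rfl fun i _ => Finset.sum_congr rfl fun j _ => ?_
    rw [mul_assoc, Finset.sum_mul_sum, Finset.mul_sum]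
    refine Finset.sum_congr rfl fun a _ => ?_
    rw [Finset.mul_sum]
    exact Finset.sum_congr rfl fun b _ => by ring
  rw [h1, Finset.sum_comm, frobForm, Fintype.sum_prod_type]
  refine Finset.sum_congr rfl fun a _ => Finset.sum_congr rfl fun b _ => ?_
  simp only [Matrix.of_apply, pairing, map_sum, Finset.sum_mul, Fintype.sum_prod_type]

theorem normalPoly_eq_frobForm (i : Fin 5) : normalPoly k i = frobForm (normalMatrix k i) := by
  fin_cases i <;> simp [normalPoly, frobForm, normalMatrix, Fin.sum_univ_four] <;> ring

theorem linearlyEquivalent_frobForm_iff [CharP k 2] (M N : Matrix (Fin 4) (Fin 4) k) :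
    LinearlyEquivalent (frobForm M) (frobForm N) ↔
      ∃ b : Fin 4 → Fin 4 → k, LinearIndependent k b ∧ ∀ i j, pairing M (b i) (b j) = N i j := by
  constructor
  · rintro ⟨g, hg⟩
    refine ⟨fun a i => g.1 i a, ?_, fun i j => ?_⟩
    · exact Matrix.linearIndependent_cols_of_isUnit g.isUnit
    · rw [linearSubst_frobForm] at hg
      rw [← frobForm_injective hg, Matrix.of_apply]
  · rintro ⟨b, hb, h⟩
    have hu : IsUnit (Matrix.of fun i a => b a i : Matrix (Fin 4) (Fin 4) k) :=
      Matrix.linearIndependent_cols_iff_isUnit.mp hb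
    refine ⟨hu.unit, ?_⟩
    rw [linearSubst_frobForm]
    congr 1
    ext i j
    exact h i j

end FrobeniusForms
/-! ### Non-degeneracy and normal forms -/

section FrobeniusForms

variable {k : Type u} [Field k]

theorem notMem_vars_frobForm {M : Matrix (Fin 4) (Fin 4) k} {i : Fin 4} (hrow : ∀ j, M i j = 0)
    (hcol : ∀ j, M j i = 0) : i ∉ (frobForm M).vars := by
  classical
  intro hi
  obtain ⟨a, -, hi⟩ := Finset.mem_biUnion.mp (vars_sum_subset _ _ hi)
  obtain ⟨b, -, hi⟩ := Finset.mem_biUnion.mp (vars_sum_subset _ _ hi)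
  rw [C_mul_X_sq_mul_X] at hi
  by_cases h0 : M a b = 0
  · simp [h0] at hi
  · rw [vars_monomial h0, Finsupp.mem_support_iff, Finsupp.add_apply, Finsupp.single_apply,
      Finsupp.single_apply] at hi
    split_ifs at hi with h1 h2 h2
    · exact h0 (h1 ▸ hrow b)
    · exact h0 (h1 ▸ hrow b)
    · exact h0 (h2 ▸ hcol a)
    · exact hi rfl

theorem mem_vars_frobForm {M : Matrix (Fin 4) (Fin 4) k} {i j : Fin 4} (h : M i j ≠ 0) :
    i ∈ (frobForm M).vars ∧ j ∈ (frobForm M).vars := by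
  rw [← coeff_frobForm M] at h
  constructor <;>
    exact (mem_vars_iff_mem_support _).mpr
      ⟨_, mem_support_iff.mpr h, by simp [Finsupp.single_apply]⟩

/-- A form is non-degenerate if and only if the two kernels of its pairing intersect trivially:
after the substitution `g`, the variable `x_i` is absent if and only if the `i`-th column of `g`
lies in both kernels. -/
theorem isNondegenerate_frobForm_iff [CharP k 2] (M : Matrix (Fin 4) (Fin 4) k) :
    IsNondegenerate (frobForm M) ↔
      ∀ v, (∀ u, pairing M v u = 0) → (∀ u, pairing M u v = 0) → v = 0 := by
  constructor
  · intro h v hv hv'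
    by_contra hv0
    obtain ⟨i, hi⟩ := Function.ne_iff.mp hv0
    have hdet : ((1 : Matrix (Fin 4) (Fin 4) k).updateCol i v).det = v i := by
      rw [← Matrix.cramer_apply, Matrix.cramer_one, Module.End.one_apply]
    have hu : IsUnit ((1 : Matrix (Fin 4) (Fin 4) k).updateCol i v) := by
      rw [Matrix.isUnit_iff_isUnit_det, hdet]
      exact isUnit_iff_ne_zero.mpr hi
    have hcol : (fun j => (1 : Matrix (Fin 4) (Fin 4) k).updateCol i v j i) = v := by
      ext j; simp
    have := h hu.unit i
    rw [linearSubst_frobForm] at this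
    refine notMem_vars_frobForm (fun j => ?_) (fun j => ?_) this
    · rw [Matrix.of_apply, IsUnit.unit_spec, hcol, hv]
    · rw [Matrix.of_apply, IsUnit.unit_spec, hcol, hv']
  · intro h g i
    rw [linearSubst_frobForm]
    by_contra hi
    have hβ := isFrobeniusPairing_pairing M
    have hli : LinearIndependent k fun a i => (g : Matrix (Fin 4) (Fin 4) k) i a :=
      Matrix.linearIndependent_cols_of_isUnit g.isUnit
    let e := basisOfLinearIndependentOfCardEqFinrank hli (by simp)
    have he : ∀ a, e a = fun i => (g : Matrix (Fin 4) (Fin 4) k) i a := fun a => by simp [e]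
    refine hli.ne_zero i (h _ (fun u => ?_) (fun u => ?_))
    · rw [hβ.eq_sum_right e]
      refine Finset.sum_eq_zero fun j _ => ?_
      by_contra hne
      exact hi (mem_vars_frobForm (i := i) (j := j)
        (by rw [Matrix.of_apply]; rw [he] at hne; exact right_ne_zero_of_mul hne)).1
    · rw [hβ.eq_sum_left e]
      refine Finset.sum_eq_zero fun j _ => ?_
      by_contra hne
      exact hi (mem_vars_frobForm (i := j) (j := i)
        (by rw [Matrix.of_apply]; rw [he] at hne; exact right_ne_zero_of_mul hne)).2

theorem pairing_normalMatrix (u v : Fin 4 → k) :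
    pairing (normalMatrix k 0) u v = u 0 ^ 2 * v 0 + u 1 ^ 2 * v 1 + u 2 ^ 2 * v 2 + u 3 ^ 2 * v 3 ∧
    pairing (normalMatrix k 1) u v = u 0 ^ 2 * v 3 + u 1 ^ 2 * v 1 + u 2 ^ 2 * v 0 ∧
    pairing (normalMatrix k 2) u v = u 0 ^ 2 * v 3 + u 1 ^ 2 * v 2 + u 2 ^ 2 * v 0 ∧
    pairing (normalMatrix k 3) u v = u 0 ^ 2 * v 3 + u 1 ^ 2 * v 1 + u 2 ^ 2 * v 2 ∧
    pairing (normalMatrix k 4) u v = u 0 ^ 2 * v 2 + u 1 ^ 2 * v 3 := by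
  simp [pairing, normalMatrix, Fin.sum_univ_four]

theorem nondegenerate_normalMatrix (i : Fin 5) (v : Fin 4 → k)
    (hv : ∀ u, pairing (normalMatrix k i) v u = 0) (hv' : ∀ u, pairing (normalMatrix k i) u v = 0) :
    v = 0 := by
  have hl := fun j => hv (Pi.single j 1)
  have hr := fun j => hv' (Pi.single j 1)
  ext j
  fin_cases i
  · have a0 := hr 0; have a1 := hr 1; have a2 := hr 2; have a3 := hr 3
    simp [(pairing_normalMatrix _ _).1] at a0 a1 a2 a3
    fin_cases j <;> assumption
  · have a0 := hl 0; have a1 := hl 1; have a2 := hl 3; have a3 := hr 0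
    simp [(pairing_normalMatrix _ _).2.1] at a0 a1 a2 a3
    fin_cases j <;> assumption
  · have a0 := hl 0; have a1 := hl 2; have a2 := hl 3; have a3 := hr 0
    simp [(pairing_normalMatrix _ _).2.2.1] at a0 a1 a2 a3
    fin_cases j <;> assumption
  · have a0 := hl 1; have a1 := hl 2; have a2 := hl 3; have a3 := hr 0
    simp [(pairing_normalMatrix _ _).2.2.2.1] at a0 a1 a2 a3
    fin_cases j <;> assumption
  · have a0 := hl 2; have a1 := hl 3; have a2 := hr 0; have a3 := hr 1
    simp [(pairing_normalMatrix _ _).2.2.2.2] at a0 a1 a2 a3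
    fin_cases j <;> assumption

theorem isNondegenerate_normalPoly [CharP k 2] (i : Fin 5) : IsNondegenerate (normalPoly k i) := by
  rw [normalPoly_eq_frobForm, isNondegenerate_frobForm_iff]
  exact nondegenerate_normalMatrix i

theorem linearIndependent_of_pairing_eq [CharP k 2] {M N : Matrix (Fin 4) (Fin 4) k}
    (hN : ∀ v, (∀ u, pairing N v u = 0) → (∀ u, pairing N u v = 0) → v = 0)
    {b : Fin 4 → Fin 4 → k} (hb : ∀ i j, pairing M (b i) (b j) = N i j) :
    LinearIndependent k b := by
  have hM := isFrobeniusPairing_pairing M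
  have hsum : ∀ u v : Fin 4 → k, pairing N u v = pairing M (∑ i, u i • b i) (∑ j, v j • b j) := by
    intro u v
    rw [hM.sum_left, pairing]
    refine Finset.sum_congr rfl fun i _ => ?_
    rw [hM.sum_right]
    refine Finset.sum_congr rfl fun j _ => ?_
    rw [hM.smul_left, hM.smul_right, hb]
    ring
  rw [Fintype.linearIndependent_iff]
  intro g hg
  exact congrFun (hN g (fun u => by rw [hsum, hg, hM.zero_left])
    (fun u => by rw [hsum, hg, hM.zero_right]))

/-- A non-degenerate form in the span of the `x_i ^ 2 * x_j` is equivalent to one of the five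
forms of the classification. -/
theorem exists_linearlyEquivalent_normalPoly [IsAlgClosed k] [CharP k 2]
    (M : Matrix (Fin 4) (Fin 4) k) (hM : IsNondegenerate (frobForm M)) :
    ∃ i, LinearlyEquivalent (frobForm M) (normalPoly k i) := by
  obtain ⟨i, b, hb⟩ := (isFrobeniusPairing_pairing M).exists_normalMatrix (by simp)
    ((isNondegenerate_frobForm_iff M).mp hM)
  refine ⟨i, ?_⟩
  rw [normalPoly_eq_frobForm, linearlyEquivalent_frobForm_iff]
  exact ⟨b, linearIndependent_of_pairing_eq (nondegenerate_normalMatrix i) hb, hb⟩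

/-- An orthonormal basis brings the form to a sum of cubes. -/
theorem linearlyEquivalent_fermat [IsAlgClosed k] [CharP k 2]
    (M : Matrix (Fin 4) (Fin 4) k) (hM : ∀ v, (∀ u, pairing M u v = 0) → v = 0) :
    LinearlyEquivalent (frobForm M) (normalPoly k 0) := by
  obtain ⟨b, hb⟩ := (isFrobeniusPairing_pairing M).exists_orthonormal 4 (by simp) hM
  have hb' : ∀ i j, pairing M (b i) (b j) = normalMatrix k 0 i j := fun i j => by
    rw [hb]
    fin_cases i <;> fin_cases j <;> simp [normalMatrix]
  rw [normalPoly_eq_frobForm, linearlyEquivalent_frobForm_iff]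
  exact ⟨b, linearIndependent_of_pairing_eq (nondegenerate_normalMatrix 0) hb', hb'⟩

/-! ### Invariants of the normal forms -/

/-- The right kernel of the pairing is zero. -/
def HasTrivialKernel (β : (Fin 4 → k) → (Fin 4 → k) → k) : Prop :=
  ∀ v, (∀ u, β u v = 0) → v = 0

/-- Some anisotropic vector is orthogonal to both kernels of the pairing. -/
def HasAnisotropicVector (β : (Fin 4 → k) → (Fin 4 → k) → k) : Prop :=
  ∃ w, β w w ≠ 0 ∧ (∀ r, (∀ u, β u r = 0) → β r w = 0) ∧ ∀ l, (∀ v, β l v = 0) → β w l = 0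

/-- The pairing does not vanish between its right and its left kernel. -/
def HasPairedKernels (β : (Fin 4 → k) → (Fin 4 → k) → k) : Prop :=
  ∃ r l, (∀ u, β u r = 0) ∧ (∀ v, β l v = 0) ∧ β r l ≠ 0

theorem invariants_of_equiv {β β' : (Fin 4 → k) → (Fin 4 → k) → k}
    (e : (Fin 4 → k) ≃ₗ[k] (Fin 4 → k)) (h : ∀ u v, β' u v = β (e u) (e v)) :
    (HasTrivialKernel β → HasTrivialKernel β') ∧
      (HasAnisotropicVector β → HasAnisotropicVector β') ∧
      (HasPairedKernels β → HasPairedKernels β') := by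
  have h' : ∀ u v, β u v = β' (e.symm u) (e.symm v) := fun u v => by simp [h]
  refine ⟨fun hK v hv => ?_, ?_, ?_⟩
  · rw [← e.map_eq_zero_iff]
    exact hK _ fun u => by rw [h', e.symm_apply_apply, hv]
  · rintro ⟨w, hw, hr, hl⟩
    refine ⟨e.symm w, by rwa [← h'], fun r hr' => ?_, fun l hl' => ?_⟩
    · rw [h, e.apply_symm_apply]
      exact hr _ fun u => by rw [h', e.symm_apply_apply, hr']
    · rw [h, e.apply_symm_apply]
      exact hl _ fun u => by rw [h', e.symm_apply_apply, hl']
  · rintro ⟨r, l, hr, hl, hrl⟩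
    exact ⟨e.symm r, e.symm l, fun u => by rw [h, e.apply_symm_apply, hr],
      fun v => by rw [h, e.apply_symm_apply, hl], by rwa [← h']⟩

theorem exists_linearEquiv_of_linearlyEquivalent [CharP k 2] {M N : Matrix (Fin 4) (Fin 4) k}
    (h : LinearlyEquivalent (frobForm M) (frobForm N)) :
    ∃ e : (Fin 4 → k) ≃ₗ[k] (Fin 4 → k), ∀ u v, pairing N u v = pairing M (e u) (e v) := by
  obtain ⟨b, hb, h⟩ := (linearlyEquivalent_frobForm_iff M N).mp h
  let e := basisOfLinearIndependentOfCardEqFinrank hb (by simp)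
  have hM := isFrobeniusPairing_pairing M
  refine ⟨e.equivFun.symm, fun u v => ?_⟩
  rw [e.equivFun_symm_apply, e.equivFun_symm_apply, hM.sum_left, pairing]
  refine Finset.sum_congr rfl fun i _ => ?_
  rw [hM.sum_right]
  refine Finset.sum_congr rfl fun j _ => ?_
  rw [hM.smul_left, hM.smul_right]
  simp only [e, coe_basisOfLinearIndependentOfCardEqFinrank, h]
  ring

theorem hasTrivialKernel_normalMatrix_iff (i : Fin 5) :
    HasTrivialKernel (pairing (normalMatrix k i)) ↔ i = 0 := by
  constructor
  · intro h
    have key : ∀ j, (∀ u, pairing (normalMatrix k i) u (Pi.single j 1) = 0) → False := fun j hj =>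
      one_ne_zero (α := k) (by simpa using congrFun (h _ hj) j)
    fin_cases i
    · rfl
    · exact (key 2 fun u => by simp [(pairing_normalMatrix _ _).2.1]).elim
    · exact (key 1 fun u => by simp [(pairing_normalMatrix _ _).2.2.1]).elim
    · exact (key 0 fun u => by simp [(pairing_normalMatrix _ _).2.2.2.1]).elim
    · exact (key 0 fun u => by simp [(pairing_normalMatrix _ _).2.2.2.2]).elim
  · rintro rfl v hv
    have h := fun j => hv (Pi.single j 1)
    have a0 := h 0; have a1 := h 1; have a2 := h 2; have a3 := h 3
    simp [(pairing_normalMatrix _ _).1] at a0 a1 a2 a3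
    ext j
    fin_cases j <;> assumption

theorem hasAnisotropicVector_normalMatrix_iff {i : Fin 5} (hi : i ≠ 0) :
    HasAnisotropicVector (pairing (normalMatrix k i)) ↔ i = 1 ∨ i = 3 := by
  constructor
  · rintro ⟨w, hw, hr, hl⟩
    fin_cases i
    · exact (hi rfl).elim
    · exact Or.inl rfl
    · have h1 := hr (Pi.single 1 1) fun u => by simp [(pairing_normalMatrix _ _).2.2.1]
      have h2 := hl (Pi.single 3 1) fun u => by simp [(pairing_normalMatrix _ _).2.2.1]
      simp [(pairing_normalMatrix _ _).2.2.1] at h1 h2 hw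
      simp [h1, h2] at hw
    · exact Or.inr rfl
    · have h1 := hr (Pi.single 0 1) fun u => by simp [(pairing_normalMatrix _ _).2.2.2.2]
      have h2 := hr (Pi.single 1 1) fun u => by simp [(pairing_normalMatrix _ _).2.2.2.2]
      simp [(pairing_normalMatrix _ _).2.2.2.2] at h1 h2 hw
      simp [h1, h2] at hw
  · rintro (rfl | rfl)
    · refine ⟨Pi.single 1 1, by simp [(pairing_normalMatrix _ _).2.1], fun r hr => ?_,
        fun l hl => ?_⟩
      · have := hr (Pi.single 1 1)
        simp_all [(pairing_normalMatrix _ _).2.1]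
      · have := hl (Pi.single 1 1)
        simp_all [(pairing_normalMatrix _ _).2.1]
    · refine ⟨Pi.single 1 1, by simp [(pairing_normalMatrix _ _).2.2.2.1], fun r hr => ?_,
        fun l hl => ?_⟩
      · have := hr (Pi.single 1 1)
        simp_all [(pairing_normalMatrix _ _).2.2.2.1]
      · have := hl (Pi.single 1 1)
        simp_all [(pairing_normalMatrix _ _).2.2.2.1]

theorem hasPairedKernels_normalMatrix_iff {i : Fin 5} (hi : i ≠ 0) :
    HasPairedKernels (pairing (normalMatrix k i)) ↔ i = 3 ∨ i = 4 := by
  constructor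
  · rintro ⟨r, l, hr, hl, hrl⟩
    fin_cases i
    · exact (hi rfl).elim
    · have h1 := hr (Pi.single 1 1)
      have h2 := hr (Pi.single 2 1)
      have h3 := hl (Pi.single 3 1)
      simp [(pairing_normalMatrix _ _).2.1] at h1 h2 h3 hrl
      simp [h1, h2, h3] at hrl
    · have h1 := hr (Pi.single 2 1)
      have h2 := hr (Pi.single 1 1)
      have h3 := hl (Pi.single 0 1)
      simp [(pairing_normalMatrix _ _).2.2.1] at h1 h2 h3 hrl
      simp [h1, h2, h3] at hrl
    · exact Or.inl rfl
    · exact Or.inr rfl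
  · rintro (rfl | rfl)
    · exact ⟨Pi.single 0 1, Pi.single 3 1, by simp [(pairing_normalMatrix _ _).2.2.2.1]⟩
    · exact ⟨Pi.single 0 1, Pi.single 2 1, by simp [(pairing_normalMatrix _ _).2.2.2.2]⟩

/-- The first form is the one whose right kernel is zero; whether there is an anisotropic vector
orthogonal to both kernels, and whether the kernels are paired, tells the other four apart. -/
theorem not_linearlyEquivalent_normalPoly [CharP k 2] {i j : Fin 5} (hij : i ≠ j) :
    ¬ LinearlyEquivalent (normalPoly k i) (normalPoly k j) := by
  intro h
  rw [normalPoly_eq_frobForm, normalPoly_eq_frobForm] at h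
  obtain ⟨e, he⟩ := exists_linearEquiv_of_linearlyEquivalent h
  have h1 := invariants_of_equiv e he
  have h2 := invariants_of_equiv e.symm (β := pairing (normalMatrix k j))
    (β' := pairing (normalMatrix k i)) fun u v => by simp [he]
  have hK := (hasTrivialKernel_normalMatrix_iff i).symm.trans
    (⟨h1.1, h2.1⟩ : _ ↔ _) |>.trans (hasTrivialKernel_normalMatrix_iff j)
  by_cases hi : i = 0
  · exact hij (hi.trans (hK.mp hi).symm)
  · have hj : j ≠ 0 := fun hj => hi (hK.mpr hj)
    have hA := (hasAnisotropicVector_normalMatrix_iff hi).symm.trans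
      (⟨h1.2.1, h2.2.1⟩ : _ ↔ _) |>.trans (hasAnisotropicVector_normalMatrix_iff hj)
    have hP := (hasPairedKernels_normalMatrix_iff hi).symm.trans
      (⟨h1.2.2, h2.2.2⟩ : _ ↔ _) |>.trans (hasPairedKernels_normalMatrix_iff hj)
    clear h h1 h2 he hK
    revert i j
    decide

/-! ### Squarefree monomials -/

/-- The exponent of the squarefree cubic monomial in the three variables other than `x_l`. -/
noncomputable def omitExponent (l : Fin 4) : Fin 4 →₀ ℕ :=
  Finsupp.equivFunOnFinite.symm fun i => if i = l then 0 else 1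

theorem exponent_of_degree_eq_three {d : Fin 4 →₀ ℕ} (hd : d.degree = 3) :
    (∃ l, d = omitExponent l) ∨ ∃ i j, d = Finsupp.single i 2 + Finsupp.single j 1 := by
  rw [Finsupp.degree_eq_sum, Fin.sum_univ_four] at hd
  by_cases h : ∃ i, 2 ≤ d i
  · right
    obtain ⟨i, hi⟩ := h
    obtain ⟨j, hj⟩ : ∃ j, 1 ≤ (d - Finsupp.single i 2 : Fin 4 →₀ ℕ) j := by
      by_contra! h0
      have := h0 0; have := h0 1; have := h0 2; have := h0 3
      simp only [Finsupp.tsub_apply, Finsupp.single_apply] at *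
      fin_cases i <;> simp at * <;> omega
    refine ⟨i, j, Finsupp.ext fun m => ?_⟩
    simp only [Finsupp.tsub_apply, Finsupp.single_apply, Finsupp.add_apply] at *
    fin_cases i <;> fin_cases j <;> fin_cases m <;> simp at * <;> omega
  · left
    push Not at h
    have h0 := h 0; have h1 := h 1; have h2 := h 2; have h3 := h 3
    obtain ⟨l, hl⟩ : ∃ l, d l = 0 := by
      by_contra! hne
      have := hne 0; have := hne 1; have := hne 2; have := hne 3
      omega
    refine ⟨l, Finsupp.ext fun m => ?_⟩
    simp only [omitExponent, Finsupp.equivFunOnFinite_symm_apply_apply]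
    fin_cases l <;> fin_cases m <;> simp at * <;> omega

/-- A cubic form without squarefree monomials is a combination of the `x_i ^ 2 * x_j`. -/
theorem exists_eq_frobForm {h : MvPolynomial (Fin 4) k} (hh : h.IsHomogeneous 3)
    (hsf : ∀ l, coeff (omitExponent l) h = 0) : ∃ M, h = frobForm M := by
  classical
  refine ⟨Matrix.of fun i j => coeff (Finsupp.single i 2 + Finsupp.single j 1) h, ?_⟩
  ext d
  by_cases hd : d.degree = 3
  · rcases exponent_of_degree_eq_three hd with ⟨l, rfl⟩ | ⟨i, j, rfl⟩
    · rw [hsf, frobForm, coeff_sum]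
      refine (Finset.sum_eq_zero fun i _ => ?_).symm
      rw [coeff_sum]
      refine Finset.sum_eq_zero fun j _ => ?_
      rw [C_mul_X_sq_mul_X, coeff_monomial, if_neg]
      intro he
      have := DFunLike.congr_fun he i
      simp only [omitExponent, Finsupp.add_apply, Finsupp.single_eq_same,
        Finsupp.equivFunOnFinite_symm_apply_apply] at this
      split_ifs at this <;> omega
    · rw [coeff_frobForm, Matrix.of_apply]
  · rw [hh.coeff_eq_zero (by exact hd), frobForm, coeff_sum]
    refine (Finset.sum_eq_zero fun i _ => ?_).symm
    rw [coeff_sum]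
    refine Finset.sum_eq_zero fun j _ => ?_
    rw [C_mul_X_sq_mul_X, coeff_monomial, if_neg]
    rintro rfl
    exact hd (by simp [map_add])

end FrobeniusForms
/-! ### Frobenius splittings of `Proj` from graded splittings -/

section GradedSplitting

variable {k A : Type u} [Field k] [CommRing A] [Algebra k A] (𝒜 : ℕ → Submodule k A)
  [GradedAlgebra 𝒜]

/-- An additive map `φ` of a graded ring with `φ (a ^ 2 * s) = a * φ s` and `φ 1 = 1` which halves
degrees. -/
structure GradedSplitting where
  toFun : A →+ A
  map_sq_mul : ∀ a s, toFun (a ^ 2 * s) = a * toFun s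
  map_one : toFun 1 = 1
  map_mem : ∀ {n a}, a ∈ 𝒜 (n + n) → toFun a ∈ 𝒜 n

namespace GradedSplitting

variable {𝒜} (φ : GradedSplitting 𝒜) (P : Submonoid A)

open HomogeneousLocalization

/-- On numerators and denominators, `a / s = (a * s) / s ^ 2` is sent to `φ (a * s) / s`. -/
def numDen (c : NumDenSameDeg 𝒜 P) : NumDenSameDeg 𝒜 P where
  deg := c.deg
  num := ⟨φ.toFun (c.num * c.den), φ.map_mem (SetLike.mul_mem_graded c.num.2 c.den.2)⟩
  den := c.den
  den_mem := c.den_mem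

omit [GradedAlgebra 𝒜] in
theorem mk_eq_mk_iff {c d : NumDenSameDeg 𝒜 P} :
    HomogeneousLocalization.mk c = HomogeneousLocalization.mk d ↔
      ∃ t ∈ P, t * (d.den * c.num) = t * (c.den * d.num : A) := by
  rw [HomogeneousLocalization.ext_iff_val, val_mk, val_mk, Localization.mk_eq_mk_iff,
    Localization.r_iff_exists]
  simp

theorem mk_numDen_eq {c d : NumDenSameDeg 𝒜 P}
    (h : HomogeneousLocalization.mk c = HomogeneousLocalization.mk d) :
    HomogeneousLocalization.mk (φ.numDen P c) = HomogeneousLocalization.mk (φ.numDen P d) := by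
  rw [mk_eq_mk_iff] at h ⊢
  obtain ⟨t, ht, h⟩ := h
  refine ⟨t, ht, ?_⟩
  change t * (d.den * φ.toFun (c.num * c.den)) = t * (c.den * φ.toFun (d.num * d.den) : A)
  rw [← mul_assoc, ← mul_assoc, ← φ.map_sq_mul, ← φ.map_sq_mul]
  congr 1
  linear_combination (c.den * d.den * t : A) * h

/-- The map induced by a graded splitting on a homogeneous localization. -/
def localized : HomogeneousLocalization 𝒜 P →+ HomogeneousLocalization 𝒜 P where
  toFun := Quotient.map' (φ.numDen P) fun c d h =>
    Quotient.exact (φ.mk_numDen_eq P (Quotient.sound h))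
  map_zero' := by
    change HomogeneousLocalization.mk (φ.numDen P 0) = HomogeneousLocalization.mk 0
    rw [mk_eq_mk_iff]
    exact ⟨1, P.one_mem, by simp [numDen]⟩
  map_add' x y := by
    obtain ⟨c, rfl⟩ := HomogeneousLocalization.mk_surjective x
    obtain ⟨d, rfl⟩ := HomogeneousLocalization.mk_surjective y
    change HomogeneousLocalization.mk (φ.numDen P (c + d)) =
      HomogeneousLocalization.mk (φ.numDen P c + φ.numDen P d)
    rw [mk_eq_mk_iff]
    refine ⟨1, P.one_mem, ?_⟩
    simp only [numDen, NumDenSameDeg.num_add, NumDenSameDeg.den_add]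
    have h : ((c.den * d.num + d.den * c.num) * (c.den * d.den) : A) =
      c.den ^ 2 * (d.num * d.den) + d.den ^ 2 * (c.num * c.den) := by ring
    rw [h, map_add, φ.map_sq_mul, φ.map_sq_mul]

theorem localized_mk (c : NumDenSameDeg 𝒜 P) :
    φ.localized P (HomogeneousLocalization.mk c) = HomogeneousLocalization.mk (φ.numDen P c) :=
  rfl

theorem localized_sq_mul (x y : HomogeneousLocalization 𝒜 P) :
    φ.localized P (x ^ 2 * y) = x * φ.localized P y := by
  obtain ⟨c, rfl⟩ := HomogeneousLocalization.mk_surjective x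
  obtain ⟨d, rfl⟩ := HomogeneousLocalization.mk_surjective y
  rw [← mk_pow, ← mk_mul, localized_mk, localized_mk, ← mk_mul, mk_eq_mk_iff]
  refine ⟨1, P.one_mem, ?_⟩
  simp only [numDen, NumDenSameDeg.num_mul, NumDenSameDeg.den_mul, NumDenSameDeg.num_pow,
    NumDenSameDeg.den_pow]
  have h : ((c.num ^ 2 * d.num) * (c.den ^ 2 * d.den) : A) =
    (c.num * c.den) ^ 2 * (d.num * d.den) := by ring
  rw [h, φ.map_sq_mul]
  ring

theorem localized_one : φ.localized P 1 = 1 := by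
  rw [← mk_one, localized_mk, mk_eq_mk_iff]
  exact ⟨1, P.one_mem, by simp [numDen, φ.map_one]⟩

/-- The map induced by a graded splitting on sections of the structure sheaf of `Proj`. -/
def onSections (U : (TopologicalSpace.Opens (ProjectiveSpectrum.top 𝒜))ᵒᵖ) :
    (ProjectiveSpectrum.Proj.structureSheaf 𝒜).1.obj U →+
      (ProjectiveSpectrum.Proj.structureSheaf 𝒜).1.obj U :=
  AddMonoidHom.mk'
    (fun s => ⟨fun x => φ.localized _ (s.1 x), fun x => by
      obtain ⟨V, hxV, i, n, a, b, hb, h⟩ := s.2 x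
      exact ⟨V, hxV, i, n, ⟨φ.toFun (a * b), φ.map_mem (SetLike.mul_mem_graded a.2 b.2)⟩, b, hb,
        fun y => congrArg (φ.localized _) (h y)⟩⟩)
    fun s t => Subtype.ext (funext fun x => map_add (φ.localized _) (s.1 x) (t.1 x))

theorem onSections_sq_mul (U : (TopologicalSpace.Opens (ProjectiveSpectrum.top 𝒜))ᵒᵖ)
    (a s : (ProjectiveSpectrum.Proj.structureSheaf 𝒜).1.obj U) :
    φ.onSections U (a ^ 2 * s) = a * φ.onSections U s :=
  Proj.ext _ _ _ (funext fun x => φ.localized_sq_mul _ (a.1 x) (s.1 x))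

theorem onSections_sq (U : (TopologicalSpace.Opens (ProjectiveSpectrum.top 𝒜))ᵒᵖ)
    (a : (ProjectiveSpectrum.Proj.structureSheaf 𝒜).1.obj U) :
    φ.onSections U (a ^ 2) = a := by
  have h : φ.onSections U 1 = 1 := Proj.ext _ _ _ (funext fun x => φ.localized_one _)
  have h1 := φ.onSections_sq_mul U a 1
  rwa [mul_one, h, mul_one] at h1

/-- The splitting of the structure sheaf of `Proj` induced by a graded splitting. -/
def frobeniusSplitting : FrobeniusSplitting 2 (Proj 𝒜) where
  toFun U := φ.onSections (Opposite.op U)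
  map_res _ _ := rfl
  map_pow_mul U a s := φ.onSections_sq_mul (Opposite.op U) a s
  map_pow U a := φ.onSections_sq (Opposite.op U) a

theorem isFrobeniusSplit (φ : GradedSplitting 𝒜) : IsFrobeniusSplit 2 (Proj 𝒜) :=
  ⟨φ.frobeniusSplitting⟩

end GradedSplitting

end GradedSplitting

/-! ### The twisted trace -/

section Trace

variable {k : Type u} [Field k] [CharP k 2] [PerfectRing k 2]

/-- The exponent `2 * e + (1, 1, 1, 1)`. -/
noncomputable def oddExponent (e : Fin 4 →₀ ℕ) : Fin 4 →₀ ℕ :=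
  e + e + Finsupp.equivFunOnFinite.symm 1

theorem oddExponent_injective : Function.Injective oddExponent := by
  intro d e h
  ext i
  have := DFunLike.congr_fun h i
  simp only [oddExponent, Finsupp.add_apply] at this
  omega

/-- The trace of the polynomial ring over its subring of squares: it sends a monomial whose
exponents are all odd, `c * x ^ (2 * e + 1)`, to the square root of `c` times `x ^ e`, and all
others to zero. -/
noncomputable def sqrtTrace (p : MvPolynomial (Fin 4) k) : MvPolynomial (Fin 4) k :=
  .ofCoeff (((AddMonoidAlgebra.coeff p).comapDomain oddExponent
    oddExponent_injective.injOn).mapRange (frobeniusEquiv k 2).symm (map_zero _))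

theorem coeff_sqrtTrace (e : Fin 4 →₀ ℕ) (p : MvPolynomial (Fin 4) k) :
    coeff e (sqrtTrace p) = (frobeniusEquiv k 2).symm (coeff (oddExponent e) p) := rfl

theorem sqrtTrace_add (p q : MvPolynomial (Fin 4) k) :
    sqrtTrace (p + q) = sqrtTrace p + sqrtTrace q := by
  ext e
  simp only [coeff_sqrtTrace, coeff_add, map_add]

theorem sqrtTrace_sq_mul (a s : MvPolynomial (Fin 4) k) :
    sqrtTrace (a ^ 2 * s) = a * sqrtTrace s := by
  induction a using MvPolynomial.induction_on' with
  | add p q hp hq =>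
    rw [CharTwo.add_sq, add_mul, sqrtTrace_add, hp, hq, add_mul]
  | monomial d c =>
    ext e
    rw [coeff_sqrtTrace, monomial_pow, coeff_monomial_mul', coeff_monomial_mul']
    have hle : 2 • d ≤ oddExponent e ↔ d ≤ e := by
      simp only [Finsupp.le_def, oddExponent, Finsupp.add_apply, Finsupp.smul_apply,
        Finsupp.equivFunOnFinite_symm_apply_apply, Pi.one_apply, smul_eq_mul]
      exact forall_congr' fun i => by omega
    by_cases h : d ≤ e
    · rw [if_pos (hle.mpr h), if_pos h, map_mul, coeff_sqrtTrace]
      congr 1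
      · rw [RingEquiv.symm_apply_eq, frobeniusEquiv_apply, frobenius_def]
      · congr 2
        ext i
        have := Finsupp.le_def.mp h i
        simp only [oddExponent, Finsupp.add_apply, Finsupp.tsub_apply, Finsupp.smul_apply,
          smul_eq_mul]
        omega
    · rw [if_neg (mt hle.mp h), if_neg h, map_zero]

theorem degree_oddExponent (e : Fin 4 →₀ ℕ) : (oddExponent e).degree = e.degree + e.degree + 4 := by
  simp only [oddExponent, Finsupp.degree_eq_sum, Fin.sum_univ_four, Finsupp.add_apply,
    Finsupp.equivFunOnFinite_symm_apply_apply, Pi.one_apply]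
  omega

theorem sqrtTrace_isHomogeneous {p : MvPolynomial (Fin 4) k} {n : ℕ}
    (hp : p.IsHomogeneous (n + n + 4)) : (sqrtTrace p).IsHomogeneous n := by
  intro e he
  rw [coeff_sqrtTrace] at he
  by_contra hne
  refine he ?_
  rw [hp.coeff_eq_zero, map_zero]
  rw [degree_oddExponent]
  have : e.degree ≠ n := by rwa [Finsupp.degree_eq_weight_one]
  omega

theorem omitExponent_add_single (l : Fin 4) :
    Finsupp.single l 1 + omitExponent l = oddExponent 0 := by
  ext i
  by_cases h : i = l
  · subst h; simp [omitExponent, oddExponent]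
  · simp [omitExponent, oddExponent, h]

/-- The twist of the trace by `h * x_l / c`, where `c` is the coefficient in the cubic form `h` of
the product of the variables other than `x_l`. It descends to the quotient by `h`, and there it
sends `1` to `1`. -/
noncomputable def twistedTrace (h : MvPolynomial (Fin 4) k) (l : Fin 4) :
    MvPolynomial (Fin 4) k →+ MvPolynomial (Fin 4) k :=
  AddMonoidHom.mk' (fun s => sqrtTrace (C (coeff (omitExponent l) h)⁻¹ * X l * h * s))
    fun s t => by rw [mul_add, sqrtTrace_add]

theorem twistedTrace_one {h : MvPolynomial (Fin 4) k} (hh : h.IsHomogeneous 3) {l : Fin 4}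
    (hl : coeff (omitExponent l) h ≠ 0) : twistedTrace h l 1 = 1 := by
  have hhom : (C (coeff (omitExponent l) h)⁻¹ * X l * h * 1).IsHomogeneous (0 + 0 + 4) := by
    rw [mul_one]
    exact ((isHomogeneous_C _ _).mul (isHomogeneous_X _ _)).mul hh
  change sqrtTrace _ = 1
  ext e
  rw [coeff_sqrtTrace, coeff_one]
  split_ifs with he
  · rw [← he, ← omitExponent_add_single l, mul_one, mul_assoc, coeff_C_mul, coeff_X_mul,
      inv_mul_cancel₀ hl, map_one]
  · rw [hhom.coeff_eq_zero, map_zero]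
    rw [degree_oddExponent]
    have : e.degree ≠ 0 := by rw [Ne, Finsupp.degree_eq_zero_iff]; exact fun h => he h.symm
    omega

/-- The additive map induced on a quotient ring. -/
def quotientAddMap {R : Type*} [CommRing R] (I : Ideal R) (g : R →+ R) (hg : ∀ s ∈ I, g s ∈ I) :
    R ⧸ I →+ R ⧸ I :=
  QuotientAddGroup.lift I.toAddSubgroup ((Ideal.Quotient.mk I).toAddMonoidHom.comp g)
    fun s hs => Ideal.Quotient.eq_zero_iff_mem.mpr (hg s hs)

theorem quotientAddMap_mk {R : Type*} [CommRing R] (I : Ideal R) (g : R →+ R)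
    (hg : ∀ s ∈ I, g s ∈ I) (s : R) :
    quotientAddMap I g hg (Ideal.Quotient.mk I s) = Ideal.Quotient.mk I (g s) := rfl

theorem twistedTrace_apply (h : MvPolynomial (Fin 4) k) (l : Fin 4) (s : MvPolynomial (Fin 4) k) :
    twistedTrace h l s = sqrtTrace (C (coeff (omitExponent l) h)⁻¹ * X l * h * s) := rfl

theorem twistedTrace_sq_mul (h : MvPolynomial (Fin 4) k) (l : Fin 4)
    (a s : MvPolynomial (Fin 4) k) : twistedTrace h l (a ^ 2 * s) = a * twistedTrace h l s := by
  rw [twistedTrace_apply, twistedTrace_apply, ← sqrtTrace_sq_mul]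
  congr 1
  ring

theorem twistedTrace_mem {h : MvPolynomial (Fin 4) k} {l : Fin 4} {s : MvPolynomial (Fin 4) k}
    (hs : s ∈ Ideal.span {h}) : twistedTrace h l s ∈ Ideal.span {h} := by
  rw [Ideal.mem_span_singleton] at hs ⊢
  obtain ⟨g, rfl⟩ := hs
  have h1 : C (coeff (omitExponent l) h)⁻¹ * X l * h * (h * g) =
      h ^ 2 * (C (coeff (omitExponent l) h)⁻¹ * X l * g) := by ring
  rw [twistedTrace_apply, h1, sqrtTrace_sq_mul]
  exact Dvd.intro _ rfl

theorem twistedTrace_isHomogeneous {h : MvPolynomial (Fin 4) k} (hh : h.IsHomogeneous 3)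
    (l : Fin 4) {n : ℕ} {s : MvPolynomial (Fin 4) k} (hs : s.IsHomogeneous (n + n)) :
    (twistedTrace h l s).IsHomogeneous n := by
  rw [twistedTrace_apply]
  refine sqrtTrace_isHomogeneous ?_
  rw [show n + n + 4 = 0 + 1 + 3 + (n + n) by omega]
  exact (((isHomogeneous_C _ _).mul (isHomogeneous_X _ _)).mul hh).mul hs

/-- The graded splitting of the homogeneous coordinate ring induced by the twisted trace. -/
noncomputable def gradedSplitting (f : CubicForm k) {l : Fin 4}
    (hl : coeff (omitExponent l) f.1 ≠ 0) : GradedSplitting (coordGrading f) where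
  toFun := quotientAddMap _ (twistedTrace f.1 l) fun _ => twistedTrace_mem
  map_sq_mul a s := by
    obtain ⟨a, rfl⟩ := Ideal.Quotient.mk_surjective a
    obtain ⟨s, rfl⟩ := Ideal.Quotient.mk_surjective s
    rw [← map_pow, ← map_mul, quotientAddMap_mk, quotientAddMap_mk, twistedTrace_sq_mul, map_mul]
  map_one := by
    rw [← map_one (Ideal.Quotient.mk _), quotientAddMap_mk,
      twistedTrace_one ((mem_homogeneousSubmodule _ _).mp f.2) hl]
  map_mem := by
    rintro n _ ⟨a, ha, rfl⟩
    exact ⟨twistedTrace f.1 l a, (mem_homogeneousSubmodule _ _).mpr (twistedTrace_isHomogeneous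
      ((mem_homogeneousSubmodule _ _).mp f.2) l ((mem_homogeneousSubmodule _ _).mp ha)), rfl⟩

/-- One direction of Fedder's criterion: a cubic form with a squarefree monomial defines a
Frobenius split surface. -/
theorem isFrobeniusSplit_of_coeff_ne_zero (f : CubicForm k) {l : Fin 4}
    (hl : coeff (omitExponent l) f.1 ≠ 0) : IsFrobeniusSplit 2 (surface f) :=
  (gradedSplitting f hl).isFrobeniusSplit

end Trace

/-! ### A Čech argument against Frobenius splittings -/

section Cech

open HomogeneousLocalization

variable {k A : Type u} [Field k] [CommRing A] [Algebra k A] {𝒜 : ℕ → Submodule k A}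
  [GradedAlgebra 𝒜]

/-- The ring of degree zero fractions with denominator a power of `g`, as a ring of sections. -/
noncomputable def awaySections {g : A} {m : ℕ} (hg : g ∈ 𝒜 m) (hm : 0 < m) :
    Away 𝒜 g ≃+* Γ(Proj 𝒜, Proj.basicOpen 𝒜 g) :=
  (Proj.basicOpenIsoAway 𝒜 g hg hm).commRingCatIsoToRingEquiv

/-- A Frobenius splitting of `Proj`, evaluated on degree zero fractions with denominator a power
of `g`. -/
noncomputable def FrobeniusSplitting.onAway (φ : FrobeniusSplitting 2 (Proj 𝒜)) {g : A} {m : ℕ}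
    (hg : g ∈ 𝒜 m) (hm : 0 < m) : Away 𝒜 g →+ Away 𝒜 g :=
  (awaySections hg hm).symm.toAddMonoidHom.comp
    ((φ.toFun (Proj.basicOpen 𝒜 g)).comp (awaySections hg hm).toAddMonoidHom)

variable (φ : FrobeniusSplitting 2 (Proj 𝒜)) {g : A} {m : ℕ} (hg : g ∈ 𝒜 m) (hm : 0 < m)

theorem FrobeniusSplitting.onAway_apply (s : Away 𝒜 g) : φ.onAway hg hm s =
    (awaySections hg hm).symm (φ.toFun (Proj.basicOpen 𝒜 g) (awaySections hg hm s)) := rfl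

theorem FrobeniusSplitting.onAway_sq_mul (a s : Away 𝒜 g) :
    φ.onAway hg hm (a ^ 2 * s) = a * φ.onAway hg hm s := by
  rw [onAway_apply, onAway_apply, map_mul, _root_.map_pow, φ.map_pow_mul, map_mul,
    RingEquiv.symm_apply_apply]

theorem FrobeniusSplitting.onAway_sq (a : Away 𝒜 g) : φ.onAway hg hm (a ^ 2) = a := by
  rw [onAway_apply, _root_.map_pow, φ.map_pow, RingEquiv.symm_apply_apply]

theorem awaySections_awayMap {t x : A} {n : ℕ} (ht : t ∈ 𝒜 n) (hx : x = g * t)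
    {l : ℕ} (hxl : x ∈ 𝒜 l) (hl : 0 < l) (s : Away 𝒜 g) :
    awaySections hxl hl (awayMap 𝒜 ht hx s) =
      (Proj 𝒜).presheaf.map (homOfLE (Proj.basicOpen_mono 𝒜 g x ⟨_, hx⟩)).op
        (awaySections hg hm s) :=
  congr($(Proj.awayMap_awayToSection 𝒜 ht hx).hom s)

theorem FrobeniusSplitting.onAway_awayMap {t x : A} {n : ℕ} (ht : t ∈ 𝒜 n) (hx : x = g * t)
    {l : ℕ} (hxl : x ∈ 𝒜 l) (hl : 0 < l) (s : Away 𝒜 g) :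
    φ.onAway hxl hl (awayMap 𝒜 ht hx s) = awayMap 𝒜 ht hx (φ.onAway hg hm s) := by
  rw [onAway_apply, awaySections_awayMap hg hm, φ.map_res, RingEquiv.symm_apply_eq,
    awaySections_awayMap hg hm, onAway_apply, RingEquiv.apply_symm_apply]

/-- The value of a splitting on `t ^ 2 * e / (x * y) ^ 2 = (t / x) ^ 2 * (x ^ 2 * e / (x * y) ^ 2)`
is `t * B / (x * y) ^ N` with a numerator `B` that depends neither on `t` nor on the smaller open
set, the locus where `x * y * z` does not vanish, on which the value is taken. -/
theorem FrobeniusSplitting.exists_onAway_mul {x y e : A} (hx : x ∈ 𝒜 1) (hy : y ∈ 𝒜 1)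
    (he : e ∈ 𝒜 2) : ∀ᶠ N in Filter.atTop, ∃ B : A, ∀ (z t w : A) (hz : z ∈ 𝒜 1) (ht : t ∈ 𝒜 1)
      (hw : w ∈ 𝒜 3) (_ : w = x * y * z) (hn : t ^ 2 * z ^ 2 * e ∈ 𝒜 (2 • 3)),
      algebraMap A (Localization.Away w) ((x * y) ^ N) *
        (φ.onAway hw (by norm_num) (Away.mk 𝒜 hw 2 (t ^ 2 * z ^ 2 * e) hn)).val =
        algebraMap A (Localization.Away w) (t * B) := by
  have hxy : x * y ∈ 𝒜 2 := SetLike.mul_mem_graded hx hy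
  have hnum : x ^ 2 * e ∈ 𝒜 (2 • 2) :=
    SetLike.mul_mem_graded (SetLike.pow_mem_graded (i := 1) 2 hx) he
  obtain ⟨n, C, hC, hnC⟩ := Away.mk_surjective 𝒜 hxy
    (φ.onAway hxy (by norm_num) (Away.mk 𝒜 hxy 2 (x ^ 2 * e) hnum))
  filter_upwards [Filter.eventually_ge_atTop (n + 1)] with N hN
  obtain ⟨N, rfl⟩ := Nat.exists_eq_add_of_le hN
  refine ⟨y * C * (x * y) ^ N, fun z t w hz ht hw hwz hn => ?_⟩
  have hty : t * y * z ∈ 𝒜 (1 • 3) :=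
    SetLike.mul_mem_graded (i := 2) (SetLike.mul_mem_graded ht hy) hz
  have h1 : Away.mk 𝒜 hw 2 (t ^ 2 * z ^ 2 * e) hn =
      (Away.mk 𝒜 hw 1 (t * y * z) hty) ^ 2 *
        awayMap 𝒜 hz hwz (Away.mk 𝒜 hxy 2 (x ^ 2 * e) hnum) := by
    rw [awayMap_mk]
    ext
    simp only [val_mul, val_pow, Away.val_mk, Localization.mk_pow, Localization.mk_mul]
    rw [Localization.mk_eq_mk_iff, Localization.r_iff_exists]
    refine ⟨1, ?_⟩
    simp only [OneMemClass.coe_one, one_mul, Submonoid.coe_mul, SubmonoidClass.coe_pow, hwz]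
    ring
  rw [h1, φ.onAway_sq_mul, φ.onAway_awayMap hxy (by norm_num), ← hnC, awayMap_mk]
  simp only [val_mul, Away.val_mk, Localization.mk_mul, ← Localization.mk_one_eq_algebraMap]
  rw [Localization.mk_eq_mk_iff, Localization.r_iff_exists]
  refine ⟨1, ?_⟩
  simp only [OneMemClass.coe_one, one_mul, Submonoid.coe_mul, hwz]
  ring

/-- The numerators of the values on `t ^ 2 * L i * L l / (x j * x m) ^ 2`, where `j` and `m` are
the two indices other than `i` and `l`, can be chosen symmetric in `i` and `l`, since the fraction
and the open set where it is defined are. -/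
theorem FrobeniusSplitting.exists_symmetric_onAway_mul {x L : Fin 4 → A} (hx : ∀ i, x i ∈ 𝒜 1)
    (hL : ∀ i, L i ∈ 𝒜 1) : ∃ (N : ℕ) (B : Fin 4 → Fin 4 → A), (∀ i l, B i l = B l i) ∧
      ∀ (i l : Fin 4), l ≠ i → ∀ (t w : A) (_ : t ∈ 𝒜 1)
        (hw : w ∈ 𝒜 3) (_ : w = ∏ j ∈ Finset.univ.erase i, x j)
        (hn : t ^ 2 * x l ^ 2 * (L i * L l) ∈ 𝒜 (2 • 3)),
      algebraMap A (Localization.Away w) (w ^ (N + 1)) *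
        (φ.onAway hw (by norm_num) (Away.mk 𝒜 hw 2 (t ^ 2 * x l ^ 2 * (L i * L l)) hn)).val =
        algebraMap A (Localization.Away w) (t * B i l * x l ^ (N + 1)) := by
  have key (i l : Fin 4) : ∀ᶠ N in Filter.atTop, ∃ B : A, l ≠ i →
      ∀ (z t w : A) (_ : z ∈ 𝒜 1) (_ : t ∈ 𝒜 1)
        (hw : w ∈ 𝒜 3) (_ : w = (∏ j ∈ (Finset.univ.erase i).erase l, x j) * z)
        (hn : t ^ 2 * z ^ 2 * (L i * L l) ∈ 𝒜 (2 • 3)),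
      algebraMap A (Localization.Away w) ((∏ j ∈ (Finset.univ.erase i).erase l, x j) ^ N) *
        (φ.onAway hw (by norm_num) (Away.mk 𝒜 hw 2 (t ^ 2 * z ^ 2 * (L i * L l)) hn)).val =
        algebraMap A (Localization.Away w) (t * B) := by
    by_cases hil : l = i
    · exact Filter.Eventually.of_forall fun N => ⟨0, fun h => absurd hil h⟩
    obtain ⟨j, m, hjm, hs⟩ : ∃ j m : Fin 4, j ≠ m ∧ (Finset.univ.erase i).erase l = {j, m} := by
      revert i l; decide
    filter_upwards [φ.exists_onAway_mul (hx j) (hx m) (SetLike.mul_mem_graded (hL i) (hL l))]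
      with N hN
    obtain ⟨B, hB⟩ := hN
    refine ⟨B, fun _ => ?_⟩
    rw [hs, Finset.prod_pair hjm]
    exact hB
  have key' : ∀ᶠ N in Filter.atTop, ∀ i l : Fin 4, _ :=
    Filter.eventually_all.mpr fun i => Filter.eventually_all.mpr fun l => key i l
  obtain ⟨N, hN, hN1⟩ := (key'.and (Filter.eventually_ge_atTop 1)).exists
  obtain ⟨N, rfl⟩ := Nat.exists_eq_add_of_le' hN1
  choose B hB using hN
  refine ⟨N, fun i l => B (min i l) (max i l), fun i l => by simp only [min_comm, max_comm], ?_⟩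
  intro i l hl t w ht hw hwx hn
  have hmul : w = (∏ j ∈ (Finset.univ.erase i).erase l, x j) * x l := by
    rw [hwx, Finset.prod_erase_mul _ _ (Finset.mem_erase.mpr ⟨hl, Finset.mem_univ l⟩)]
  have hB' : algebraMap A (Localization.Away w)
      ((∏ j ∈ (Finset.univ.erase i).erase l, x j) ^ (N + 1)) *
        (φ.onAway hw (by norm_num) (Away.mk 𝒜 hw 2 (t ^ 2 * x l ^ 2 * (L i * L l)) hn)).val =
        algebraMap A (Localization.Away w) (t * B (min i l) (max i l)) := by
    rcases lt_or_gt_of_ne hl with h | h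
    · rw [min_eq_right h.le, max_eq_left h.le]
      have hcomm : L i * L l = L l * L i := mul_comm _ _
      have herase : (Finset.univ.erase i).erase l = (Finset.univ.erase l).erase i :=
        Finset.erase_right_comm
      simp only [hcomm] at hn ⊢
      rw [herase] at hmul ⊢
      exact hB l i hl.symm (x l) t w (hx l) ht hw hmul hn
    · rw [min_eq_left h.le, max_eq_right h.le]
      exact hB i l hl (x l) t w (hx l) ht hw hmul hn
  have hpow : algebraMap A (Localization.Away w) (w ^ (N + 1)) =
      algebraMap A _ ((∏ j ∈ (Finset.univ.erase i).erase l, x j) ^ (N + 1)) *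
        algebraMap A _ (x l ^ (N + 1)) := by
    rw [← map_mul, ← mul_pow, ← hmul]
  rw [hpow, map_mul _ (t * _)]
  linear_combination algebraMap A (Localization.Away w) (x l ^ (N + 1)) * hB'

/-- The relation `∑ i, x i ^ 2 * L i = 0` makes the square of `x i * L i / w`, where `w` is the
product of the other three variables, a sum of fractions `L i * L l / (x j * x m) ^ 2`. A splitting
then writes `x i * L i / w` itself as a sum of values with symmetric numerators, up to a power of
`w`. -/
theorem FrobeniusSplitting.exists_cech (φ : FrobeniusSplitting 2 (Proj 𝒜)) (h2 : (2 : A) = 0)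
    {x L : Fin 4 → A} (hx : ∀ i, x i ∈ 𝒜 1) (hL : ∀ i, L i ∈ 𝒜 1) (hrel : ∑ i, x i ^ 2 * L i = 0) :
    ∃ (N K : ℕ) (B : Fin 4 → Fin 4 → A), (∀ i l, B i l = B l i) ∧
      ∀ i, (∏ j ∈ Finset.univ.erase i, x j) ^ K *
        (x i * L i * (∏ j ∈ Finset.univ.erase i, x j) ^ N -
          ∑ l ∈ Finset.univ.erase i, B i l * x l ^ (N + 1)) = 0 := by
  obtain ⟨N, B, hsymm, hB⟩ := φ.exists_symmetric_onAway_mul hx hL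
  have key (i : Fin 4) : ∀ᶠ K in Filter.atTop, (∏ j ∈ Finset.univ.erase i, x j) ^ K *
        (x i * L i * (∏ j ∈ Finset.univ.erase i, x j) ^ N -
          ∑ l ∈ Finset.univ.erase i, B i l * x l ^ (N + 1)) = 0 := by
    -- Any variable other than `x i` serves as the auxiliary form `t`; it divides `w`.
    obtain ⟨t, ht⟩ := exists_ne i
    obtain ⟨w, hwx⟩ : ∃ w, w = ∏ j ∈ Finset.univ.erase i, x j := ⟨_, rfl⟩
    have hw : w ∈ 𝒜 3 := by
      have h := SetLike.prod_mem_graded 𝒜 (fun _ : Fin 4 => 1) x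
        (F := Finset.univ.erase i) fun j _ => hx j
      rw [← hwx] at h
      simpa using h
    have hnum : x t * (x i * L i) ∈ 𝒜 (1 • 3) :=
      SetLike.mul_mem_graded (j := 2) (hx t) (SetLike.mul_mem_graded (hx i) (hL i))
    have hnum' (l : Fin 4) : x t ^ 2 * x l ^ 2 * (L i * L l) ∈ 𝒜 (2 • 3) :=
      SetLike.mul_mem_graded (i := 4) (j := 2)
        (SetLike.mul_mem_graded (SetLike.pow_mem_graded (i := 1) 2 (hx t))
          (SetLike.pow_mem_graded (i := 1) 2 (hx l))) (SetLike.mul_mem_graded (hL i) (hL l))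
    have hrel' : x i ^ 2 * L i = ∑ l ∈ Finset.univ.erase i, x l ^ 2 * L l := by
      rw [← Finset.add_sum_erase _ _ (Finset.mem_univ i)] at hrel
      linear_combination (x i ^ 2 * L i) * h2 - hrel
    have hsum : (Away.mk 𝒜 hw 1 _ hnum) ^ 2 = ∑ l ∈ Finset.univ.erase i,
        Away.mk 𝒜 hw 2 _ (hnum' l) := by
      ext
      rw [val_pow, ← HomogeneousLocalization.algebraMap_apply (∑ l ∈ _, _), map_sum]
      simp only [HomogeneousLocalization.algebraMap_apply, Away.val_mk, Localization.mk_pow]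
      rw [← Localization.mk_sum]
      have e : (x t * (x i * L i)) ^ 2 =
          ∑ l ∈ Finset.univ.erase i, x t ^ 2 * x l ^ 2 * (L i * L l) := by
        calc _ = x t ^ 2 * L i * (x i ^ 2 * L i) := by ring
          _ = _ := by rw [hrel', Finset.mul_sum]; exact Finset.sum_congr rfl fun l _ => by ring
      rw [← e]
      congr 1
      ext
      simp
    have h1 : Away.mk 𝒜 hw 1 _ hnum = ∑ l ∈ Finset.univ.erase i,
        φ.onAway hw (by norm_num) (Away.mk 𝒜 hw 2 _ (hnum' l)) := by
      rw [← map_sum, ← hsum, φ.onAway_sq]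
    have h3 : algebraMap A (Localization.Away w) (x t * (x i * L i * w ^ N)) =
        algebraMap A (Localization.Away w)
          (x t * ∑ l ∈ Finset.univ.erase i, B i l * x l ^ (N + 1)) := by
      have h4 := congrArg (fun y => algebraMap A (Localization.Away w) (w ^ (N + 1)) *
        algebraMap (Away 𝒜 w) _ y) h1
      simp only [map_sum, Finset.mul_sum, HomogeneousLocalization.algebraMap_apply] at h4
      rw [Finset.sum_congr rfl fun l hl => hB i l (Finset.ne_of_mem_erase hl) (x t) w (hx t) hw
        hwx (hnum' l), ← map_sum, Away.val_mk, ← Localization.mk_one_eq_algebraMap,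
        Localization.mk_mul] at h4
      rw [Finset.mul_sum, Finset.sum_congr rfl fun l _ => (mul_assoc (x t) _ _).symm, ← h4,
        ← Localization.mk_one_eq_algebraMap, Localization.mk_eq_mk_iff, Localization.r_iff_exists]
      refine ⟨1, ?_⟩
      simp only [OneMemClass.coe_one, one_mul, pow_one]
      ring
    obtain ⟨⟨_, n, rfl⟩, hn⟩ := (IsLocalization.eq_iff_exists (Submonoid.powers w) _).mp h3
    filter_upwards [Filter.eventually_ge_atTop (n + 1)] with K hK
    obtain ⟨K, rfl⟩ := Nat.exists_eq_add_of_le hK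
    have hw' : w = (∏ j ∈ (Finset.univ.erase i).erase t, x j) * x t := by
      rw [hwx, Finset.prod_erase_mul _ _ (Finset.mem_erase.mpr ⟨ht, Finset.mem_univ t⟩)]
    rw [← hwx, pow_add, pow_succ]
    nth_rewrite 2 [hw']
    simp only at hn
    linear_combination (w ^ K * ∏ j ∈ (Finset.univ.erase i).erase t, x j) * hn
  obtain ⟨K, hK⟩ := (Filter.eventually_all.mpr key).exists
  exact ⟨N, K, B, hsymm, hK⟩

end Cech

/-! ### Surfaces that are not Frobenius split -/

section NotSplit

variable {k : Type u} [Field k] [CharP k 2]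

/-- The linear forms `L_i` with `frobForm M = ∑ i, x_i ^ 2 * L_i`. -/
noncomputable def rowForm (M : Matrix (Fin 4) (Fin 4) k) (i : Fin 4) : MvPolynomial (Fin 4) k :=
  ∑ j, C (M i j) * X j

omit [CharP k 2] in
theorem frobForm_eq_sum_rowForm (M : Matrix (Fin 4) (Fin 4) k) :
    frobForm M = ∑ i, X i ^ 2 * rowForm M i := by
  simp only [frobForm, rowForm, Finset.mul_sum]
  exact Finset.sum_congr rfl fun i _ => Finset.sum_congr rfl fun j _ => by ring

omit [CharP k 2] in
theorem rowForm_isHomogeneous (M : Matrix (Fin 4) (Fin 4) k) (i : Fin 4) :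
    (rowForm M i).IsHomogeneous 1 :=
  IsHomogeneous.sum _ _ _ fun j _ => (isHomogeneous_C_mul_X _ j)

/-- In characteristic two, the off-diagonal entries of a symmetric matrix add up to zero. -/
theorem sum_erase_eq_zero {R : Type*} [CommRing R] (h2 : (2 : R) = 0) {T : Fin 4 → Fin 4 → R}
    (hT : ∀ i l, T i l = T l i) : ∑ i, ∑ l ∈ Finset.univ.erase i, T i l = 0 := by
  have he (i : Fin 4) : ∑ l ∈ Finset.univ.erase i, T i l = ∑ l, T i l - T i i := by
    rw [← Finset.add_sum_erase _ _ (Finset.mem_univ i), add_sub_cancel_left]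
  simp only [he, Fin.sum_univ_four]
  rw [hT 1 0, hT 2 0, hT 3 0, hT 2 1, hT 3 1, hT 3 2]
  linear_combination (T 0 1 + T 0 2 + T 0 3 + T 1 2 + T 1 3 + T 2 3) * h2

omit [CharP k 2] in
theorem prod_X_pow_ne_sum {n : ℕ} (G : Fin 4 → MvPolynomial (Fin 4) k) :
    (∏ j, X j : MvPolynomial (Fin 4) k) ^ n ≠ ∑ i, X i ^ (n + 1) * G i := by
  intro h
  have h1 := congrArg (coeff (Finsupp.equivFunOnFinite.symm fun _ => n)) h
  have hl : (∏ j, X j : MvPolynomial (Fin 4) k) ^ n =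
      monomial (Finsupp.equivFunOnFinite.symm fun _ => n) 1 := by
    rw [← Finset.prod_pow, monomial_eq, Finsupp.prod_fintype _ _ fun _ => pow_zero _]
    simp
  rw [hl, coeff_monomial, if_pos rfl, coeff_sum] at h1
  refine one_ne_zero (h1.trans (Finset.sum_eq_zero fun i _ => ?_))
  rw [X_pow_eq_monomial, coeff_monomial_mul', if_neg]
  rw [Finsupp.single_le_iff]
  simp

/-- The other direction of Fedder's criterion: a cubic form without squarefree monomials does not
define a Frobenius split surface. The relations of `exists_cech`, lifted to polynomials, multiplied
by `x_i ^ (K + N + 1)` and added up, would write a power of the product of the variables as a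
combination of higher powers of single variables, because the symmetric terms cancel. -/
theorem not_isFrobeniusSplit {f : CubicForm k} {M : Matrix (Fin 4) (Fin 4) k}
    (hf : f.1 = frobForm M) (hf0 : f.1 ≠ 0) : ¬ IsFrobeniusSplit 2 (surface f) := by
  rintro ⟨φ⟩
  have h2' : (2 : MvPolynomial (Fin 4) k) = 0 := CharTwo.two_eq_zero
  have h2 : (2 : CoordRing f) = 0 := by
    rw [← map_ofNat (Ideal.Quotient.mk _) 2, h2', map_zero]
  have hdeg {p : MvPolynomial (Fin 4) k} (hp : p.IsHomogeneous 1) :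
      Ideal.Quotient.mk (Ideal.span {f.1}) p ∈ coordGrading f 1 :=
    mk_mem_quotientGrading _ _ ((mem_homogeneousSubmodule _ _).mpr hp)
  have hrel : ∑ i, Ideal.Quotient.mk (Ideal.span {f.1}) (X i) ^ 2 *
      Ideal.Quotient.mk (Ideal.span {f.1}) (rowForm M i) = 0 := by
    simp only [← map_pow, ← map_mul, ← map_sum]
    rw [← frobForm_eq_sum_rowForm, ← hf]
    exact Ideal.Quotient.eq_zero_iff_mem.mpr (Ideal.mem_span_singleton_self _)
  obtain ⟨N, K, B, hB, h⟩ := FrobeniusSplitting.exists_cech (𝒜 := coordGrading f) φ h2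
    (fun i => hdeg (isHomogeneous_X k i)) (fun i => hdeg (rowForm_isHomogeneous M i)) hrel
  obtain ⟨b, hbsymm, hb⟩ : ∃ b : Fin 4 → Fin 4 → MvPolynomial (Fin 4) k,
      (∀ i l, b i l = b l i) ∧ ∀ i l, Ideal.Quotient.mk _ (b i l) = B i l := by
    choose b hb using fun i l => Ideal.Quotient.mk_surjective (B i l)
    refine ⟨fun i l => b (min i l) (max i l), fun i l => by simp only [min_comm, max_comm],
      fun i l => ?_⟩
    rcases le_total i l with hil | hil
    · simp only [min_eq_left hil, max_eq_right hil, hb]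
    · simp only [min_eq_right hil, max_eq_left hil, hb, hB i l]
  have hdvd (i : Fin 4) : f.1 ∣ (∏ j ∈ Finset.univ.erase i, X j) ^ K *
      (X i * rowForm M i * (∏ j ∈ Finset.univ.erase i, X j) ^ N -
        ∑ l ∈ Finset.univ.erase i, b i l * X l ^ (N + 1)) := by
    rw [← Ideal.mem_span_singleton, ← Ideal.Quotient.eq_zero_iff_mem, ← h i]
    simp only [map_mul, map_pow, map_sub, map_sum, map_prod, hb]
  choose G hG using hdvd
  have hmul (i : Fin 4) : X i ^ (K + N + 1) * ((∏ j ∈ Finset.univ.erase i, X j) ^ K *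
      (X i * rowForm M i * (∏ j ∈ Finset.univ.erase i, X j) ^ N -
        ∑ l ∈ Finset.univ.erase i, b i l * X l ^ (N + 1))) =
      (∏ j, X j) ^ K * ((∏ j, X j) ^ N * (X i ^ 2 * rowForm M i) -
        ∑ l ∈ Finset.univ.erase i, b i l * (X i ^ (N + 1) * X l ^ (N + 1))) := by
    have hs : ∑ l ∈ Finset.univ.erase i, b i l * (X i ^ (N + 1) * X l ^ (N + 1)) =
        X i ^ (N + 1) * ∑ l ∈ Finset.univ.erase i, b i l * X l ^ (N + 1) := by
      rw [Finset.mul_sum]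
      exact Finset.sum_congr rfl fun l _ => by ring
    rw [hs, ← Finset.mul_prod_erase _ _ (Finset.mem_univ i)]
    ring
  have hsum := Finset.sum_congr rfl fun (i : Fin 4) (_ : i ∈ Finset.univ) => hmul i
  rw [← Finset.mul_sum, Finset.sum_sub_distrib, ← Finset.mul_sum, ← frobForm_eq_sum_rowForm, ← hf,
    sum_erase_eq_zero h2' fun i l => by rw [hbsymm i l, mul_comm (X i ^ _)], sub_zero] at hsum
  simp only [hG] at hsum
  refine prod_X_pow_ne_sum (n := K + N) G (mul_left_cancel₀ hf0 ?_)
  rw [Finset.mul_sum, pow_add]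
  refine Eq.trans ?_ (hsum.symm.trans (Finset.sum_congr rfl fun i _ => ?_)) <;> ring

end NotSplit

/-! ### Affine charts of the surface -/

section Chart

open HomogeneousLocalization

attribute [local instance] MvPolynomial.gradedAlgebra

variable {k : Type u} [Field k]

/-- Setting the variable `x_i` to one; the other variables become `y_0, y_1, y_2` in order. -/
noncomputable def dehom (i : Fin 4) : MvPolynomial (Fin 4) k →ₐ[k] MvPolynomial (Fin 3) k :=
  aeval (i.insertNth 1 X)

@[simp]
theorem dehom_X_self (i : Fin 4) : dehom i (X i : MvPolynomial (Fin 4) k) = 1 := by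
  simp [dehom]

@[simp]
theorem dehom_X_succAbove (i : Fin 4) (j : Fin 3) :
    dehom i (X (i.succAbove j) : MvPolynomial (Fin 4) k) = X j := by
  simp [dehom]

@[simp]
theorem dehom_C (i : Fin 4) (c : k) : dehom i (C c) = C c := (dehom i).commutes c

/-- Homogeneous polynomials scale by the power of `u` given by their degree when all variables are
multiplied by `u`. -/
theorem map_eq_map_mul_pow {σ R : Type*} [Fintype σ] [CommRing R] {φ ψ : MvPolynomial σ k →+* R}
    {u : R} (hC : ∀ c, φ (C c) = ψ (C c)) (hX : ∀ j, φ (X j) = ψ (X j) * u) {n : ℕ}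
    {p : MvPolynomial σ k} (hp : p.IsHomogeneous n) : φ p = ψ p * u ^ n := by
  rw [p.as_sum, map_sum, map_sum, Finset.sum_mul]
  refine Finset.sum_congr rfl fun d hd => ?_
  have hdn : ∑ j, d j = n := by
    rw [← Finsupp.degree_eq_sum, Finsupp.degree_eq_weight_one]
    exact hp (mem_support_iff.mp hd)
  rw [monomial_eq, Finsupp.prod_fintype _ _ fun _ => pow_zero _]
  simp only [map_mul, map_prod, map_pow, hC, hX, mul_pow, Finset.prod_mul_distrib]
  rw [Finset.prod_pow_eq_pow_sum, hdn, mul_assoc]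

variable (f : CubicForm k) (i : Fin 4)

/-- The coordinate ring of the part of the surface where `x_i` does not vanish. -/
abbrev ChartRing : Type u := MvPolynomial (Fin 3) k ⧸ Ideal.span {dehom i f.1}

/-- The map from the homogeneous coordinate ring to the ring of a chart. -/
noncomputable def toChartRing : CoordRing f →+* ChartRing f i :=
  Ideal.quotientMap _ (dehom i).toRingHom <| by
    rw [Ideal.span_singleton_le_iff_mem, Ideal.mem_comap]
    exact Ideal.mem_span_singleton_self _

@[simp]
theorem toChartRing_mk (p : MvPolynomial (Fin 4) k) :
    toChartRing f i (Ideal.Quotient.mk _ p) = Ideal.Quotient.mk _ (dehom i p) :=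
  rfl

/-- The `i`-th coordinate function in the homogeneous coordinate ring. -/
noncomputable abbrev coord : CoordRing f := Ideal.Quotient.mk _ (X i)

theorem coord_mem : coord f i ∈ coordGrading f 1 :=
  mk_mem_quotientGrading _ _ ((mem_homogeneousSubmodule _ _).mpr (isHomogeneous_X k i))

theorem toChartRing_coord_self : toChartRing f i (coord f i) = 1 := by
  rw [coord, toChartRing_mk, dehom_X_self, map_one]

/-- Evaluation of degree zero fractions at `x_i = 1`. -/
noncomputable def awayToChart : Away (coordGrading f) (coord f i) →+* ChartRing f i :=
  (Localization.awayLift (toChartRing f i) (coord f i)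
    (by rw [toChartRing_coord_self]; exact isUnit_one)).comp
    (algebraMap (Away (coordGrading f) (coord f i)) (Localization.Away (coord f i)))

theorem awayToChart_mk (n : ℕ) (a : CoordRing f) (ha : a ∈ coordGrading f (n • 1)) :
    awayToChart f i (Away.mk _ (coord_mem f i) n a ha) = toChartRing f i a := by
  change Localization.awayLift (toChartRing f i) (coord f i)
    (by rw [toChartRing_coord_self]; exact isUnit_one) (Localization.mk a _) = _
  have h : toChartRing f i (coord f i) * 1 = 1 := by rw [toChartRing_coord_self, one_mul]
  rw [Localization.awayLift_mk (hv := h), one_pow, mul_one]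

theorem awayToChart_fromZero (c : k) : awayToChart f i (fromZeroRingHom (coordGrading f) _
    (algebraMap k (coordGrading f 0) c)) = Ideal.Quotient.mk _ (C c) := by
  have h : algebraMap k (CoordRing f) c ∈ coordGrading f (0 • 1) := by
    rw [zero_smul]
    exact (algebraMap k (coordGrading f 0) c).2
  have h1 : fromZeroRingHom (coordGrading f) (Submonoid.powers (coord f i))
      (algebraMap k (coordGrading f 0) c) = Away.mk _ (coord_mem f i) 0 (algebraMap k _ c) h := by
    ext
    rw [Away.val_mk]
    exact congrArg (Localization.mk _) (Subtype.ext (pow_zero _).symm)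
  rw [h1, awayToChart_mk]
  exact congrArg (Ideal.Quotient.mk _) (dehom_C i c)

/-- Substitution of `x_j / x_i` for the variables. -/
noncomputable def chartToAwayAux : MvPolynomial (Fin 3) k →+* Away (coordGrading f) (coord f i) :=
  eval₂Hom ((fromZeroRingHom (coordGrading f) _).comp (algebraMap k (coordGrading f 0)))
    fun j => Away.mk _ (coord_mem f i) 1 (coord f (i.succAbove j)) (coord_mem f _)

theorem chartToAwayAux_dehom {n : ℕ} {p : MvPolynomial (Fin 4) k} (hp : p.IsHomogeneous n)
    (h : Ideal.Quotient.mk _ p ∈ coordGrading f (n • 1)) :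
    chartToAwayAux f i (dehom i p) =
      Away.mk _ (coord_mem f i) n (Ideal.Quotient.mk _ p) h := by
  have key := map_eq_map_mul_pow
    (φ := (algebraMap _ (Localization.Away (coord f i))).comp
      (Ideal.Quotient.mk (Ideal.span {f.1})))
    (ψ := ((algebraMap _ (Localization.Away (coord f i))).comp (chartToAwayAux f i)).comp
      (dehom i).toRingHom) (u := algebraMap _ _ (coord f i)) (fun c => ?_) (fun j => ?_) hp
  · ext
    rw [Away.val_mk, Localization.mk_eq_mk', eq_comm, IsLocalization.mk'_eq_iff_eq_mul, map_pow]
    exact key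
  · simp only [RingHom.comp_apply, AlgHom.toRingHom_eq_coe, RingHom.coe_coe]
    rw [dehom_C, chartToAwayAux, eval₂Hom_C]
    rfl
  · simp only [RingHom.comp_apply, AlgHom.toRingHom_eq_coe, RingHom.coe_coe]
    rw [HomogeneousLocalization.algebraMap_apply]
    rcases Fin.eq_self_or_eq_succAbove i j with rfl | ⟨j, rfl⟩
    · rw [dehom_X_self, map_one, val_one, one_mul]
    · rw [dehom_X_succAbove, chartToAwayAux, eval₂Hom_X', Away.val_mk, Localization.mk_eq_mk']
      refine Eq.trans ?_ (congrArg (_ * algebraMap _ _ ·) (pow_one (coord f i)))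
      exact (IsLocalization.mk'_spec (Localization.Away (coord f i)) (coord f (i.succAbove j))
        (⟨coord f i ^ 1, 1, rfl⟩ : Submonoid.powers (coord f i))).symm

theorem chartToAwayAux_self : chartToAwayAux f i (dehom i f.1) = 0 := by
  have h : Ideal.Quotient.mk (Ideal.span {f.1}) f.1 = 0 :=
    Ideal.Quotient.eq_zero_iff_mem.mpr (Ideal.mem_span_singleton_self _)
  rw [chartToAwayAux_dehom f i ((mem_homogeneousSubmodule _ _).mp f.2)
    (by rw [h]; exact zero_mem _)]
  ext
  rw [Away.val_mk, val_zero, h, Localization.mk_zero]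

/-- The coordinate ring of a chart is the ring of degree zero fractions. -/
noncomputable def chartEquiv : Away (coordGrading f) (coord f i) ≃+* ChartRing f i :=
  RingEquiv.ofRingHom (awayToChart f i)
    (Ideal.Quotient.lift _ (chartToAwayAux f i) fun a ha => by
      obtain ⟨b, rfl⟩ := Ideal.mem_span_singleton.mp ha
      rw [map_mul, chartToAwayAux_self, zero_mul])
    (by
      refine Ideal.Quotient.ringHom_ext (MvPolynomial.ringHom_ext (fun c => ?_) fun j => ?_)
      · simp only [RingHom.comp_apply, Ideal.Quotient.lift_mk, chartToAwayAux, eval₂Hom_C,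
          RingHom.id_apply, awayToChart_fromZero]
      · simp only [RingHom.comp_apply, Ideal.Quotient.lift_mk, chartToAwayAux, eval₂Hom_X',
          awayToChart_mk, toChartRing_mk, dehom_X_succAbove, RingHom.id_apply])
    (by
      refine RingHom.ext fun x => ?_
      obtain ⟨n, _, ⟨p, hp, rfl⟩, rfl⟩ := Away.mk_surjective _ (coord_mem f i) x
      rw [RingHom.comp_apply, RingHom.id_apply]
      refine (congrArg _ (awayToChart_mk f i n (Ideal.Quotient.mk _ p) _)).trans ?_
      exact chartToAwayAux_dehom f i (by simpa using (mem_homogeneousSubmodule _ _).mp hp) _)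

theorem chartEquiv_mk (n : ℕ) (a : CoordRing f) (ha : a ∈ coordGrading f (n • 1)) :
    chartEquiv f i (Away.mk _ (coord_mem f i) n a ha) = toChartRing f i a :=
  awayToChart_mk f i n a ha

theorem chartEquiv_fromZero (c : k) : chartEquiv f i (fromZeroRingHom (coordGrading f) _
    (algebraMap k (coordGrading f 0) c)) = algebraMap k _ c :=
  awayToChart_fromZero f i c

/-- The open immersion of the `i`-th chart, with the surface unfolded to `Proj`. -/
noncomputable def projChart : Spec (CommRingCat.of (ChartRing f i)) ⟶ Proj (coordGrading f) :=
  Spec.map (CommRingCat.ofHom (chartEquiv f i).toRingHom) ≫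
    Proj.awayι (coordGrading f) (coord f i) (coord_mem f i) one_pos

instance : IsIso (Spec.map (CommRingCat.ofHom (chartEquiv f i).toRingHom)) :=
  have : IsIso (CommRingCat.ofHom (chartEquiv f i).toRingHom) :=
    (chartEquiv f i).toCommRingCatIso.isIso_hom
  inferInstance

instance : IsOpenImmersion (projChart f i) :=
  inferInstanceAs (IsOpenImmersion (_ ≫ _))

theorem projChart_toSpecZero : projChart f i ≫ (Proj.toSpecZero (coordGrading f) ≫
    Spec.map (CommRingCat.ofHom (algebraMap k (coordGrading f 0)))) =
      Spec.map (CommRingCat.ofHom (algebraMap k (ChartRing f i))) := by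
  rw [projChart, Category.assoc, Proj.awayι_toSpecZero_assoc, ← Spec.map_comp, ← Spec.map_comp]
  congr 1
  ext c
  exact chartEquiv_fromZero f i c

theorem projChart_mem_basicOpen_iff (j : Fin 4) (y : PrimeSpectrum (ChartRing f i)) :
    projChart f i y ∈ Proj.basicOpen (coordGrading f) (coord f j) ↔
      Ideal.Quotient.mk _ (dehom i (X j)) ∉ y.asIdeal := by
  have h := Proj.awayι_preimage_basicOpen (coordGrading f) (coord_mem f i) one_pos
    (coord_mem f j) one_pos
  have h1 := SetLike.ext_iff.mp h
    (Spec.map (CommRingCat.ofHom (chartEquiv f i).toRingHom) y)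
  refine (Iff.trans ?_ h1).trans ?_
  · rfl
  · refine not_congr ?_
    change chartEquiv f i _ ∈ y.asIdeal ↔ _
    rw [chartEquiv_mk, pow_one, toChartRing_mk]

theorem range_projChart :
    Set.range (projChart f i) = Proj.basicOpen (coordGrading f) (coord f i) := by
  have h := Proj.opensRange_awayι (coordGrading f) (coord f i) (coord_mem f i) one_pos
  have h1 := Scheme.Hom.opensRange_comp_of_isIso
    (Spec.map (CommRingCat.ofHom (chartEquiv f i).toRingHom))
    (Proj.awayι (coordGrading f) (coord f i) (coord_mem f i) one_pos)
  exact congrArg (fun U : (Proj (coordGrading f)).Opens => (U : Set (Proj (coordGrading f))))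
    (h1.trans h)

theorem iSup_basicOpen_coord : ⨆ i, Proj.basicOpen (coordGrading f) (coord f i) = ⊤ := by
  refine Proj.iSup_basicOpen_eq_top' _ _ (fun i => ⟨1, coord_mem f i⟩) ?_
  refine Algebra.eq_top_iff.mpr fun x => ?_
  obtain ⟨p, rfl⟩ := Ideal.Quotient.mk_surjective x
  induction p using MvPolynomial.induction_on with
  | C c => exact Subalgebra.algebraMap_mem _ (algebraMap k (coordGrading f 0) c)
  | add p q hp hq => exact (map_add (Ideal.Quotient.mk (Ideal.span {f.1})) p q) ▸ add_mem hp hq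
  | mul_X p j hp =>
    rw [map_mul]
    exact mul_mem hp (Algebra.subset_adjoin ⟨j, rfl⟩)

/-- The open immersion of the `i`-th chart into the surface. -/
noncomputable def chart : Spec (CommRingCat.of (ChartRing f i)) ⟶ surface f := projChart f i

instance : IsOpenImmersion (chart f i) := inferInstanceAs (IsOpenImmersion (projChart f i))

theorem chart_surfaceToSpec :
    chart f i ≫ surfaceToSpec f = Spec.map (CommRingCat.ofHom (algebraMap k (ChartRing f i))) :=
  projChart_toSpecZero f i

theorem chart_mem_coordLocus_iff {s : Set (Fin 4)} (y : PrimeSpectrum (ChartRing f i)) :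
    chart f i y ∈ coordLocus f s ↔ ∀ j ∈ s, Ideal.Quotient.mk _ (dehom i (X j)) ∈ y.asIdeal := by
  have h : chart f i y ∈ coordLocus f s ↔
      ∀ j ∈ s, projChart f i y ∉ Proj.basicOpen (coordGrading f) (coord f j) := by
    refine Set.image_subset_iff.trans (forall₂_congr fun j _ => ?_)
    exact not_not.symm
  rw [h]
  exact forall₂_congr fun j _ => by rw [projChart_mem_basicOpen_iff, not_not]

theorem exists_chart_eq (x : surface f) :
    ∃ (i : Fin 4) (y : PrimeSpectrum (ChartRing f i)), chart f i y = x := by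
  have h : (x : Proj (coordGrading f)) ∈ ⨆ i, Proj.basicOpen (coordGrading f) (coord f i) := by
    rw [iSup_basicOpen_coord]; trivial
  obtain ⟨i, hi⟩ := TopologicalSpace.Opens.mem_iSup.mp h
  have h1 : x ∈ Set.range (projChart f i) := by
    rw [range_projChart]; exact hi
  exact ⟨i, h1⟩

theorem isIso_stalkMap {X Y : Scheme.{u}} (g : X ⟶ Y) [IsOpenImmersion g] (y : X) :
    IsIso (g.stalkMap y) := inferInstance

theorem nonempty_stalkEquiv_of_isOpenImmersion {R : CommRingCat.{u}} {X : Scheme.{u}}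
    (g : Spec R ⟶ X) [IsOpenImmersion g] (y : PrimeSpectrum R) :
    Nonempty (X.presheaf.stalk (g y) ≃+* Localization.AtPrime y.asIdeal) :=
  have := isIso_stalkMap g y
  ⟨((asIso (g.stalkMap y)).trans (Spec.stalkIso R y)).commRingCatIsoToRingEquiv⟩

theorem nonempty_stalkEquiv (y : PrimeSpectrum (ChartRing f i)) :
    Nonempty ((surface f).presheaf.stalk (chart f i y) ≃+* Localization.AtPrime y.asIdeal) :=
  nonempty_stalkEquiv_of_isOpenImmersion (chart f i) y

end Chart
/-! ### Smoothness -/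

section Smooth

variable {k : Type u} [Field k]

theorem smooth_surfaceToSpec_iff (f : CubicForm k) :
    Smooth (surfaceToSpec f) ↔ ∀ i, Algebra.FormallySmooth k (ChartRing f i) := by
  have h (i : Fin 4) : Smooth (chart f i ≫ surfaceToSpec f) ↔
      Algebra.FormallySmooth k (ChartRing f i) := by
    rw [chart_surfaceToSpec, HasRingHomProperty.Spec_iff (P := @Smooth), CommRingCat.hom_ofHom,
      RingHom.smooth_algebraMap]
    refine ⟨fun h => h.1, fun h => ⟨h, ?_⟩⟩
    exact Algebra.FinitePresentation.quotient
      (Submodule.fg_span_singleton _)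
  rw [← forall_congr' h]
  refine ⟨fun hf i => HasRingHomProperty.comp_of_isOpenImmersion @Smooth _ _ hf, fun hf => ?_⟩
  let 𝒰 : (surface f).OpenCover := Scheme.Cover.mkOfCovers (Fin 4)
    (fun i => Spec (CommRingCat.of (ChartRing f i))) (fun i => chart f i)
    (fun x => exists_chart_eq f x) (fun i => inferInstance)
  have (j : 𝒰.I₀) : IsAffine (𝒰.X j) := inferInstanceAs (IsAffine (Spec _))
  exact HasRingHomProperty.of_source_openCover (P := @Smooth) 𝒰
    fun j => HasRingHomProperty.appTop (P := @Smooth) _ (hf j)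

/-- A homogeneous polynomial is recovered from its dehomogenization by substituting
`x_j / x_i`. -/
theorem eq_zero_of_dehom_eq_zero {n : ℕ} {p : MvPolynomial (Fin 4) k} (hp : p.IsHomogeneous n)
    {i : Fin 4} (h : dehom i p = 0) : p = 0 := by
  let K := FractionRing (MvPolynomial (Fin 4) k)
  let x (j : Fin 4) : K := algebraMap (MvPolynomial (Fin 4) k) K (X j)
  let ψ : MvPolynomial (Fin 3) k →ₐ[k] K := aeval fun j => x (i.succAbove j) / x i
  have key := map_eq_map_mul_pow (φ := algebraMap (MvPolynomial (Fin 4) k) K)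
    (ψ := ψ.toRingHom.comp (dehom i).toRingHom) (u := x i) (fun c => ?_) (fun j => ?_) hp
  · refine IsFractionRing.injective (MvPolynomial (Fin 4) k) K ?_
    rw [key, map_zero]
    simp [h]
  · simp only [RingHom.comp_apply, AlgHom.toRingHom_eq_coe, RingHom.coe_coe, dehom_C,
      ψ, MvPolynomial.aeval_C]
    rfl
  · simp only [RingHom.comp_apply, AlgHom.toRingHom_eq_coe, RingHom.coe_coe]
    rcases Fin.eq_self_or_eq_succAbove i j with rfl | ⟨j, rfl⟩
    · simp [x]
    · simp only [ψ, x]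
      rw [dehom_X_succAbove, aeval_X, div_mul_cancel₀]
      exact (map_ne_zero_iff _ (IsFractionRing.injective _ _)).mpr (X_ne_zero _)

variable (k) in
theorem dehom_normalPoly_zero (i : Fin 4) :
    dehom i (normalPoly k 0) = 1 + X 0 ^ 3 + X 1 ^ 3 + X 2 ^ 3 := by
  have : normalPoly k 0 = ∑ j, X j ^ 3 := by simp [normalPoly, Fin.sum_univ_four]
  rw [this, Fin.sum_univ_succAbove _ i, Fin.sum_univ_three]
  simp only [map_add, map_pow, dehom_X_self, dehom_X_succAbove]
  ring

/-- A hypersurface `F = 0` is smooth if and only if its identity map lifts to the first order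
thickening `F ^ 2 = 0`, that is, some substitution `X j ↦ X j + F * G j` sends `F` to a multiple of
`F ^ 2`. -/
theorem formallySmooth_quotient_iff {σ : Type} (F : MvPolynomial σ k) :
    Algebra.FormallySmooth k (MvPolynomial σ k ⧸ Ideal.span {F}) ↔
      ∃ G : σ → MvPolynomial σ k, F ^ 2 ∣ aeval (fun j => X j + F * G j) F := by
  let π := Ideal.Quotient.mkₐ k (Ideal.span {F})
  have hker : RingHom.ker π.toRingHom ^ 2 = Ideal.span {F ^ 2} := by
    rw [← Ideal.span_singleton_pow]
    exact congrArg (· ^ 2) (Ideal.Quotient.mkₐ_ker k _)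
  rw [Algebra.FormallySmooth.iff_split_surjection π Ideal.Quotient.mk_surjective]
  constructor
  · rintro ⟨g, hg⟩
    have hex (j : σ) : ∃ q, g (π (X j)) = Ideal.Quotient.mk _ (X j + F * q) := by
      obtain ⟨q, hq⟩ := Ideal.Quotient.mk_surjective (g (π (X j)))
      have h1 : π q = π (X j) := by
        have := congr($hg (π (X j)))
        rw [AlgHom.comp_apply, ← hq] at this
        exact this
      obtain ⟨G, hG⟩ := Ideal.mem_span_singleton.mp (Ideal.Quotient.eq.mp h1)
      exact ⟨G, by rw [← hq, ← hG, add_sub_cancel]⟩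
    choose G hG using hex
    refine ⟨G, ?_⟩
    have h1 : g.comp π = (Ideal.Quotient.mkₐ k _).comp (aeval fun j => X j + F * G j) := by
      refine MvPolynomial.algHom_ext fun j => ?_
      rw [AlgHom.comp_apply, AlgHom.comp_apply, aeval_X]
      exact hG j
    have h2 := congr($h1 F)
    rw [AlgHom.comp_apply, AlgHom.comp_apply,
      show π F = 0 from Ideal.Quotient.eq_zero_iff_mem.mpr (Ideal.mem_span_singleton_self _),
      map_zero] at h2
    rw [← Ideal.mem_span_singleton, ← hker]
    exact Ideal.Quotient.eq_zero_iff_mem.mp h2.symm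
  · rintro ⟨G, hG⟩
    rw [← Ideal.mem_span_singleton, ← hker] at hG
    refine ⟨Ideal.Quotient.liftₐ _ ((Ideal.Quotient.mkₐ k _).comp
      (aeval fun j => X j + F * G j)) fun a ha => ?_, ?_⟩
    · obtain ⟨b, rfl⟩ := Ideal.mem_span_singleton.mp ha
      rw [map_mul]
      exact mul_eq_zero_of_left (Ideal.Quotient.eq_zero_iff_mem.mpr hG) _
    · refine Ideal.Quotient.algHom_ext _ (MvPolynomial.algHom_ext fun j => ?_)
      change π (aeval (fun j => X j + F * G j) (X j)) = π (X j)
      rw [aeval_X]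
      refine Ideal.Quotient.eq.mpr ?_
      rw [add_sub_cancel_left]
      exact Ideal.mem_span_singleton.mpr (Dvd.intro _ rfl)

theorem map_frobForm {R : Type*} [CommRing R] [Algebra k R] (θ : MvPolynomial (Fin 4) k →ₐ[k] R)
    (M : Matrix (Fin 4) (Fin 4) k) :
    θ (frobForm M) = ∑ a, ∑ b, algebraMap k R (M a b) * θ (X a) ^ 2 * θ (X b) := by
  simp only [frobForm, map_sum, map_mul, map_pow, ← MvPolynomial.algebraMap_eq, AlgHom.commutes]

/-- The expansion of a form modulo `F ^ 2`: in characteristic two, only the linear factor of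
`x a ^ 2 * x b` contributes to the first order. -/
theorem sum_mul_sq_mul_add {R : Type*} [CommRing R] (h2 : (2 : R) = 0) (m : Fin 4 → Fin 4 → R)
    (x g : Fin 4 → R) (F : R) :
    ∑ a, ∑ b, m a b * (x a + F * g a) ^ 2 * (x b + F * g b) =
      ∑ a, ∑ b, m a b * x a ^ 2 * x b + F * ∑ a, ∑ b, m a b * x a ^ 2 * g b +
        F ^ 2 * ∑ a, ∑ b, m a b * g a ^ 2 * (x b + F * g b) := by
  simp only [Finset.mul_sum, ← Finset.sum_add_distrib]
  refine Finset.sum_congr rfl fun a _ => Finset.sum_congr rfl fun b _ => ?_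
  linear_combination (m a b * x a * F * g a * (x b + F * g b)) * h2

variable [CharP k 2]

/-- The Fermat cubic surface is smooth: with `F = 1 + ∑ y_j ^ 3`, the substitution
`y_j ↦ y_j * (1 + F)` sends `F` to `F ^ 4`. -/
theorem smooth_fermat : Smooth (surfaceToSpec (normalForm k 0)) := by
  rw [smooth_surfaceToSpec_iff]
  intro i
  refine (formallySmooth_quotient_iff _).mpr ⟨X, ?_⟩
  change dehom i (normalPoly k 0) ^ 2 ∣ aeval _ (dehom i (normalPoly k 0))
  rw [dehom_normalPoly_zero]
  have h2 : (2 : MvPolynomial (Fin 3) k) = 0 := CharTwo.two_eq_zero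
  have hXF (F : MvPolynomial (Fin 3) k) (j : Fin 3) :
      (X j + F * X j) ^ 3 = X j ^ 3 * (1 + F) ^ 3 := by ring
  generalize hF : (1 + X 0 ^ 3 + X 1 ^ 3 + X 2 ^ 3 : MvPolynomial (Fin 3) k) = F
  have h3 : aeval (fun j => X j + F * X j) F = 1 + (X 0 + F * X 0) ^ 3 + (X 1 + F * X 1) ^ 3 +
      (X 2 + F * X 2) ^ 3 := by
    nth_rewrite 2 [← hF]
    simp only [map_add, map_one, map_pow, aeval_X]
  change F ^ 2 ∣ aeval (fun j => X j + dehom i (normalPoly k 0) * X j) F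
  rw [dehom_normalPoly_zero, hF, h3]
  refine ⟨F ^ 2, ?_⟩
  simp only [hXF]
  linear_combination (1 + F) ^ 3 * hF + (F ^ 3 - F) * h2

/-- A non-zero vector of the left kernel is a point of the surface at which all partial
derivatives vanish, so the first order term of any lift as in `formallySmooth_quotient_iff` is `F`
there, and cannot be cancelled. -/
theorem pairing_left_kernel_eq_zero_of_smooth {f : CubicForm k} {M : Matrix (Fin 4) (Fin 4) k}
    (hf : f.1 = frobForm M) (hf0 : f.1 ≠ 0) (hs : Smooth (surfaceToSpec f)) {l : Fin 4 → k}
    (hl : ∀ v, pairing M l v = 0) : l = 0 := by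
  by_contra hne
  obtain ⟨i, hi⟩ := Function.ne_iff.mp hne
  obtain ⟨G, hG⟩ := (formallySmooth_quotient_iff _).mp ((smooth_surfaceToSpec_iff f).mp hs i)
  set F := dehom i f.1 with hF
  have hF0 : F ≠ 0 := fun h =>
    hf0 (eq_zero_of_dehom_eq_zero ((mem_homogeneousSubmodule _ _).mp f.2) h)
  obtain ⟨g, hg⟩ : ∃ g : Fin 4 → MvPolynomial (Fin 3) k,
      ∀ a, aeval (fun j => X j + F * G j) (dehom i (X a : MvPolynomial (Fin 4) k)) =
        dehom i (X a) + F * g a := by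
    refine ⟨i.insertNth 0 G, fun a => ?_⟩
    rcases Fin.eq_self_or_eq_succAbove i a with rfl | ⟨a, rfl⟩
    · simp
    · simp
  have hFx := map_frobForm (dehom i) M
  rw [← hf, ← hF] at hFx
  have hFt := map_frobForm ((aeval fun j => X j + F * G j).comp (dehom i)) M
  simp only [AlgHom.comp_apply, hg] at hFt
  rw [← hf, ← hF, sum_mul_sq_mul_add CharTwo.two_eq_zero, ← hFx] at hFt
  obtain ⟨q, hq⟩ : F ∣ 1 + ∑ a, ∑ b, algebraMap k _ (M a b) * dehom i (X a) ^ 2 * g b := by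
    refine (mul_dvd_mul_iff_left hF0).mp ?_
    rw [← pow_two, mul_add, mul_one]
    refine (dvd_add_left (Dvd.intro _ rfl)).mp (hFt ▸ hG)
  -- The point `[l]` in the chart where the `i`-th coordinate is one.
  let p (a : Fin 4) : k := l a / l i
  let ev : MvPolynomial (Fin 3) k →ₐ[k] k := aeval fun j => p (i.succAbove j)
  have hev (a : Fin 4) : ev (dehom i (X a)) = p a := by
    rcases Fin.eq_self_or_eq_succAbove i a with rfl | ⟨a, rfl⟩
    · simp [p, div_self hi]
    · simp [ev]
  have hpair (v : Fin 4 → k) : pairing M p v = 0 := by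
    have : p = (l i)⁻¹ • l := by
      ext a
      simp [p, div_eq_inv_mul]
    rw [this, (isFrobeniusPairing_pairing M).smul_left, hl, mul_zero]
  have h1 := congrArg ev hq
  have h2 : ev F = 0 := by
    rw [hFx]
    simp only [map_sum, map_mul, map_pow, hev, AlgHom.commutes]
    exact hpair p
  rw [map_mul, h2, zero_mul] at h1
  simp only [map_add, map_one, map_sum, map_mul, map_pow, hev, AlgHom.commutes] at h1
  have h3 := hpair fun b => ev (g b)
  simp only [pairing] at h3
  simp only [Algebra.algebraMap_self, RingHom.id_apply] at h1
  rw [h3, add_zero] at h1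
  exact one_ne_zero h1

end Smooth
/-! ### Regularity of hypersurfaces -/

section RegularQuotient

open IsLocalRing

variable {R : Type*} [CommRing R]

theorem exists_ringKrullDim_eq_natCast [IsLocalRing R] [IsNoetherianRing R] :
    ∃ n : ℕ, ringKrullDim R = n := by
  have h0 : 0 ≤ ringKrullDim R := ringKrullDim_nonneg_of_nontrivial
  have h1 := ringKrullDim_le_spanFinrank_maximalIdeal R
  obtain ⟨a, ha⟩ := WithBot.ne_bot_iff_exists.mp (ne_bot_of_le_ne_bot WithBot.zero_ne_bot h0)
  rw [← ha] at h1 ⊢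
  obtain ⟨n, hn⟩ := ENat.ne_top_iff_exists.mp
    (ne_top_of_le_ne_top (ENat.natCast_ne_top _) (WithBot.coe_le_coe.mp h1))
  exact ⟨n, by rw [← hn]; rfl⟩

/-- A hypersurface in the spectrum of a regular local ring is regular if and only if its equation is
not in the square of the maximal ideal. -/
theorem isRegularLocalRing_quotient_iff [IsRegularLocalRing R] [IsDomain R] {f : R}
    (hf : f ∈ maximalIdeal R) (hf0 : f ≠ 0) :
    IsRegularLocalRing (R ⧸ Ideal.span {f}) ↔ f ∉ maximalIdeal R ^ 2 := by
  classical
  have hle : Ideal.span {f} ≤ maximalIdeal R := (Ideal.span_singleton_le_iff_mem _).mpr hf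
  have : Nontrivial (R ⧸ Ideal.span {f}) :=
    Ideal.Quotient.nontrivial_iff.mpr fun h => Ideal.IsPrime.ne_top' (top_le_iff.mp (h ▸ hle))
  have : IsLocalRing (R ⧸ Ideal.span {f}) :=
    IsLocalRing.of_surjective' (Ideal.Quotient.mk _) Ideal.Quotient.mk_surjective
  obtain ⟨n, hn⟩ := exists_ringKrullDim_eq_natCast (R := R ⧸ Ideal.span {f})
  have hdim := ringKrullDim_quotient_span_singleton_succ_eq_ringKrullDim_of_mem_nonZeroDivisors
    (mem_nonZeroDivisors_of_ne_zero hf0) hf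
  have hrank : (maximalIdeal R).spanFinrank = n + 1 := by
    have := IsRegularLocalRing.spanFinrank_maximalIdeal (R := R)
    rw [← hdim, hn] at this
    exact_mod_cast this
  have hcomap : (maximalIdeal (R ⧸ Ideal.span {f})).comap (Ideal.Quotient.mk (Ideal.span {f})) =
      maximalIdeal R :=
    eq_maximalIdeal (Ideal.comap_isMaximal_of_surjective _ Ideal.Quotient.mk_surjective)
  have hmap : (maximalIdeal R).map (Ideal.Quotient.mk (Ideal.span {f})) =
      maximalIdeal (R ⧸ Ideal.span {f}) := by
    rw [← hcomap, Ideal.map_comap_of_surjective _ Ideal.Quotient.mk_surjective]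
  constructor
  · -- Lifted generators of the maximal ideal of the quotient generate it modulo its square, hence
    -- generate it, by Nakayama's lemma; they are too few.
    intro hreg hf2
    have hrank' : (maximalIdeal (R ⧸ Ideal.span {f})).spanFinrank = n := by
      have := IsRegularLocalRing.spanFinrank_maximalIdeal (R := R ⧸ Ideal.span {f})
      rw [hn] at this
      exact_mod_cast this
    obtain ⟨s, hs, hspan⟩ := Submodule.FG.exists_span_finset_card_eq_spanFinrank
      (maximalIdeal (R ⧸ Ideal.span {f})).fg_of_isNoetherianRing
    choose g hg using Ideal.Quotient.mk_surjective (I := Ideal.span {f})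
    have hle' : maximalIdeal R ≤ Ideal.span (s.image g) := by
      refine Submodule.le_of_le_smul_of_le_jacobson_bot (I := maximalIdeal R)
        (maximalIdeal R).fg_of_isNoetherianRing (maximalIdeal_le_jacobson _) fun x hx => ?_
      have h1 : Ideal.Quotient.mk (Ideal.span {f}) x ∈
          (Ideal.span (s.image g : Set R)).map (Ideal.Quotient.mk (Ideal.span {f})) := by
        rw [Ideal.map_span, Finset.coe_image, ← Set.image_comp]
        have : (Ideal.Quotient.mk (Ideal.span {f}) ∘ g) = id := funext hg
        rw [this, Set.image_id]
        exact hspan.ge (hmap.le (Ideal.mem_map_of_mem _ hx))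
      obtain ⟨y, hy, hxy⟩ := (Ideal.mem_map_iff_of_surjective _ Ideal.Quotient.mk_surjective).mp h1
      obtain ⟨z, hz⟩ := Ideal.mem_span_singleton.mp (Ideal.Quotient.eq.mp hxy.symm)
      have hx' : x = y + f * z := by rw [← hz]; ring
      rw [hx']
      refine add_mem (Ideal.mem_sup_left hy) (Ideal.mem_sup_right (Ideal.mul_mem_right _ _ ?_))
      rwa [smul_eq_mul, ← pow_two]
    have hle2 : Ideal.span (s.image g) ≤ maximalIdeal R := by
      rw [Ideal.span_le]
      intro x hx
      obtain ⟨y, hy, rfl⟩ := Finset.mem_image.mp hx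
      have : y ∈ maximalIdeal (R ⧸ Ideal.span {f}) := hspan.le (Submodule.subset_span hy)
      rw [← hcomap]
      exact Ideal.mem_comap.mpr ((hg y).symm ▸ this)
    have h1 := Submodule.spanFinrank_span_le_ncard_of_finite (R := R) (s.image g).finite_toSet
    have h2 : Submodule.span R (s.image g : Set R) = maximalIdeal R := le_antisymm hle2 hle'
    rw [h2, hrank, Set.ncard_coe_finset] at h1
    have := Finset.card_image_le (s := s) (f := g)
    omega
  · -- In an expression of `f` by minimal generators some coefficient is a unit, so that one
    -- generator is superfluous in the quotient.
    intro hf2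
    obtain ⟨s, hs, hspan⟩ := Submodule.FG.exists_span_finset_card_eq_spanFinrank
      (maximalIdeal R).fg_of_isNoetherianRing
    obtain ⟨a, ha⟩ := Submodule.mem_span_finset'.mp (hspan.ge hf)
    obtain ⟨g, hg⟩ : ∃ g : s, IsUnit (a g) := by
      by_contra! hnot
      refine hf2 (ha ▸ sum_mem fun g _ => ?_)
      rw [pow_two, smul_eq_mul]
      exact Ideal.mul_mem_mul ((mem_maximalIdeal _).mpr (hnot g))
        (hspan.le (Submodule.subset_span g.2))
    let t : Finset (R ⧸ Ideal.span {f}) := (s.erase g).image (Ideal.Quotient.mk _)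
    have hmem (x : R) (hx : x ∈ s.erase g) :
        Ideal.Quotient.mk (Ideal.span {f}) x ∈ Ideal.span (t : Set (R ⧸ Ideal.span {f})) :=
      Ideal.subset_span (Finset.mem_coe.mpr (Finset.mem_image_of_mem _ hx))
    have hg' : Ideal.Quotient.mk (Ideal.span {f}) g ∈
        Ideal.span (t : Set (R ⧸ Ideal.span {f})) := by
      have h0 : ∑ x : s, Ideal.Quotient.mk (Ideal.span {f}) (a x) *
          Ideal.Quotient.mk (Ideal.span {f}) x = 0 := by
        simp only [← map_mul, ← map_sum]
        refine Ideal.Quotient.eq_zero_iff_mem.mpr ?_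
        simp only [smul_eq_mul] at ha
        rw [ha]
        exact Ideal.mem_span_singleton_self f
      rw [← Finset.add_sum_erase _ _ (Finset.mem_univ g), add_eq_zero_iff_eq_neg] at h0
      rw [← Ideal.unit_mul_mem_iff_mem _ (hg.map (Ideal.Quotient.mk (Ideal.span {f}))), h0]
      refine neg_mem (sum_mem fun x hx => Ideal.mul_mem_left _ _ (hmem _ ?_))
      exact Finset.mem_erase.mpr ⟨fun h => Finset.ne_of_mem_erase hx (Subtype.ext h), x.2⟩
    have hspan' : maximalIdeal (R ⧸ Ideal.span {f}) ≤
        Ideal.span (t : Set (R ⧸ Ideal.span {f})) := by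
      rw [← hmap, ← hspan]
      change Ideal.map _ (Ideal.span (s : Set R)) ≤ _
      rw [Ideal.map_span, Ideal.span_le]
      rintro _ ⟨x, hx, rfl⟩
      by_cases hxg : x = g
      · exact hxg ▸ hg'
      · exact hmem x (Finset.mem_erase.mpr ⟨hxg, hx⟩)
    have hle2 : Ideal.span (t : Set (R ⧸ Ideal.span {f})) ≤ maximalIdeal (R ⧸ Ideal.span {f}) := by
      rw [Ideal.span_le]
      intro y hy
      obtain ⟨x, hx, rfl⟩ := Finset.mem_image.mp hy
      exact hmap.le (Ideal.mem_map_of_mem _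
        (hspan.le (Submodule.subset_span (Finset.mem_of_mem_erase hx))))
    have h1 := Submodule.spanFinrank_span_le_ncard_of_finite (R := R ⧸ Ideal.span {f})
      t.finite_toSet
    have h2 : Submodule.span (R ⧸ Ideal.span {f}) (t : Set (R ⧸ Ideal.span {f})) =
      maximalIdeal (R ⧸ Ideal.span {f}) := le_antisymm hle2 hspan'
    have h3 : t.card ≤ n := Finset.card_image_le.trans (by
      rw [Finset.card_erase_of_mem g.2]; omega)
    refine IsRegularLocalRing.of_spanFinrank_maximalIdeal_le _ ?_
    rw [h2, Set.ncard_coe_finset] at h1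
    rw [hn]
    exact_mod_cast h1.trans h3

/-- The localization of a quotient is the quotient of the localization. -/
theorem nonempty_localization_quotient_equiv {f : R} (y : PrimeSpectrum (R ⧸ Ideal.span {f})) :
    Nonempty (Localization.AtPrime (y.asIdeal.comap (Ideal.Quotient.mk (Ideal.span {f}))) ⧸
        Ideal.span {algebraMap R
          (Localization.AtPrime (y.asIdeal.comap (Ideal.Quotient.mk (Ideal.span {f})))) f} ≃+*
      Localization.AtPrime y.asIdeal) := by
  set P := y.asIdeal.comap (Ideal.Quotient.mk (Ideal.span {f})) with hP
  have hmap : P.primeCompl.map (Ideal.Quotient.mk (Ideal.span {f})) = y.asIdeal.primeCompl := by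
    ext z
    constructor
    · rintro ⟨x, hx, rfl⟩
      exact hx
    · intro hz
      obtain ⟨x, rfl⟩ := Ideal.Quotient.mk_surjective z
      exact ⟨x, hz, rfl⟩
  let g : Localization.AtPrime P →+* Localization.AtPrime y.asIdeal :=
    IsLocalization.map (M := P.primeCompl) (T := y.asIdeal.primeCompl) _
      (Ideal.Quotient.mk (Ideal.span {f})) (hmap ▸ Submonoid.le_comap_map _)
  have hker : RingHom.ker g = Ideal.span {algebraMap R _ f} := by
    have := IsLocalization.ker_map (S := Localization.AtPrime P) (Localization.AtPrime y.asIdeal)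
      (Ideal.Quotient.mk (Ideal.span {f})) hmap
    rw [Ideal.mk_ker, Ideal.map_span, Set.image_singleton] at this
    exact this
  have hsurj : Function.Surjective g := by
    have : IsLocalization (P.primeCompl.map (Ideal.Quotient.mk (Ideal.span {f})))
      (Localization.AtPrime y.asIdeal) := by
      rw [hmap]
      infer_instance
    exact IsLocalization.map_surjective_of_surjective P.primeCompl (Localization.AtPrime P)
      (Localization.AtPrime y.asIdeal) Ideal.Quotient.mk_surjective
  rw [← hker]
  exact ⟨RingHom.quotientKerEquivOfSurjective hsurj⟩

theorem isRegularLocalRing_iff_of_ringEquiv {R S : Type*} [CommRing R] [CommRing S] (e : R ≃+* S) :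
    IsRegularLocalRing R ↔ IsRegularLocalRing S :=
  ⟨fun _ => .of_ringEquiv e, fun _ => .of_ringEquiv e.symm⟩

/-- A hypersurface in a regular scheme is regular at a point if and only if its equation is not in
the square of the maximal ideal there. -/
theorem isRegularLocalRing_localization_quotient_iff [IsRegularRing R] [IsDomain R] {f : R}
    (hf0 : f ≠ 0) (y : PrimeSpectrum (R ⧸ Ideal.span {f})) :
    IsRegularLocalRing (Localization.AtPrime y.asIdeal) ↔
      ∀ s, Ideal.Quotient.mk _ s ∉ y.asIdeal →
        s * f ∉ (y.asIdeal.comap (Ideal.Quotient.mk (Ideal.span {f}))) ^ 2 := by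
  obtain ⟨e⟩ := nonempty_localization_quotient_equiv y
  rw [← isRegularLocalRing_iff_of_ringEquiv e]
  set P := y.asIdeal.comap (Ideal.Quotient.mk (Ideal.span {f})) with hP
  have hfP : f ∈ P := by
    rw [hP, Ideal.mem_comap, Ideal.Quotient.eq_zero_iff_mem.mpr (Ideal.mem_span_singleton_self f)]
    exact zero_mem _
  have := IsRegularRing.isRegularLocalRing_localization P
  have : IsDomain (Localization.AtPrime P) :=
    IsLocalization.isDomain_localization (Ideal.primeCompl_le_nonZeroDivisors P)
  rw [isRegularLocalRing_quotient_iff]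
  · rw [← Localization.AtPrime.map_eq_maximalIdeal, ← Ideal.map_pow,
      IsLocalization.algebraMap_mem_map_algebraMap_iff P.primeCompl]
    push Not
    rfl
  · rw [← Localization.AtPrime.map_eq_maximalIdeal]
    exact Ideal.mem_map_of_mem _ hfP
  · exact (map_ne_zero_iff _ (IsLocalization.injective _
      (Ideal.primeCompl_le_nonZeroDivisors P))).mpr hf0

end RegularQuotient

/-! ### Singular loci -/

section SingularLocus

variable {k : Type u} [Field k]

theorem pderiv_dehom (i : Fin 4) (j : Fin 3) (p : MvPolynomial (Fin 4) k) :
    pderiv j (dehom i p) = dehom i (pderiv (i.succAbove j) p) := by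
  induction p using MvPolynomial.induction_on with
  | C c => simp
  | add p q hp hq => simp only [map_add, hp, hq]
  | mul_X p l hp =>
    simp only [map_mul, Derivation.leibniz, hp, map_add, smul_eq_mul, pderiv_X]
    rcases Fin.eq_self_or_eq_succAbove i l with rfl | ⟨l, rfl⟩
    · simp
    · by_cases h : l = j
      · subst h; simp
      · have h' : i.succAbove l ≠ i.succAbove j := fun h' => h (Fin.succAbove_right_injective h')
        simp [h, h', pderiv_X]

theorem derivation_mem_of_mem_sq {R : Type*} [CommRing R] [Algebra k R] (D : Derivation k R R)
    {P : Ideal R} {x : R} (hx : x ∈ P ^ 2) : D x ∈ P := by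
  rw [pow_two] at hx
  induction hx using Submodule.mul_induction_on' with
  | mem_mul_mem a ha b hb =>
    rw [D.leibniz]
    exact add_mem (P.mul_mem_right _ ha) (P.mul_mem_right _ hb)
  | add a _ b _ ha hb =>
    rw [map_add]
    exact add_mem ha hb

theorem chart_mem_singularLocus_iff {f : CubicForm k} (hf0 : f.1 ≠ 0) (i : Fin 4)
    (y : PrimeSpectrum (ChartRing f i)) :
    chart f i y ∈ singularLocus (surface f) ↔ ∃ s, Ideal.Quotient.mk _ s ∉ y.asIdeal ∧
      s * dehom i f.1 ∈ (y.asIdeal.comap (Ideal.Quotient.mk (Ideal.span {dehom i f.1}))) ^ 2 := by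
  obtain ⟨e⟩ := nonempty_stalkEquiv f i y
  change ¬ IsRegularLocalRing _ ↔ _
  rw [isRegularLocalRing_iff_of_ringEquiv (S := Localization.AtPrime y.asIdeal) e,
    isRegularLocalRing_localization_quotient_iff]
  · push Not
    rfl
  · exact fun h => hf0 (eq_zero_of_dehom_eq_zero ((mem_homogeneousSubmodule _ _).mp f.2) h)

/-- At a singular point all partial derivatives of the form vanish. The one with respect to the
coordinate that is one on the chart is obtained from the others by Euler's relation. -/
theorem dehom_pderiv_mem_of_mem_singularLocus [CharP k 2] {f : CubicForm k}
    {M : Matrix (Fin 4) (Fin 4) k} (hf : f.1 = frobForm M) (hf0 : f.1 ≠ 0) (i : Fin 4)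
    (y : PrimeSpectrum (ChartRing f i)) (hy : chart f i y ∈ singularLocus (surface f)) (l : Fin 4) :
    Ideal.Quotient.mk _ (dehom i (pderiv l f.1)) ∈ y.asIdeal := by
  obtain ⟨s, hs, hsf⟩ := (chart_mem_singularLocus_iff hf0 i y).mp hy
  have hzero : Ideal.Quotient.mk (Ideal.span {dehom i f.1}) (dehom i f.1) = 0 :=
    Ideal.Quotient.eq_zero_iff_mem.mpr (Ideal.mem_span_singleton_self _)
  have hj (j : Fin 3) : Ideal.Quotient.mk (Ideal.span {dehom i f.1})
      (dehom i (pderiv (i.succAbove j) f.1)) ∈ y.asIdeal := by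
    have h := derivation_mem_of_mem_sq (pderiv j) hsf
    rw [Derivation.leibniz, Ideal.mem_comap, map_add, smul_eq_mul, smul_eq_mul, map_mul, map_mul,
      hzero, zero_mul, add_zero, pderiv_dehom] at h
    exact (y.2.mem_or_mem h).resolve_left hs
  rcases Fin.eq_self_or_eq_succAbove i l with rfl | ⟨j, rfl⟩
  · have heuler : ∑ j, X j * pderiv j f.1 = f.1 := by
      rw [hf]
      simp only [pderiv_frobForm, Finset.mul_sum]
      rw [Finset.sum_comm, frobForm]
      exact Finset.sum_congr rfl fun a _ => Finset.sum_congr rfl fun b _ => by ring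
    have h := congrArg (fun p => Ideal.Quotient.mk (Ideal.span {dehom l f.1}) (dehom l p)) heuler
    simp only [hzero] at h
    rw [Fin.sum_univ_succAbove _ l] at h
    simp only [map_add, map_mul, map_sum, dehom_X_self, one_mul] at h
    rw [add_eq_zero_iff_eq_neg] at h
    rw [h]
    exact neg_mem (sum_mem fun j _ => Ideal.mul_mem_left _ _ (hj j))
  · exact hj j

/-- A surface is singular where its equation vanishes to second order. -/
theorem mem_singularLocus_of_mem_coordLocus {f : CubicForm k} (hf0 : f.1 ≠ 0) {s : Set (Fin 4)}
    (hf : f.1 ∈ (Ideal.span (X '' s)) ^ 2) {x : surface f} (hx : x ∈ coordLocus f s) :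
    x ∈ singularLocus (surface f) := by
  obtain ⟨i, y, rfl⟩ := exists_chart_eq f x
  rw [chart_mem_coordLocus_iff] at hx
  refine (chart_mem_singularLocus_iff hf0 i y).mpr ⟨1, ?_, ?_⟩
  · rw [map_one]
    exact fun h => y.2.ne_top ((Ideal.eq_top_iff_one _).mpr h)
  · rw [one_mul]
    have h := Ideal.mem_map_of_mem (dehom i).toRingHom hf
    rw [Ideal.map_pow] at h
    refine Ideal.pow_right_mono ?_ 2 h
    rw [Ideal.map_span, Ideal.span_le]
    rintro _ ⟨_, ⟨j, hj, rfl⟩, rfl⟩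
    exact hx j hj

/-- If the squares of the coordinates `x_j`, `j ∈ s`, are partial derivatives of the form and the
form vanishes to second order along their common zeros, then these are the singular points. -/
theorem singularLocus_eq_coordLocus [CharP k 2] {f : CubicForm k} {M : Matrix (Fin 4) (Fin 4) k}
    (hf : f.1 = frobForm M) (hf0 : f.1 ≠ 0) {s : Set (Fin 4)}
    (hf2 : f.1 ∈ (Ideal.span (X '' s)) ^ 2)
    (hs : ∀ j ∈ s, ∃ l, pderiv l f.1 = X j ^ 2) : singularLocus (surface f) = coordLocus f s := by
  refine Set.Subset.antisymm (fun x hx => ?_)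
    fun x hx => mem_singularLocus_of_mem_coordLocus hf0 hf2 hx
  obtain ⟨i, y, rfl⟩ := exists_chart_eq f x
  rw [chart_mem_coordLocus_iff]
  intro j hj
  obtain ⟨l, hl⟩ := hs j hj
  have h := dehom_pderiv_mem_of_mem_singularLocus hf hf0 i y hx l
  rw [hl, map_pow, map_pow] at h
  exact y.2.mem_of_pow_mem _ h

/-- The point `[0 : 0 : 0 : 1]` of a surface that contains it. -/
theorem exists_coordLocus_eq_singleton {f : CubicForm k}
    (hf : f.1 ∈ Ideal.span (X '' ({0, 1, 2} : Set (Fin 4)))) :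
    ∃ P : surface f, coordLocus f {0, 1, 2} = {P} := by
  have h0 : constantCoeff (dehom 3 f.1) = 0 := by
    have h : Ideal.span (X '' ({0, 1, 2} : Set (Fin 4))) ≤
        RingHom.ker ((constantCoeff (R := k)).comp (dehom 3).toRingHom) := by
      rw [Ideal.span_le]
      rintro _ ⟨j, hj, rfl⟩
      have hj3 : j ≠ 3 := by rintro rfl; simp at hj
      obtain ⟨l, rfl⟩ := Fin.exists_succAbove_eq hj3
      change constantCoeff (dehom 3 (X (Fin.succAbove 3 l))) = 0
      rw [dehom_X_succAbove, constantCoeff_X]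
    exact h hf
  let ev : ChartRing f 3 →+* k := Ideal.Quotient.lift _ constantCoeff fun a ha => by
    obtain ⟨b, rfl⟩ := Ideal.mem_span_singleton.mp ha
    rw [map_mul, h0, zero_mul]
  have hev (p : MvPolynomial (Fin 3) k) : ev (Ideal.Quotient.mk _ p) = constantCoeff p := rfl
  let y₀ : PrimeSpectrum (ChartRing f 3) := ⟨RingHom.ker ev, RingHom.ker_isPrime ev⟩
  refine ⟨chart f 3 y₀, Set.Subset.antisymm (fun x hx => ?_) (Set.singleton_subset_iff.mpr ?_)⟩
  · obtain ⟨i, y, rfl⟩ := exists_chart_eq f x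
    rw [chart_mem_coordLocus_iff] at hx
    obtain rfl : i = 3 := by
      by_contra hi
      have hi' : i ∈ ({0, 1, 2} : Set (Fin 4)) := by
        have h4 : ∀ i : Fin 4, i ≠ 3 → i ∈ ({0, 1, 2} : Set (Fin 4)) := by decide
        exact h4 i hi
      have := hx i hi'
      rw [dehom_X_self, map_one] at this
      exact y.2.ne_top ((Ideal.eq_top_iff_one _).mpr this)
    have hX (j : Fin 3) : Ideal.Quotient.mk _ (X j) ∈ y.asIdeal := by
      rw [← dehom_X_succAbove 3 j]
      have h4 : ∀ j : Fin 3, Fin.succAbove 3 j ∈ ({0, 1, 2} : Set (Fin 4)) := by decide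
      exact hx _ (h4 j)
    have hsub (p : MvPolynomial (Fin 3) k) :
        Ideal.Quotient.mk _ (p - C (constantCoeff p)) ∈ y.asIdeal := by
      induction p using MvPolynomial.induction_on with
      | C c => simp
      | add p q hp hq =>
        have : p + q - C (constantCoeff (p + q)) =
          (p - C (constantCoeff p)) + (q - C (constantCoeff q)) := by
          rw [map_add, map_add]; ring
        rw [this, map_add]
        exact add_mem hp hq
      | mul_X p j hp =>
        rw [map_mul constantCoeff, constantCoeff_X, mul_zero, map_zero, sub_zero, map_mul]
        exact Ideal.mul_mem_left _ _ (hX j)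
    have hy : y = y₀ := by
      refine PrimeSpectrum.ext (Ideal.ext fun z => ?_)
      obtain ⟨p, rfl⟩ := Ideal.Quotient.mk_surjective z
      change _ ↔ constantCoeff p = 0
      have h1 := hsub p
      rw [map_sub] at h1
      rw [← sub_add_cancel (Ideal.Quotient.mk _ p) (Ideal.Quotient.mk _ (C (constantCoeff p))),
        Ideal.add_mem_iff_right _ h1]
      refine ⟨fun h => ?_, fun h => by rw [h, map_zero, map_zero]; exact zero_mem _⟩
      by_contra hne
      exact y.2.ne_top (Ideal.eq_top_of_isUnit_mem _ h
        (((isUnit_iff_ne_zero.mpr hne).map C).map (Ideal.Quotient.mk _)))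
    rw [hy]
    rfl
  · rw [chart_mem_coordLocus_iff]
    intro j hj
    have hj3 : j ≠ 3 := by rintro rfl; simp at hj
    obtain ⟨l, rfl⟩ := Fin.exists_succAbove_eq hj3
    rw [dehom_X_succAbove]
    exact constantCoeff_X k l

end SingularLocus
/-! ### Integrally closed domains -/

section IntegrallyClosed

variable {B : Type*} [CommRing B]

/-- If `c * x` lies in `B` and `x` is integral over `B`, then `c` divides a power of `c * x`. -/
theorem exists_dvd_pow_of_isIntegral [IsDomain B] {K : Type*} [Field K] [Algebra B K]
    [IsFractionRing B K] {c w : B} {x : K} (hx : IsIntegral B x)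
    (hw : algebraMap B K w = algebraMap B K c * x) : ∃ n, c ∣ w ^ n := by
  obtain ⟨p, hp, hpx⟩ := hx
  have h0 := Polynomial.scaleRoots_aeval_eq_zero (r := c) (show Polynomial.aeval x p = 0 from hpx)
  rw [← hw, Polynomial.aeval_algebraMap_apply,
    map_eq_zero_iff _ (IsFractionRing.injective B K), Polynomial.aeval_def,
    Polynomial.eval₂_eq_sum_range, Polynomial.natDegree_scaleRoots, Finset.sum_range_succ,
    Polynomial.coeff_scaleRoots_natDegree, hp.leadingCoeff] at h0
  refine ⟨p.natDegree, ?_⟩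
  have h1 : c ∣ ∑ i ∈ Finset.range p.natDegree,
      algebraMap B B ((p.scaleRoots c).coeff i) * w ^ i := by
    refine Finset.dvd_sum fun i hi => Dvd.dvd.mul_right ?_ _
    rw [Polynomial.coeff_scaleRoots]
    refine Dvd.dvd.mul_left (dvd_pow_self c ?_) _
    have := Finset.mem_range.mp hi
    omega
  rw [map_one, one_mul] at h0
  exact (dvd_add_right h1).mp (h0 ▸ dvd_zero c)

/-- A domain is integrally closed if its localization away from a radical element `c` is: if `x` is
integral and `c * x` lies in the domain, then `c` divides a power of `c * x`, hence `c * x` itself,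
and an induction removes all powers of `c` from the denominator of an integral fraction. -/
theorem isIntegrallyClosed_of_away [IsDomain B] {c : B} (hc : c ≠ 0) (hrad : IsRadical c)
    (C : Type*) [CommRing C] [Algebra B C] [IsLocalization.Away c C] [IsIntegrallyClosed C] :
    IsIntegrallyClosed B := by
  let K := FractionRing B
  have hM : Submonoid.powers c ≤ nonZeroDivisors B := powers_le_nonZeroDivisors_of_noZeroDivisors hc
  let g : C →+* K := IsLocalization.map _ (T := nonZeroDivisors B) (RingHom.id B) hM
  let := g.toAlgebra
  have : IsScalarTower B C K := IsScalarTower.of_algebraMap_eq fun b =>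
    (IsLocalization.map_eq (Q := K) (T := nonZeroDivisors B) (g := RingHom.id B) hM b).symm
  have := IsFractionRing.isFractionRing_of_isDomain_of_isLocalization (Submonoid.powers c) C K
  have key (n : ℕ) : ∀ (x : K) (a : B), IsIntegral B x →
      algebraMap B K a = algebraMap B K c ^ n * x → ∃ b, algebraMap B K b = x := by
    induction n with
    | zero => exact fun x a _ h => ⟨a, by rw [h, pow_zero, one_mul]⟩
    | succ n ih =>
      intro x a hx h
      obtain ⟨w, hw⟩ := ih (algebraMap B K c * x) a (isIntegral_algebraMap.mul hx)
        (by rw [h]; ring)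
      obtain ⟨m, hm⟩ := exists_dvd_pow_of_isIntegral hx hw
      obtain ⟨b, rfl⟩ := hrad m w hm
      refine ⟨b, mul_left_cancel₀ ?_ ((map_mul _ _ _).symm.trans hw)⟩
      exact (map_ne_zero_iff _ (IsFractionRing.injective B K)).mpr hc
  refine (isIntegrallyClosed_iff K).mpr fun {x} hx => ?_
  obtain ⟨y, hy⟩ := (isIntegrallyClosed_iff K).mp ‹IsIntegrallyClosed C› (hx.tower_top (A := C))
  obtain ⟨⟨a, ⟨_, n, rfl⟩⟩, ha⟩ := IsLocalization.surj (Submonoid.powers c) y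
  refine key n x a hx ?_
  have := congrArg (algebraMap C K) ha
  rw [map_mul, hy, ← IsScalarTower.algebraMap_apply, ← IsScalarTower.algebraMap_apply] at this
  rw [← this, map_pow, mul_comm]

theorem isDomain_and_isIntegrallyClosed_of_equiv {R S : Type*} [CommRing R] [CommRing S]
    (e : R ≃+* S) [IsDomain S] [IsIntegrallyClosed S] : IsDomain R ∧ IsIntegrallyClosed R :=
  have := e.toMulEquiv.isDomain S
  ⟨this, .of_equiv e.symm⟩

end IntegrallyClosed

/-! ### Normality of charts -/

section ChartNormal

open HomogeneousLocalization

variable {k : Type u} [Field k] (f : CubicForm k)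

theorem coord_ne_zero (i : Fin 4) : coord f i ≠ 0 := by
  intro h
  obtain ⟨q, hq⟩ := Ideal.mem_span_singleton.mp (Ideal.Quotient.eq_zero_iff_mem.mp h)
  have hX : (X i : MvPolynomial (Fin 4) k) ≠ 0 := X_ne_zero i
  have hf0 : f.1 ≠ 0 := fun h0 => hX (by rw [hq, h0, zero_mul])
  have hq0 : q ≠ 0 := fun h0 => hX (by rw [hq, h0, mul_zero])
  have h1 := congrArg totalDegree hq
  rw [totalDegree_X, totalDegree_mul_of_isDomain hf0 hq0,
    ((mem_homogeneousSubmodule _ _).mp f.2).totalDegree hf0] at h1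
  omega

variable [IsDomain (CoordRing f)]

theorem isDomain_away {g : CoordRing f} (hg : g ≠ 0) : IsDomain (Away (coordGrading f) g) := by
  have : IsDomain (Localization.Away g) := IsLocalization.isDomain_localization
    (powers_le_nonZeroDivisors_of_noZeroDivisors hg)
  exact (val_injective (𝒜 := coordGrading f) (Submonoid.powers g)).isDomain
    (algebraMap (Away (coordGrading f) g) (Localization.Away g))

/-- The fraction `x_j / x_i` is not zero. -/
theorem isLocalizationElem_coord_ne_zero (i j : Fin 4) :
    Away.isLocalizationElem (coord_mem f i) (coord_mem f j) ≠ 0 := by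
  intro h
  have h1 := congrArg HomogeneousLocalization.val h
  rw [Away.val_mk, val_zero, Localization.mk_eq_mk'_apply, IsLocalization.mk'_eq_zero_iff] at h1
  obtain ⟨⟨_, n, rfl⟩, h1⟩ := h1
  rw [pow_one] at h1
  exact mul_ne_zero (pow_ne_zero n (coord_ne_zero f i)) (coord_ne_zero f j) h1

theorem isDomain_chartRing (i : Fin 4) : IsDomain (ChartRing f i) :=
  have := isDomain_away f (coord_ne_zero f i)
  (chartEquiv f i).symm.toMulEquiv.isDomain (Away (coordGrading f) (coord f i))

/-- Normality passes from a chart to a second one if the equation of the complement of the first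
is radical on the second. -/
theorem isIntegrallyClosed_chartRing {i j : Fin 4} (h : IsIntegrallyClosed (ChartRing f i))
    (hrad : IsRadical (Ideal.Quotient.mk _ (dehom j (X i)) : ChartRing f j)) :
    IsIntegrallyClosed (ChartRing f j) := by
  have := isDomain_away f (coord_ne_zero f i)
  have := isDomain_away f (coord_ne_zero f j)
  have : IsIntegrallyClosed (Away (coordGrading f) (coord f i)) :=
    .of_equiv (chartEquiv f i).symm
  let C := Away (coordGrading f) (coord f i * coord f j)
  have hC : IsIntegrallyClosed C := by
    let := (awayMap (coordGrading f) (coord_mem f j) (rfl : coord f i * coord f j = _)).toAlgebra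
    have := Away.isLocalization_mul (coord_mem f i) (coord_mem f j) rfl one_ne_zero
    refine isIntegrallyClosed_of_isLocalization (R := Away (coordGrading f) (coord f i)) C
      (Submonoid.powers (Away.isLocalizationElem (coord_mem f i) (coord_mem f j)))
      (powers_le_nonZeroDivisors_of_noZeroDivisors ?_)
    exact isLocalizationElem_coord_ne_zero f i j
  have hj : IsIntegrallyClosed (Away (coordGrading f) (coord f j)) := by
    let := (awayMap (coordGrading f) (coord_mem f i) (mul_comm (coord f i) (coord f j))).toAlgebra
    have := Away.isLocalization_mul (coord_mem f j) (coord_mem f i)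
      (mul_comm (coord f i) (coord f j)) one_ne_zero
    refine isIntegrallyClosed_of_away
      (c := Away.isLocalizationElem (coord_mem f j) (coord_mem f i)) ?_ ?_ C
    · exact isLocalizationElem_coord_ne_zero f j i
    · intro n z hz
      rw [← map_dvd_iff (chartEquiv f j)] at hz ⊢
      rw [chartEquiv_mk, pow_one, toChartRing_mk] at hz ⊢
      exact hrad n _ (map_pow (chartEquiv f j) z n ▸ hz)
  exact .of_equiv (chartEquiv f j)

theorem isNormalScheme_of_chartRing (h : ∀ i, IsIntegrallyClosed (ChartRing f i)) :
    IsNormalScheme (surface f) := by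
  intro x
  obtain ⟨i, y, rfl⟩ := exists_chart_eq f x
  obtain ⟨e⟩ := nonempty_stalkEquiv f i y
  have := isDomain_chartRing f i
  have := h i
  have : IsDomain (Localization.AtPrime y.asIdeal) :=
    IsLocalization.isDomain_localization (Ideal.primeCompl_le_nonZeroDivisors y.asIdeal)
  have : IsIntegrallyClosed (Localization.AtPrime y.asIdeal) :=
    isIntegrallyClosed_of_isLocalization _ _ (Ideal.primeCompl_le_nonZeroDivisors y.asIdeal)
  exact isDomain_and_isIntegrallyClosed_of_equiv (S := Localization.AtPrime y.asIdeal) e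

end ChartNormal

/-! ### Radical ideals generated by a coordinate -/

section Radical

variable {k : Type u} [Field k]

/-- The substitution `y_l ↦ 0`. -/
noncomputable def restrictZero (l : Fin 3) : MvPolynomial (Fin 3) k →ₐ[k] MvPolynomial (Fin 3) k :=
  aeval (Function.update X l 0)

theorem X_dvd_sub_restrictZero (l : Fin 3) (p : MvPolynomial (Fin 3) k) :
    X l ∣ p - restrictZero l p := by
  induction p using MvPolynomial.induction_on with
  | C c => simp [restrictZero]
  | add p q hp hq =>
    rw [map_add, add_sub_add_comm]
    exact dvd_add hp hq
  | mul_X p j hp =>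
    have h1 : p * X j - restrictZero l (p * X j) =
        (p - restrictZero l p) * X j + restrictZero l p * (X j - restrictZero l (X j)) := by
      rw [map_mul]; ring
    rw [h1]
    refine dvd_add (Dvd.dvd.mul_right hp _) (Dvd.dvd.mul_left ?_ _)
    by_cases hj : j = l
    · subst hj; simp [restrictZero]
    · simp [restrictZero, hj]

/-- A coordinate is radical on a hypersurface if the equation restricted to the hyperplane where
the coordinate vanishes is squarefree. -/
theorem isRadical_mk_X {F : MvPolynomial (Fin 3) k} {l : Fin 3}
    (h : Squarefree (restrictZero l F)) :
    IsRadical (Ideal.Quotient.mk (Ideal.span {F}) (X l)) := by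
  have hX : restrictZero l (X l : MvPolynomial (Fin 3) k) = 0 := by simp [restrictZero]
  have hFmk : Ideal.Quotient.mk (Ideal.span {F}) F = 0 :=
    Ideal.Quotient.eq_zero_iff_mem.mpr (Ideal.mem_span_singleton_self _)
  intro n z hz
  obtain ⟨p, rfl⟩ := Ideal.Quotient.mk_surjective z
  obtain ⟨z, hz⟩ := hz
  obtain ⟨q, rfl⟩ := Ideal.Quotient.mk_surjective z
  rw [← map_pow, ← map_mul, Ideal.Quotient.eq, Ideal.mem_span_singleton] at hz
  obtain ⟨r, hr⟩ := hz
  have h1 := congrArg (restrictZero l) hr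
  rw [map_sub, map_mul, map_mul, hX, zero_mul, sub_zero, map_pow] at h1
  obtain ⟨s, hs⟩ := h.isRadical n _ (Dvd.intro _ h1.symm)
  obtain ⟨a, ha⟩ := X_dvd_sub_restrictZero l p
  obtain ⟨b, hb⟩ := X_dvd_sub_restrictZero l F
  refine ⟨Ideal.Quotient.mk _ (a - b * s), ?_⟩
  have h2 : p = F * s + X l * (a - b * s) := by linear_combination ha - s * hb + hs
  rw [← map_mul]
  conv_lhs => rw [h2]
  rw [map_add, map_mul _ F, hFmk, zero_mul, zero_add]

/-- A multiple factor of `F` divides `F` and its derivatives. -/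
theorem squarefree_of_pderiv {F : MvPolynomial (Fin 3) k}
    (h : ∀ x, x ∣ F → (∀ j, x ∣ pderiv j F) → IsUnit x) : Squarefree F := by
  intro x hx
  refine h x ((Dvd.intro _ rfl).trans hx) fun j => ?_
  obtain ⟨q, rfl⟩ := hx
  rw [Derivation.leibniz, Derivation.leibniz]
  simp only [smul_eq_mul]
  exact ⟨x * pderiv j q + q * (pderiv j x + pderiv j x), by ring⟩

theorem isUnit_of_dvd_X_pow {i j : Fin 3} (hij : i ≠ j) {a b : ℕ} {x : MvPolynomial (Fin 3) k}
    (hi : x ∣ X i ^ a) (hj : x ∣ X j ^ b) : IsUnit x := by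
  have h : IsRelPrime (X i : MvPolynomial (Fin 3) k) (X j) :=
    (X_prime.irreducible.isRelPrime_iff_not_dvd).mpr fun h => hij (X_dvd_X.mp h)
  exact h.pow hi hj

end Radical

/-! ### Graphs and irreducible equations -/

section Graph

variable {k : Type u} [Field k]

/-- The hypersurface `y_2 = -g(y_0, y_1)` is a graph, hence isomorphic to the affine plane. -/
theorem isIntegrallyClosed_quotient_X_add (g : MvPolynomial (Fin 2) k) :
    IsIntegrallyClosed
      (MvPolynomial (Fin 3) k ⧸ Ideal.span {X 2 + rename Fin.castSucc g}) := by
  let φ : MvPolynomial (Fin 3) k →ₐ[k] MvPolynomial (Fin 2) k :=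
    aeval (Fin.snoc (α := fun _ => MvPolynomial (Fin 2) k) X (-g))
  have hφr (p : MvPolynomial (Fin 2) k) : φ (rename Fin.castSucc p) = p := by
    have h : φ.comp (rename Fin.castSucc) = AlgHom.id k _ := by
      ext j
      simp [φ]
    exact DFunLike.congr_fun h p
  have hφ2 : φ (X 2) = -g := by
    simp only [φ, aeval_X]
    exact Fin.snoc_last (α := fun _ => MvPolynomial (Fin 2) k) _ _
  have hφ : Function.Surjective φ := fun p => ⟨_, hφr p⟩
  have hdvd (p : MvPolynomial (Fin 3) k) :
      X 2 + rename Fin.castSucc g ∣ p - rename Fin.castSucc (φ p) := by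
    induction p using MvPolynomial.induction_on with
    | C c => simp [φ]
    | add p q hp hq =>
      rw [map_add, map_add, add_sub_add_comm]
      exact dvd_add hp hq
    | mul_X p j hp =>
      have h1 : p * X j - rename Fin.castSucc (φ (p * X j)) =
          (p - rename Fin.castSucc (φ p)) * X j +
            rename Fin.castSucc (φ p) * (X j - rename Fin.castSucc (φ (X j))) := by
        rw [map_mul, map_mul]; ring
      rw [h1]
      refine dvd_add (Dvd.dvd.mul_right hp _) (Dvd.dvd.mul_left ?_ _)
      induction j using Fin.lastCases with
      | last =>
        change _ ∣ X 2 - rename Fin.castSucc (φ (X 2))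
        rw [hφ2, map_neg, sub_neg_eq_add]
      | cast j =>
        rw [← rename_X (R := k) Fin.castSucc j, hφr, sub_self]
        exact dvd_zero _
  have hker : RingHom.ker φ = Ideal.span {X 2 + rename Fin.castSucc g} := by
    ext p
    rw [RingHom.mem_ker, Ideal.mem_span_singleton]
    constructor
    · intro h
      have := hdvd p
      rwa [h, map_zero, sub_zero] at this
    · rintro ⟨q, rfl⟩
      rw [map_mul, map_add, hφ2, hφr, neg_add_cancel, zero_mul]
  exact .of_equiv ((Ideal.quotEquivOfEq hker.symm).trans
    (RingHom.quotientKerEquivOfSurjective hφ)).symm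

/-- An equation `x_0 ^ 2 * x_3 + g(x_0, x_1, x_2)` is irreducible unless `x_0` divides `g`. -/
theorem isDomain_coordRing {f : CubicForm k} {g : MvPolynomial (Fin 3) k}
    (hf : f.1 = X 0 ^ 2 * X 3 + rename Fin.castSucc g) (v : Fin 4 → k) (hv : v 0 = 0)
    (hg : eval v (rename Fin.castSucc g) ≠ 0) : IsDomain (CoordRing f) := by
  have hX : ¬ X 0 ∣ rename Fin.castSucc g := by
    rintro ⟨q, hq⟩
    rw [hq, map_mul, eval_X, hv, zero_mul] at hg
    exact hg rfl
  have hirr : Irreducible f.1 := by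
    rw [hf]
    refine irreducible_mul_X_add _ _ 3 (pow_ne_zero 2 (X_ne_zero 0)) (fun h => ?_) (fun h => ?_)
      (X_prime.irreducible.isRelPrime_iff_not_dvd.mpr hX).pow_left
    · have := vars_pow _ _ h
      rw [vars_X] at this
      exact absurd (Finset.mem_singleton.mp this) (by decide)
    · classical
      obtain ⟨j, -, hj⟩ := Finset.mem_image.mp (vars_rename _ _ h)
      exact absurd hj (Fin.castSucc_lt_last j).ne
  exact (Ideal.Quotient.isDomain_iff_prime _).mpr
    ((Ideal.span_singleton_prime hirr.ne_zero).mpr hirr.prime)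

end Graph

/-! ### The point `[0 : 0 : 0 : 1]` on the normal forms -/

section CoordinatePoint

variable (k : Type u) [Field k]

theorem X_mem_span_image {s : Set (Fin 4)} {i : Fin 4} (hi : i ∈ s) :
    (X i : MvPolynomial (Fin 4) k) ∈ Ideal.span (X '' s) :=
  Ideal.subset_span ⟨i, hi, rfl⟩

theorem exists_coordLocus_normalForm_eq_singleton (i : Fin 5)
    (hi : i ∈ ({1, 2, 3, 4} : Set (Fin 5))) :
    ∃ P, coordLocus (normalForm k i) {0, 1, 2} = {P} := by
  have hX (i : Fin 4) (hi : i ∈ ({0, 1, 2} : Set (Fin 4))) := X_mem_span_image k hi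
  have hsq (i : Fin 4) (n : ℕ) (hi : i ∈ ({0, 1, 2} : Set (Fin 4))) :
      (X i : MvPolynomial (Fin 4) k) ^ (n + 1) ∈ Ideal.span (X '' {0, 1, 2}) :=
    Ideal.pow_mem_of_mem _ (hX i hi) _ n.succ_pos
  refine exists_coordLocus_eq_singleton ?_
  rcases hi with rfl | rfl | rfl | rfl
  · exact add_mem (add_mem (Ideal.mul_mem_right _ _ (hsq 0 1 (by simp))) (hsq 1 2 (by simp)))
      (Ideal.mul_mem_right _ _ (hX 0 (by simp)))
  · exact add_mem (add_mem (Ideal.mul_mem_right _ _ (hsq 0 1 (by simp)))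
      (Ideal.mul_mem_left _ _ (hX 2 (by simp)))) (Ideal.mul_mem_right _ _ (hX 0 (by simp)))
  · exact add_mem (add_mem (Ideal.mul_mem_right _ _ (hsq 0 1 (by simp))) (hsq 1 2 (by simp)))
      (hsq 2 2 (by simp))
  · exact add_mem (Ideal.mul_mem_left _ _ (hX 2 (by simp)))
      (Ideal.mul_mem_right _ _ (hsq 1 1 (by simp)))

end CoordinatePoint

/-! ### Normality of the normal forms -/

section NormalForms

variable {k : Type u} [Field k]

theorem dehom_X (j i : Fin 4) : dehom j (X i : MvPolynomial (Fin 4) k) =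
    (![![1, X 0, X 1, X 2], ![X 0, 1, X 1, X 2], ![X 0, X 1, 1, X 2], ![X 0, X 1, X 2, 1]] :
      Fin 4 → Fin 4 → MvPolynomial (Fin 3) k) j i := by
  by_cases h : i = j
  · subst h
    rw [dehom_X_self]
    fin_cases i <;> rfl
  · obtain ⟨l, rfl⟩ := Fin.exists_succAbove_eq h
    rw [dehom_X_succAbove]
    fin_cases j <;> fin_cases l <;> rfl

theorem restrictZero_X (l j : Fin 3) :
    restrictZero l (X j : MvPolynomial (Fin 3) k) = if j = l then 0 else X j := by
  simp [restrictZero, Function.update_apply]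

theorem isIntegrallyClosed_chartRing_zero {f : CubicForm k} (g : MvPolynomial (Fin 2) k)
    (hf : dehom 0 f.1 = X 2 + rename Fin.castSucc g) : IsIntegrallyClosed (ChartRing f 0) := by
  unfold ChartRing
  rw [hf]
  exact isIntegrallyClosed_quotient_X_add g

/-- Normality passes from the chart of `x_i`, `i = j.succAbove l`, to that of `x_j` if the curve
`x_i = 0` on the latter is reduced. -/
theorem isIntegrallyClosed_chartRing_of_squarefree {f : CubicForm k} [IsDomain (CoordRing f)]
    (j : Fin 4) (l : Fin 3) (h : IsIntegrallyClosed (ChartRing f (j.succAbove l)))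
    {p : MvPolynomial (Fin 3) k} (hp : restrictZero l (dehom j f.1) = p) (hsq : Squarefree p) :
    IsIntegrallyClosed (ChartRing f j) := by
  refine isIntegrallyClosed_chartRing f h ?_
  rw [dehom_X_succAbove]
  exact isRadical_mk_X (hp ▸ hsq)

theorem isUnit_of_dvd_add_one {x : MvPolynomial (Fin 3) k} {p : MvPolynomial (Fin 3) k}
    (h : x ∣ p) (h1 : x ∣ p + 1) : IsUnit x :=
  isUnit_of_dvd_one ((dvd_add_right h).mp h1)

theorem squarefree_add_X (i j : Fin 3) (hij : i ≠ j) (n : ℕ) :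
    Squarefree (X i ^ n + X j : MvPolynomial (Fin 3) k) := by
  refine squarefree_of_pderiv fun x hx h => isUnit_of_dvd_one ?_
  have := h j
  rwa [map_add, pderiv_pow, pderiv_X_of_ne hij, mul_zero, zero_add, pderiv_X_self] at this

variable [CharP k 2]

theorem pderiv_X_pow_two (i j : Fin 3) : pderiv i (X j ^ 2 : MvPolynomial (Fin 3) k) = 0 := by
  rw [pderiv_pow]; simp [CharTwo.two_eq_zero]

theorem pderiv_X_pow_three (i : Fin 3) :
    pderiv i (X i ^ 3 : MvPolynomial (Fin 3) k) = X i ^ 2 := by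
  rw [pderiv_pow, pderiv_X_self]
  linear_combination X i ^ 2 * CharTwo.two_eq_zero (R := MvPolynomial (Fin 3) k)

theorem squarefree_X_pow_two_add_X_mul :
    Squarefree (X 0 ^ 2 + X 0 * X 2 ^ 2 : MvPolynomial (Fin 3) k) := by
  refine squarefree_of_pderiv fun x hx h => ?_
  have h0 := h 0
  rw [map_add, pderiv_X_pow_two, zero_add, pderiv_mul, pderiv_X_self, pderiv_X_pow_two, mul_zero,
    add_zero, one_mul] at h0
  exact isUnit_of_dvd_X_pow (i := 0) (j := 2) (by decide) ((dvd_add_left (h0.mul_left _)).mp hx) h0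

theorem squarefree_X_pow_three_add_one (i : Fin 3) :
    Squarefree (X i ^ 3 + 1 : MvPolynomial (Fin 3) k) := by
  refine squarefree_of_pderiv fun x hx h => ?_
  have h0 := h i
  rw [map_add, pderiv_X_pow_three, pderiv_one, add_zero] at h0
  exact isUnit_of_dvd_add_one (by rw [pow_succ]; exact h0.mul_right _) hx

theorem squarefree_X_pow_two_add_X_pow_three :
    Squarefree (X 0 ^ 2 + X 1 ^ 3 : MvPolynomial (Fin 3) k) := by
  refine squarefree_of_pderiv fun x hx h => ?_
  have h0 := h 1
  rw [map_add, pderiv_X_pow_three, pderiv_X_pow_two, zero_add] at h0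
  refine isUnit_of_dvd_X_pow (i := 0) (j := 1) (by decide) ((dvd_add_left ?_).mp hx) h0
  rw [pow_succ]
  exact h0.mul_right _

/-- The chart where `x_0` is one is an affine plane. Normality spreads from it to the charts of
`x_1`, `x_3`, `x_2`, in this order: on each of them, the coordinate that is one on the previous
chart cuts out a reduced curve, which may be empty. -/
theorem isNormalScheme_normalForm_one : IsNormalScheme (surface (normalForm k 1)) := by
  have : IsDomain (CoordRing (normalForm k 1)) :=
    isDomain_coordRing (g := X 1 ^ 3 + X 0 * X 2 ^ 2) (by simp [normalForm, normalPoly, add_assoc])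
      ![0, 1, 0, 0] rfl (by simp)
  have h0 : IsIntegrallyClosed (ChartRing (normalForm k 1) 0) :=
    isIntegrallyClosed_chartRing_zero (X 0 ^ 3 + X 1 ^ 2) (by
      simp [normalForm, normalPoly, dehom_X, add_assoc])
  have h1 := isIntegrallyClosed_chartRing_of_squarefree (f := normalForm k 1) 1 0 h0 (by
      simp [normalForm, normalPoly, dehom_X, restrictZero_X])
      squarefree_one
  have h3 := isIntegrallyClosed_chartRing_of_squarefree (f := normalForm k 1) 3 1 h1 (by
      simp [normalForm, normalPoly, dehom_X, restrictZero_X])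
      squarefree_X_pow_two_add_X_mul
  have h2 := isIntegrallyClosed_chartRing_of_squarefree (f := normalForm k 1) 2 2 h3 (by
      simp [normalForm, normalPoly, dehom_X, restrictZero_X])
      (squarefree_add_X (k := k) 1 0 (by decide) 3)
  exact isNormalScheme_of_chartRing _ fun i => by fin_cases i <;> assumption

/-- Normality spreads through the charts of `x_0`, `x_1`, `x_3`, `x_2`, in this order. -/
theorem isNormalScheme_normalForm_two : IsNormalScheme (surface (normalForm k 2)) := by
  have : IsDomain (CoordRing (normalForm k 2)) :=
    isDomain_coordRing (g := X 1 ^ 2 * X 2 + X 0 * X 2 ^ 2)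
      (by simp [normalForm, normalPoly, add_assoc]) ![0, 1, 1, 0] rfl (by simp)
  have h0 : IsIntegrallyClosed (ChartRing (normalForm k 2) 0) :=
    isIntegrallyClosed_chartRing_zero (X 0 ^ 2 * X 1 + X 1 ^ 2) (by
      simp [normalForm, normalPoly, dehom_X, add_assoc])
  have h1 := isIntegrallyClosed_chartRing_of_squarefree (f := normalForm k 2) 1 0 h0 (by
      simp [normalForm, normalPoly, dehom_X, restrictZero_X])
      (X_prime (i := 1)).irreducible.squarefree
  have h3 := isIntegrallyClosed_chartRing_of_squarefree (f := normalForm k 2) 3 1 h1 (by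
      simp [normalForm, normalPoly, dehom_X, restrictZero_X])
      squarefree_X_pow_two_add_X_mul
  have h2 := isIntegrallyClosed_chartRing_of_squarefree (f := normalForm k 2) 2 2 h3 (by
      simp [normalForm, normalPoly, dehom_X, restrictZero_X])
      (squarefree_add_X (k := k) 1 0 (by decide) 2)
  exact isNormalScheme_of_chartRing _ fun i => by fin_cases i <;> assumption

/-- Normality spreads from the chart of `x_0`, an affine plane, to those of `x_1` and `x_2`, and
from the latter to that of `x_3`. -/
theorem isNormalScheme_normalForm_three : IsNormalScheme (surface (normalForm k 3)) := by
  have : IsDomain (CoordRing (normalForm k 3)) :=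
    isDomain_coordRing (g := X 1 ^ 3 + X 2 ^ 3)
      (by simp [normalForm, normalPoly, add_assoc]) ![0, 1, 0, 0] rfl (by simp)
  have h0 : IsIntegrallyClosed (ChartRing (normalForm k 3) 0) :=
    isIntegrallyClosed_chartRing_zero (X 0 ^ 3 + X 1 ^ 3) (by
      simp [normalForm, normalPoly, dehom_X, add_assoc])
  have h1 := isIntegrallyClosed_chartRing_of_squarefree (f := normalForm k 3) 1 0 h0 (by
      simp [normalForm, normalPoly, dehom_X, restrictZero_X, add_comm])
      (squarefree_X_pow_three_add_one (k := k) 1)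
  have h2 := isIntegrallyClosed_chartRing_of_squarefree (f := normalForm k 3) 2 0 h0 (by
      simp [normalForm, normalPoly, dehom_X, restrictZero_X])
      (squarefree_X_pow_three_add_one (k := k) 1)
  have h3 := isIntegrallyClosed_chartRing_of_squarefree (f := normalForm k 3) 3 2 h2 (by
      simp [normalForm, normalPoly, dehom_X, restrictZero_X])
      squarefree_X_pow_two_add_X_pow_three
  exact isNormalScheme_of_chartRing _ fun i => by fin_cases i <;> assumption

/-- At the point `[0 : 0 : 0 : 1]` the fraction `x_1 / x_0` is integral, as its square is `x_2`,
but not regular, as the local equation `x_0 ^ 2 * x_2 + x_1 ^ 2` has derivative zero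
with respect to `x_1`. -/
theorem not_isNormalScheme_normalForm_four : ¬ IsNormalScheme (surface (normalForm k 4)) := by
  intro hN
  set f := normalForm k 4 with hf
  have hF : dehom 3 f.1 = X 0 ^ 2 * X 2 + X 1 ^ 2 := by
    simp [hf, normalForm, normalPoly, dehom_X]
  obtain ⟨P, hP⟩ := exists_coordLocus_normalForm_eq_singleton k 4 (by simp)
  obtain ⟨i, y, rfl⟩ := exists_chart_eq f P
  have hmem : chart f i y ∈ coordLocus f {0, 1, 2} := hP ▸ rfl
  rw [chart_mem_coordLocus_iff] at hmem
  have hi : i = 3 := by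
    by_contra hi
    have := hmem i (by fin_cases i <;> simp_all)
    rw [dehom_X_self, map_one] at this
    exact y.2.one_notMem this
  subst hi
  let mk := Ideal.Quotient.mk (Ideal.span {dehom 3 f.1})
  have h0 : mk (X 0) ∈ y.asIdeal := dehom_X_succAbove (k := k) 3 0 ▸ hmem 0 (by simp)
  have h1 : mk (X 1) ∈ y.asIdeal := dehom_X_succAbove (k := k) 3 1 ▸ hmem 1 (by simp)
  obtain ⟨e⟩ := nonempty_stalkEquiv f 3 y
  let L := Localization.AtPrime y.asIdeal
  obtain ⟨hd, hc⟩ := hN (chart f 3 y)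
  obtain ⟨hd, hc⟩ := isDomain_and_isIntegrallyClosed_of_equiv (R := L) e.symm
  have hrel : mk (X 1) ^ 2 = mk (X 0) ^ 2 * -mk (X 2) := by
    have : mk (X 0 ^ 2 * X 2 + X 1 ^ 2) = 0 := Ideal.Quotient.eq_zero_iff_mem.mpr
      (hF ▸ Ideal.mem_span_singleton_self _)
    rw [map_add, map_mul, map_pow, map_pow] at this
    linear_combination this
  have hdvd : algebraMap _ L (mk (X 0)) ∣ algebraMap _ L (mk (X 1)) := by
    rw [← IsIntegrallyClosed.pow_dvd_pow_iff two_ne_zero, ← map_pow (algebraMap _ L),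
      ← map_pow (algebraMap _ L), hrel, map_mul]
    exact dvd_mul_right _ _
  obtain ⟨z, hz⟩ := hdvd
  obtain ⟨⟨c, s⟩, hcs⟩ := IsLocalization.surj y.asIdeal.primeCompl z
  have h2 : algebraMap _ L (mk (X 1) * s) = algebraMap _ L (mk (X 0) * c) := by
    rw [map_mul, map_mul, hz, mul_assoc, hcs]
  obtain ⟨t, ht⟩ := (IsLocalization.eq_iff_exists y.asIdeal.primeCompl L).mp h2
  obtain ⟨S, hS⟩ := Ideal.Quotient.mk_surjective ((t * s : y.asIdeal.primeCompl) : ChartRing f 3)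
  obtain ⟨T, hT⟩ := Ideal.Quotient.mk_surjective ((t : ChartRing f 3) * c)
  have h3 : mk (S * X 1) = mk (T * X 0) := by
    rw [map_mul, map_mul, hS, hT]
    simp only [Submonoid.coe_mul]
    linear_combination ht
  obtain ⟨q, hq⟩ := Ideal.mem_span_singleton.mp (Ideal.Quotient.eq.mp h3)
  have hdF : pderiv 1 (dehom 3 f.1) = 0 := by
    rw [hF, map_add, pderiv_mul, pderiv_X_pow_two, pderiv_X_pow_two,
      pderiv_X_of_ne (by decide)]
    simp
  -- As `x_1 * S = x_0 * T` modulo the equation, whose derivative vanishes, `S` lies in `y`.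
  have h4 := congrArg (pderiv 1) hq
  rw [map_sub, pderiv_mul, pderiv_mul, pderiv_mul, hdF, pderiv_X_self,
    pderiv_X_of_ne (by decide)] at h4
  have h5 : mk S ∈ y.asIdeal := by
    have h6 : mk S = mk (pderiv 1 T) * mk (X 0) - mk (pderiv 1 S) * mk (X 1) := by
      have : mk (dehom 3 f.1 * pderiv 1 q) = 0 := Ideal.Quotient.eq_zero_iff_mem.mpr
        (Ideal.mem_span_singleton.mpr (dvd_mul_right _ _))
      rw [← map_mul, ← map_mul, ← map_sub, ← sub_eq_zero, ← map_sub, ← this]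
      congr 1
      linear_combination h4
    rw [h6]
    exact sub_mem (Ideal.mul_mem_left _ _ h0) (Ideal.mul_mem_left _ _ h1)
  exact (t * s).2 (hS ▸ h5)

end NormalForms

/-! ### Singular loci of the normal forms -/

section SingularLoci

variable (k : Type u) [Field k] [CharP k 2]

theorem normalPoly_ne_zero (i : Fin 5) : normalPoly k i ≠ 0 := by
  intro h
  have := isNondegenerate_normalPoly (k := k) i 1 0
  rw [h, map_zero, vars_0] at this
  exact absurd this (Finset.notMem_empty _)

theorem singularLocus_normalForm (i : Fin 5) {s : Set (Fin 4)}
    (hf2 : normalPoly k i ∈ Ideal.span (X '' s) ^ 2)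
    (hs : ∀ j ∈ s, ∃ l, pderiv l (normalPoly k i) = X j ^ 2) :
    singularLocus (surface (normalForm k i)) = coordLocus (normalForm k i) s :=
  singularLocus_eq_coordLocus (normalPoly_eq_frobForm i) (normalPoly_ne_zero k i) hf2 hs

theorem pderiv_normalPoly :
    pderiv 3 (normalPoly k 1) = X 0 ^ 2 ∧ pderiv 1 (normalPoly k 1) = X 1 ^ 2 ∧
    pderiv 0 (normalPoly k 1) = X 2 ^ 2 ∧ pderiv 3 (normalPoly k 2) = X 0 ^ 2 ∧
    pderiv 2 (normalPoly k 2) = X 1 ^ 2 ∧ pderiv 0 (normalPoly k 2) = X 2 ^ 2 ∧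
    pderiv 3 (normalPoly k 3) = X 0 ^ 2 ∧ pderiv 1 (normalPoly k 3) = X 1 ^ 2 ∧
    pderiv 2 (normalPoly k 3) = X 2 ^ 2 ∧ pderiv 2 (normalPoly k 4) = X 0 ^ 2 ∧
    pderiv 3 (normalPoly k 4) = X 1 ^ 2 := by
  have h2 : (2 : MvPolynomial (Fin 4) k) = 0 := CharTwo.two_eq_zero
  have h3 : (3 : MvPolynomial (Fin 4) k) = 1 := by linear_combination h2
  refine ⟨?_, ?_, ?_, ?_, ?_, ?_, ?_, ?_, ?_, ?_, ?_⟩ <;> simp [normalPoly, pderiv_X, h2, h3]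

/-- Three partial derivatives of each of these forms are the squares of `x_0`, `x_1` and `x_2`. -/
theorem singularLocus_normalForm_isolated (i : Fin 5) (hi : i ∈ ({1, 2, 3} : Set (Fin 5))) :
    singularLocus (surface (normalForm k i)) = coordLocus (normalForm k i) {0, 1, 2} := by
  have hsq (i : Fin 4) (hi : i ∈ ({0, 1, 2} : Set (Fin 4))) (q : MvPolynomial (Fin 4) k) :
      X i ^ 2 * q ∈ Ideal.span (X '' ({0, 1, 2} : Set (Fin 4))) ^ 2 :=
    Ideal.mul_mem_right _ _ (Ideal.pow_mem_pow (X_mem_span_image k hi) 2)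
  have h0 := hsq 0 (by simp)
  have h1 := hsq 1 (by simp)
  have h2 := hsq 2 (by simp)
  have h2' : (X 0 * X 2 ^ 2 : MvPolynomial (Fin 4) k) ∈
      Ideal.span (X '' ({0, 1, 2} : Set (Fin 4))) ^ 2 := by
    rw [mul_comm]
    exact h2 (X 0)
  obtain ⟨d1, d2, d3, d4, d5, d6, d7, d8, d9, -, -⟩ := pderiv_normalPoly k
  rcases hi with rfl | rfl | rfl
  · refine singularLocus_normalForm k 1 (add_mem (add_mem (h0 _) (h1 (X 1))) h2') ?_
    rintro j (rfl | rfl | rfl)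
    exacts [⟨3, d1⟩, ⟨1, d2⟩, ⟨0, d3⟩]
  · refine singularLocus_normalForm k 2 (add_mem (add_mem (h0 _) (h1 _)) h2') ?_
    rintro j (rfl | rfl | rfl)
    exacts [⟨3, d4⟩, ⟨2, d5⟩, ⟨0, d6⟩]
  · refine singularLocus_normalForm k 3 (add_mem (add_mem (h0 _) (h1 (X 1))) (h2 (X 2))) ?_
    rintro j (rfl | rfl | rfl)
    exacts [⟨3, d7⟩, ⟨1, d8⟩, ⟨2, d9⟩]

theorem singularLocus_normalForm_four :
    singularLocus (surface (normalForm k 4)) = coordLocus (normalForm k 4) {0, 1} := by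
  obtain ⟨-, -, -, -, -, -, -, -, -, d1, d2⟩ := pderiv_normalPoly k
  refine singularLocus_normalForm k 4 ?_ ?_
  · exact add_mem (Ideal.mul_mem_right _ _ (Ideal.pow_mem_pow (X_mem_span_image k (by simp)) 2))
      (Ideal.mul_mem_right _ _ (Ideal.pow_mem_pow (X_mem_span_image k (by simp)) 2))
  · rintro j (rfl | rfl)
    exacts [⟨2, d1⟩, ⟨3, d2⟩]

end SingularLoci

/-! ### Classification of the surfaces that are not Frobenius split -/

section LinearEquivalence

variable {k : Type u} [Field k]

theorem linearSubst_linearSubst {n : ℕ} (g h : Matrix (Fin n) (Fin n) k)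
    (p : MvPolynomial (Fin n) k) :
    linearSubst g (linearSubst h p) = linearSubst (h * g) p := by
  have : (linearSubst g).comp (linearSubst h) = linearSubst (h * g) := by
    ext1 i
    simp only [linearSubst, AlgHom.comp_apply, aeval_X, map_sum, map_mul, algHom_C, algebraMap_eq,
      Matrix.mul_apply, Finset.sum_mul, Finset.mul_sum, mul_assoc]
    exact Finset.sum_comm
  exact DFunLike.congr_fun this p

theorem linearSubst_one {n : ℕ} (p : MvPolynomial (Fin n) k) : linearSubst 1 p = p := by
  have : linearSubst (1 : Matrix (Fin n) (Fin n) k) = AlgHom.id k _ := by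
    ext1 i
    simp [linearSubst, Matrix.one_apply]
  exact DFunLike.congr_fun this p

theorem LinearlyEquivalent.symm {n : ℕ} {p q : MvPolynomial (Fin n) k}
    (h : LinearlyEquivalent p q) : LinearlyEquivalent q p := by
  obtain ⟨g, rfl⟩ := h
  exact ⟨g⁻¹, by rw [linearSubst_linearSubst, ← Units.val_mul, mul_inv_cancel, Units.val_one,
    linearSubst_one]⟩

theorem LinearlyEquivalent.trans {n : ℕ} {p q r : MvPolynomial (Fin n) k}
    (h : LinearlyEquivalent p q) (h' : LinearlyEquivalent q r) : LinearlyEquivalent p r := by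
  obtain ⟨g, rfl⟩ := h
  obtain ⟨g', rfl⟩ := h'
  exact ⟨g * g', by rw [linearSubst_linearSubst, Units.val_mul]⟩

variable [CharP k 2]

theorem not_isFrobeniusSplit_of_linearlyEquivalent {f : CubicForm k} {i : Fin 5}
    (h : LinearlyEquivalent f.1 (normalForm k i).1) : ¬ IsFrobeniusSplit 2 (surface f) := by
  obtain ⟨g, hg⟩ := h.symm
  refine not_isFrobeniusSplit (hg.symm.trans ((congrArg _ (normalPoly_eq_frobForm i)).trans
    (linearSubst_frobForm _ _))) fun hf0 => ?_
  obtain ⟨g, hg⟩ := h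
  rw [hf0, map_zero] at hg
  exact normalPoly_ne_zero k i hg.symm

theorem exists_eq_frobForm_of_not_isFrobeniusSplit [PerfectRing k 2] {f : CubicForm k}
    (h : ¬ IsFrobeniusSplit 2 (surface f)) : ∃ M, f.1 = frobForm M :=
  exists_eq_frobForm ((mem_homogeneousSubmodule _ _).mp f.2) fun _ =>
    by_contra fun hl => h (isFrobeniusSplit_of_coeff_ne_zero f hl)

/-- Smoothness makes the left kernel trivial, hence the right kernel as well, so that the pairing
has an orthonormal basis. -/
theorem linearlyEquivalent_fermat_of_smooth [IsAlgClosed k] {f : CubicForm k} (hf0 : f ≠ 0)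
    (hs : Smooth (surfaceToSpec f)) (h : ¬ IsFrobeniusSplit 2 (surface f)) :
    LinearlyEquivalent f.1 (normalForm k 0).1 := by
  obtain ⟨M, hM⟩ := exists_eq_frobForm_of_not_isFrobeniusSplit h
  rw [hM]
  refine linearlyEquivalent_fermat M fun v hv => by_contra fun hv0 => ?_
  obtain ⟨l, hl0, hl⟩ := (isFrobeniusPairing_pairing M).exists_left_kernel hv0 hv
  exact hl0 (pairing_left_kernel_eq_zero_of_smooth hM (fun h0 => hf0 (Subtype.ext h0)) hs hl)

end LinearEquivalence

end CubicSurface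


theorem theorem4p1 (k : Type u) [Field k] [IsAlgClosed k] [CharP k 2] :
    -- the classification
    (∀ h : CubicForm k, IsNondegenerate h.1 →
      (¬ IsFrobeniusSplit 2 (surface h) ↔
        ∃! i : Fin 5, LinearlyEquivalent h.1 (normalForm k i).1)) ∧
    -- the five forms are non-degenerate and pairwise inequivalent
    (∀ i : Fin 5, IsNondegenerate (normalForm k i).1) ∧
    (∀ i j : Fin 5, i ≠ j → ¬ LinearlyEquivalent (normalForm k i).1 (normalForm k j).1) ∧
    -- the first one is smooth, and the only smooth one that is not Frobenius split
    Smooth (surfaceToSpec (normalForm k 0)) ∧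
    ¬ IsFrobeniusSplit 2 (surface (normalForm k 0)) ∧
    (∀ h : CubicForm k, h ≠ 0 → Smooth (surfaceToSpec h) → ¬ IsFrobeniusSplit 2 (surface h) →
      LinearlyEquivalent h.1 (normalForm k 0).1) ∧
    -- the next three are normal, and their only singular point is `[0 : 0 : 0 : 1]`
    (∀ i ∈ ({1, 2, 3} : Set (Fin 5)), IsNormalScheme (surface (normalForm k i)) ∧
      ∃ P : surface (normalForm k i), coordLocus (normalForm k i) {0, 1, 2} = {P} ∧
        singularLocus (surface (normalForm k i)) = {P}) ∧
    -- the last one is not normal, and its singular locus is the line `x₁ = x₂ = 0`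
    ¬ IsNormalScheme (surface (normalForm k 4)) ∧
    singularLocus (surface (normalForm k 4)) = coordLocus (normalForm k 4) {0, 1} := by
  refine ⟨fun h hh => ⟨fun hns => ?_, fun ⟨i, hi, _⟩ => ?_⟩, isNondegenerate_normalPoly,
    fun i j hij => not_linearlyEquivalent_normalPoly hij, smooth_fermat, ?_,
    fun h h0 hs hns => linearlyEquivalent_fermat_of_smooth h0 hs hns, fun i hi => ⟨?_, ?_⟩,
    not_isNormalScheme_normalForm_four, singularLocus_normalForm_four k⟩
  · obtain ⟨M, hM⟩ := exists_eq_frobForm_of_not_isFrobeniusSplit hns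
    obtain ⟨i, hi⟩ := exists_linearlyEquivalent_normalPoly M (hM ▸ hh)
    have hi' : LinearlyEquivalent h.1 (normalForm k i).1 := hM ▸ hi
    exact ⟨i, hi', fun j hj => by_contra fun hji =>
      not_linearlyEquivalent_normalPoly hji (hj.symm.trans hi')⟩
  · exact not_isFrobeniusSplit_of_linearlyEquivalent hi
  · exact not_isFrobeniusSplit (normalPoly_eq_frobForm 0) (normalPoly_ne_zero k 0)
  · rcases hi with rfl | rfl | rfl
    exacts [isNormalScheme_normalForm_one, isNormalScheme_normalForm_two,
      isNormalScheme_normalForm_three]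
  · obtain ⟨P, hP⟩ := exists_coordLocus_normalForm_eq_singleton k i
      (by rcases hi with rfl | rfl | rfl <;> simp)
    exact ⟨P, hP, (singularLocus_normalForm_isolated k i hi).trans hP⟩
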